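/- Work in intuitionistic linear logic with connectives $\otimes, \&, \multimap, {!}$ over a set of atoms, proofs being sequent calculus proofs considered up to cut-elimination equivalence (the equivalence relation generated by the cut-elimination transformations, including $\eta$-expansion of axioms and the laws making contraction commutative and associative with unit weakening). Write $A^m = A \,\&\, \cdots \,\&\, A$ ($m\ge 1$ copies) and, for $n \ge 1$, $$\mathbf{bint}_A = {!}(A\multimap A)\multimap({!}(A\multimap A)\multimap(A\multimap A)),\qquad {}_n\mathbf{bool}_A = A^n\multimap A,\qquad \mathbf{Tur}_A = {!}\mathbf{bint}_A\otimes{!}\mathbf{bint}_A\otimes{!}\,{}_n\mathbf{bool}_A .$$ Let $M$ be a Turing machine with states $Q=\{0,\dots,n-1\}$, tape alphabet $\Sigma=\{0,1\}$ with blank $0$, and transition function $\delta:\Sigma\times Q\to\Sigma\times Q\times\{\text{left},\text{right}\}$. A configuration is a triple $\langle S,T,q\rangle$ with $S,T\in\Sigma^*$, $q\in Q$, where $S$ is the tape to the left of the head including the scanned square and $T$ is the reversal of the tape to its right. With $\delta(\sigma,q)=(\sigma',q',d)$, one transition step sends $\langle S\sigma,T\tau,q\rangle$ to $\langle S,T\tau\sigma',q'\rangle$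 if $d=\text{left}$ and to $\langle S\sigma'\tau,T,q'\rangle$ if $d=\text{right}$; an empty word is treated as having last letter $0$ and being empty after its removal. The configuration $\langle S,T,q\rangle$ is represented on $A$ by the proof $\operatorname{prom}(\underline S_A)\otimes\operatorname{prom}(\underline T_A)\otimes\operatorname{prom}(\underline q_A)$ of $\vdash\mathbf{Tur}_A$, where $\underline S_A$, $\underline T_A$, $\underline q_A$ are the standard proofs of $\vdash\mathbf{bint}_A$ and $\vdash{}_n\mathbf{bool}_A$ for these values. A proof of $\mathbf{Tur}_B\vdash\mathbf{Tur}_A$ encodes $p$ transition steps if for every configuration $c$ its cut against the representation of $c$ on $B$ is equivalent under cut-elimination to the representation on $A$ of the configuration $p$ steps after $c$. Then there are proofs $\mathrm{step}_A$ of $\mathbf{Tur}_{A^3}\vdash\mathbf{Tur}_A$, one for each formula $A$, such that for every formula $A$ and every $p\ge 1$: 1. the proof of $\mathbf{Tur}_{A_p}\vdash\mathbf{Tur}_A$ obtained by cutting together $\mathrm{step}_{A_{p-1}},\dots,\mathrm{step}_{A_1},\mathrm{step}_{A_0}$, where $A_0=A$ and $A_{i+1}=(A_i)^3$, encodes $p$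 transition steps of $M$; 2. there is a proof of $\mathbf{Tur}_{A^{3^p}}\vdash\mathbf{Tur}_A$, with $A^{3^p}$ the product of $3^p$ copies of $A$ in its standard (right-nested) bracketing, that encodes $p$ transition steps of $M$. -/

import Mathlib

/-! Intuitionistic linear logic with connectives tensor, with, linear implication and bang. -/

namespace ILL

/-- Formulas (types) of linear logic over a set `α` of atomic formulas. -/
inductive Formula (α : Type*) where
  | atom : α → Formula α
  | tensor : Formula α → Formula α → Formula α
  | with : Formula α → Formula α → Formula α
  | lolli : Formula α → Formula α → Formula α
  | bang : Formula α → Formula α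

infixr:70 " ⊗ₗ " => Formula.tensor
infixr:70 " &ₗ " => Formula.with
infixr:65 " ⊸ₗ " => Formula.lolli
prefix:80 "!ₗ" => Formula.bang

/-- Proof trees of the sequent calculus, one constructor for each rule. The formula occurrences on
the left of a sequent carry names (natural numbers), so that the exchange rule leaves no trace in
the tree. In a left rule the first name is the principal hypothesis of the conclusion, and the
names directly before a subtree are those of the active hypotheses in that premise. -/
inductive Term (α : Type*) where
  | ax : ℕ → Term α
  | cut : Formula α → Term α → ℕ → Term α → Term α
  | tensorR : Term α → Term α → Term α
  | tensorL : ℕ → ℕ → ℕ → Term α → Term α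
  | lolliR : ℕ → Term α → Term α
  | lolliL : ℕ → Term α → ℕ → Term α → Term α
  | withR : Term α → Term α → Term α
  | withL₀ : ℕ → ℕ → Term α → Term α
  | withL₁ : ℕ → ℕ → Term α → Term α
  | prom : Term α → Term α
  | der : ℕ → ℕ → Term α → Term α
  | wk : ℕ → Term α → Term α
  | ctr : ℕ → ℕ → ℕ → Term α → Term α

/-- The left-hand side of a sequent: a list of named formulas. -/
abbrev Ctx (α : Type*) := List (ℕ × Formula α)

/-- The names that occur in a context. -/
def Ctx.names {α : Type*} (Γ : Ctx α) : List ℕ := Γ.map Prod.fst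

/-- `Derivation Γ t A`: the tree `t` is a proof of the sequent `Γ ⊢ A`. The names in the context of a
derivable sequent are pairwise distinct. -/
inductive Derivation {α : Type*} : Ctx α → Term α → Formula α → Prop
  | ax (x : ℕ) (A : Formula α) : Derivation [(x, A)] (.ax x) A
  | exch {Γ Δ : Ctx α} {t : Term α} {A : Formula α} :
      Γ.Perm Δ → Derivation Γ t A → Derivation Δ t A
  | cut {Γ Δ : Ctx α} {t u : Term α} {x : ℕ} {A B : Formula α} :
      Derivation Γ t A → Derivation ((x, A) :: Δ) u B → Γ.names.Disjoint Δ.names →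
      Derivation (Γ ++ Δ) (.cut A t x u) B
  | tensorR {Γ Δ : Ctx α} {t u : Term α} {A B : Formula α} :
      Derivation Γ t A → Derivation Δ u B → Γ.names.Disjoint Δ.names →
      Derivation (Γ ++ Δ) (.tensorR t u) (A ⊗ₗ B)
  | tensorL {Γ : Ctx α} {u : Term α} {x y z : ℕ} {A B C : Formula α} :
      Derivation ((x, A) :: (y, B) :: Γ) u C → z ∉ Γ.names →
      Derivation ((z, A ⊗ₗ B) :: Γ) (.tensorL z x y u) C
  | lolliR {Γ : Ctx α} {t : Term α} {x : ℕ} {A B : Formula α} :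
      Derivation ((x, A) :: Γ) t B → Derivation Γ (.lolliR x t) (A ⊸ₗ B)
  | lolliL {Γ Δ : Ctx α} {t u : Term α} {f x : ℕ} {A B C : Formula α} :
      Derivation Γ t A → Derivation ((x, B) :: Δ) u C → Γ.names.Disjoint Δ.names →
      f ∉ Γ.names → f ∉ Δ.names →
      Derivation ((f, A ⊸ₗ B) :: (Γ ++ Δ)) (.lolliL f t x u) C
  | withR {Γ : Ctx α} {t u : Term α} {A B : Formula α} :
      Derivation Γ t A → Derivation Γ u B → Derivation Γ (.withR t u) (A &ₗ B)
  | withL₀ {Γ : Ctx α} {u : Term α} {x z : ℕ} {A B C : Formula α} :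
      Derivation ((x, A) :: Γ) u C → z ∉ Γ.names →
      Derivation ((z, A &ₗ B) :: Γ) (.withL₀ z x u) C
  | withL₁ {Γ : Ctx α} {u : Term α} {x z : ℕ} {A B C : Formula α} :
      Derivation ((x, B) :: Γ) u C → z ∉ Γ.names →
      Derivation ((z, A &ₗ B) :: Γ) (.withL₁ z x u) C
  | prom {Γ : Ctx α} {t : Term α} {A : Formula α} :
      (∀ h ∈ Γ, ∃ B, h.2 = !ₗB) → Derivation Γ t A → Derivation Γ (.prom t) (!ₗA)
  | der {Γ : Ctx α} {u : Term α} {x z : ℕ} {A C : Formula α} :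
      Derivation ((x, A) :: Γ) u C → z ∉ Γ.names →
      Derivation ((z, !ₗA) :: Γ) (.der z x u) C
  | wk {Γ : Ctx α} {u : Term α} {z : ℕ} {A C : Formula α} :
      Derivation Γ u C → z ∉ Γ.names → Derivation ((z, !ₗA) :: Γ) (.wk z u) C
  | ctr {Γ : Ctx α} {u : Term α} {x y z : ℕ} {A C : Formula α} :
      Derivation ((x, !ₗA) :: (y, !ₗA) :: Γ) u C → z ∉ Γ.names →
      Derivation ((z, !ₗA) :: Γ) (.ctr z x y u) C

/-- The names of the hypotheses of a proof tree. -/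
def Term.fv {α : Type*} : Term α → Finset ℕ
  | .ax x => {x}
  | .cut _ t x u => t.fv ∪ (u.fv \ {x})
  | .tensorR t u => t.fv ∪ u.fv
  | .tensorL z x y u => {z} ∪ (u.fv \ {x, y})
  | .lolliR x t => t.fv \ {x}
  | .lolliL f t x u => {f} ∪ (t.fv ∪ (u.fv \ {x}))
  | .withR t u => t.fv ∪ u.fv
  | .withL₀ z x u => {z} ∪ (u.fv \ {x})
  | .withL₁ z x u => {z} ∪ (u.fv \ {x})
  | .prom t => t.fv
  | .der z x u => {z} ∪ (u.fv \ {x})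
  | .wk z u => {z} ∪ u.fv
  | .ctr z x y u => {z} ∪ (u.fv \ {x, y})

/-- Apply a permutation to all names in a proof tree, active and bound ones included. -/
def Term.rename {α : Type*} (e : Equiv.Perm ℕ) : Term α → Term α
  | .ax x => .ax (e x)
  | .cut A t x u => .cut A (t.rename e) (e x) (u.rename e)
  | .tensorR t u => .tensorR (t.rename e) (u.rename e)
  | .tensorL z x y u => .tensorL (e z) (e x) (e y) (u.rename e)
  | .lolliR x t => .lolliR (e x) (t.rename e)
  | .lolliL f t x u => .lolliL (e f) (t.rename e) (e x) (u.rename e)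
  | .withR t u => .withR (t.rename e) (u.rename e)
  | .withL₀ z x u => .withL₀ (e z) (e x) (u.rename e)
  | .withL₁ z x u => .withL₁ (e z) (e x) (u.rename e)
  | .prom t => .prom (t.rename e)
  | .der z x u => .der (e z) (e x) (u.rename e)
  | .wk z u => .wk (e z) (u.rename e)
  | .ctr z x y u => .ctr (e z) (e x) (e y) (u.rename e)

/-- Exchange the two names `x` and `y` everywhere. -/
abbrev Term.swap {α : Type*} (x y : ℕ) (t : Term α) : Term α := t.rename (Equiv.swap x y)

/-- The cut-elimination transformations. -/
inductive Step {α : Type*} : Term α → Term α → Prop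
  -- The names of the active hypotheses of a rule are immaterial.
  | alpha_cut {A : Formula α} {t u : Term α} {x x' : ℕ} : x' ∉ u.fv →
      Step (.cut A t x u) (.cut A t x' (u.swap x x'))
  | alpha_tensorL {u : Term α} {z x y x' : ℕ} : x' ∉ u.fv →
      Step (.tensorL z x y u) (.tensorL z x' y (u.swap x x'))
  | alpha_tensorL' {u : Term α} {z x y y' : ℕ} : y' ∉ u.fv →
      Step (.tensorL z x y u) (.tensorL z x y' (u.swap y y'))
  | alpha_lolliR {u : Term α} {x x' : ℕ} : x' ∉ u.fv →
      Step (.lolliR x u) (.lolliR x' (u.swap x x'))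
  | alpha_lolliL {t u : Term α} {f x x' : ℕ} : x' ∉ u.fv →
      Step (.lolliL f t x u) (.lolliL f t x' (u.swap x x'))
  | alpha_withL₀ {u : Term α} {z x x' : ℕ} : x' ∉ u.fv →
      Step (.withL₀ z x u) (.withL₀ z x' (u.swap x x'))
  | alpha_withL₁ {u : Term α} {z x x' : ℕ} : x' ∉ u.fv →
      Step (.withL₁ z x u) (.withL₁ z x' (u.swap x x'))
  | alpha_der {u : Term α} {z x x' : ℕ} : x' ∉ u.fv →
      Step (.der z x u) (.der z x' (u.swap x x'))
  | alpha_ctr {u : Term α} {z x y x' : ℕ} : x' ∉ u.fv →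
      Step (.ctr z x y u) (.ctr z x' y (u.swap x x'))
  | alpha_ctr' {u : Term α} {z x y y' : ℕ} : y' ∉ u.fv →
      Step (.ctr z x y u) (.ctr z x y' (u.swap y y'))
  -- Cut against an axiom.
  | cut_ax_left {A : Formula α} {u : Term α} {x y : ℕ} : y ∉ u.fv \ {x} →
      Step (.cut A (.ax y) x u) (u.swap x y)
  | cut_ax_right {A : Formula α} {t : Term α} {x : ℕ} : Step (.cut A t x (.ax x)) t
  -- Expansion of axioms.
  | eta_tensor {z x y : ℕ} : x ≠ y →
      Step (.ax z) (.tensorL z x y (.tensorR (.ax x) (.ax y)))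
  | eta_lolli {f x y : ℕ} : x ≠ f →
      Step (.ax f) (.lolliR x (.lolliL f (.ax x) y (.ax y)))
  | eta_with {z x y : ℕ} :
      Step (.ax z) (.withR (.withL₀ z x (.ax x)) (.withL₁ z y (.ax y)))
  | eta_bang {z x : ℕ} : Step (.ax z) (.prom (.der z x (.ax x)))
  -- Cut against cut.
  | cut_assoc {A B : Formula α} {t u v : Term α} {x y : ℕ} : x ∉ v.fv →
      Step (.cut B (.cut A t x u) y v) (.cut A t x (.cut B u y v))
  | cut_comm {A B : Formula α} {t u v : Term α} {x y : ℕ} : x ≠ y → x ∉ u.fv → y ∉ t.fv →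
      Step (.cut A t x (.cut B u y v)) (.cut B u y (.cut A t x v))
  -- Both occurrences of the cut formula are principal.
  | cut_tensor {A B : Formula α} {t s u : Term α} {z x y : ℕ} : x ≠ y → x ∉ s.fv →
      Step (.cut (A ⊗ₗ B) (.tensorR t s) z (.tensorL z x y u)) (.cut A t x (.cut B s y u))
  | cut_lolli {A B : Formula α} {t s u : Term α} {f x y : ℕ} :
      Step (.cut (A ⊸ₗ B) (.lolliR x t) f (.lolliL f s y u)) (.cut B (.cut A s x t) y u)
  | cut_with₀ {A B : Formula α} {t s u : Term α} {z x : ℕ} :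
      Step (.cut (A &ₗ B) (.withR t s) z (.withL₀ z x u)) (.cut A t x u)
  | cut_with₁ {A B : Formula α} {t s u : Term α} {z x : ℕ} :
      Step (.cut (A &ₗ B) (.withR t s) z (.withL₁ z x u)) (.cut B s x u)
  | cut_der {A : Formula α} {t u : Term α} {z x : ℕ} :
      Step (.cut (!ₗA) (.prom t) z (.der z x u)) (.cut A t x u)
  -- The hypotheses of a discarded promotion are weakened.
  | cut_wk {A : Formula α} {t u : Term α} {z : ℕ} (L : List ℕ) : L.Nodup → L.toFinset = t.fv →
      Step (.cut (!ₗA) (.prom t) z (.wk z u)) (L.foldr .wk u)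
  -- The hypotheses `w` of a duplicated promotion are contracted; the pairs `(w, w')` in `L` say
  -- that `w` keeps its name in the first copy and is called `w'` in the second one.
  | cut_ctr {A : Formula α} {t u : Term α} {z x y : ℕ} (L : List (ℕ × ℕ)) :
      (L.map Prod.fst).Nodup → (L.map Prod.fst).toFinset = t.fv → (L.map Prod.snd).Nodup →
      (∀ p ∈ L, p.2 ∉ t.fv ∧ p.2 ∉ u.fv ∧ p.2 ≠ x ∧ p.2 ≠ y) → x ≠ y →
      Step (.cut (!ₗA) (.prom t) z (.ctr z x y u))
        (L.foldr (fun p s => .ctr p.1 p.1 p.2 s)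
          (.cut (!ₗA) (.prom t) x
            (.cut (!ₗA) (.prom (L.foldr (fun p s => s.swap p.1 p.2) t)) y u)))
  | cut_prom {A : Formula α} {t u : Term α} {x : ℕ} :
      Step (.cut (!ₗA) (.prom t) x (.prom u)) (.prom (.cut (!ₗA) (.prom t) x u))
  -- The left premise of the cut ends with a left rule.
  | left_tensorL {C : Formula α} {t u : Term α} {z x y w : ℕ} : x ∉ u.fv → y ∉ u.fv →
      Step (.cut C (.tensorL z x y t) w u) (.tensorL z x y (.cut C t w u))
  | left_lolliL {C : Formula α} {s t u : Term α} {f x w : ℕ} : x ∉ u.fv →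
      Step (.cut C (.lolliL f s x t) w u) (.lolliL f s x (.cut C t w u))
  | left_withL₀ {C : Formula α} {t u : Term α} {z x w : ℕ} : x ∉ u.fv →
      Step (.cut C (.withL₀ z x t) w u) (.withL₀ z x (.cut C t w u))
  | left_withL₁ {C : Formula α} {t u : Term α} {z x w : ℕ} : x ∉ u.fv →
      Step (.cut C (.withL₁ z x t) w u) (.withL₁ z x (.cut C t w u))
  | left_der {C : Formula α} {t u : Term α} {z x w : ℕ} : x ∉ u.fv →
      Step (.cut C (.der z x t) w u) (.der z x (.cut C t w u))
  | left_wk {C : Formula α} {t u : Term α} {z w : ℕ} :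
      Step (.cut C (.wk z t) w u) (.wk z (.cut C t w u))
  | left_ctr {C : Formula α} {t u : Term α} {z x y w : ℕ} : x ∉ u.fv → y ∉ u.fv →
      Step (.cut C (.ctr z x y t) w u) (.ctr z x y (.cut C t w u))
  -- The cut formula is not principal in the last rule of the right premise.
  | right_tensorR₀ {A : Formula α} {t u v : Term α} {x : ℕ} : x ∈ u.fv → x ∉ v.fv →
      Step (.cut A t x (.tensorR u v)) (.tensorR (.cut A t x u) v)
  | right_tensorR₁ {A : Formula α} {t u v : Term α} {x : ℕ} : x ∉ u.fv → x ∈ v.fv →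
      Step (.cut A t x (.tensorR u v)) (.tensorR u (.cut A t x v))
  | right_tensorL {A : Formula α} {t u : Term α} {x z a b : ℕ} :
      x ≠ z → a ≠ x → b ≠ x → a ∉ t.fv → b ∉ t.fv →
      Step (.cut A t x (.tensorL z a b u)) (.tensorL z a b (.cut A t x u))
  | right_lolliR {A : Formula α} {t u : Term α} {x a : ℕ} : a ≠ x → a ∉ t.fv →
      Step (.cut A t x (.lolliR a u)) (.lolliR a (.cut A t x u))
  | right_lolliL₀ {A : Formula α} {t s u : Term α} {x f a : ℕ} :
      x ≠ f → x ∈ s.fv → x ∉ u.fv \ {a} →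
      Step (.cut A t x (.lolliL f s a u)) (.lolliL f (.cut A t x s) a u)
  | right_lolliL₁ {A : Formula α} {t s u : Term α} {x f a : ℕ} :
      x ≠ f → x ∉ s.fv → x ∈ u.fv → a ≠ x → a ∉ t.fv →
      Step (.cut A t x (.lolliL f s a u)) (.lolliL f s a (.cut A t x u))
  | right_withR {A : Formula α} {t u v : Term α} {x : ℕ} :
      Step (.cut A t x (.withR u v)) (.withR (.cut A t x u) (.cut A t x v))
  | right_withL₀ {A : Formula α} {t u : Term α} {x z a : ℕ} : x ≠ z → a ≠ x → a ∉ t.fv →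
      Step (.cut A t x (.withL₀ z a u)) (.withL₀ z a (.cut A t x u))
  | right_withL₁ {A : Formula α} {t u : Term α} {x z a : ℕ} : x ≠ z → a ≠ x → a ∉ t.fv →
      Step (.cut A t x (.withL₁ z a u)) (.withL₁ z a (.cut A t x u))
  | right_der {A : Formula α} {t u : Term α} {x z a : ℕ} : x ≠ z → a ≠ x → a ∉ t.fv →
      Step (.cut A t x (.der z a u)) (.der z a (.cut A t x u))
  | right_wk {A : Formula α} {t u : Term α} {x z : ℕ} : x ≠ z →
      Step (.cut A t x (.wk z u)) (.wk z (.cut A t x u))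
  | right_ctr {A : Formula α} {t u : Term α} {x z a b : ℕ} :
      x ≠ z → a ≠ x → b ≠ x → a ∉ t.fv → b ∉ t.fv →
      Step (.cut A t x (.ctr z a b u)) (.ctr z a b (.cut A t x u))
  -- Contraction is commutative and associative, with weakening as its unit.
  | ctr_comm {u : Term α} {z x y : ℕ} : Step (.ctr z x y u) (.ctr z y x u)
  | ctr_assoc {u : Term α} {z x y a b w : ℕ} : x ≠ y → a ≠ w →
      Step (.ctr z x y (.ctr x a b u)) (.ctr z a w (.ctr w b y u))
  | ctr_wk {u : Term α} {z x : ℕ} : x ≠ z → Step (.ctr z x z (.wk x u)) u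
  -- A transformation may be applied to any subtree.
  | cut_congr_left {A : Formula α} {t t' u : Term α} {x : ℕ} : Step t t' →
      Step (.cut A t x u) (.cut A t' x u)
  | cut_congr_right {A : Formula α} {t u u' : Term α} {x : ℕ} : Step u u' →
      Step (.cut A t x u) (.cut A t x u')
  | tensorR_congr_left {t t' u : Term α} : Step t t' → Step (.tensorR t u) (.tensorR t' u)
  | tensorR_congr_right {t u u' : Term α} : Step u u' → Step (.tensorR t u) (.tensorR t u')
  | tensorL_congr {u u' : Term α} {z x y : ℕ} : Step u u' →
      Step (.tensorL z x y u) (.tensorL z x y u')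
  | lolliR_congr {u u' : Term α} {x : ℕ} : Step u u' → Step (.lolliR x u) (.lolliR x u')
  | lolliL_congr_left {t t' u : Term α} {f x : ℕ} : Step t t' →
      Step (.lolliL f t x u) (.lolliL f t' x u)
  | lolliL_congr_right {t u u' : Term α} {f x : ℕ} : Step u u' →
      Step (.lolliL f t x u) (.lolliL f t x u')
  | withR_congr_left {t t' u : Term α} : Step t t' → Step (.withR t u) (.withR t' u)
  | withR_congr_right {t u u' : Term α} : Step u u' → Step (.withR t u) (.withR t u')
  | withL₀_congr {u u' : Term α} {z x : ℕ} : Step u u' → Step (.withL₀ z x u) (.withL₀ z x u')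
  | withL₁_congr {u u' : Term α} {z x : ℕ} : Step u u' → Step (.withL₁ z x u) (.withL₁ z x u')
  | prom_congr {u u' : Term α} : Step u u' → Step (.prom u) (.prom u')
  | der_congr {u u' : Term α} {z x : ℕ} : Step u u' → Step (.der z x u) (.der z x u')
  | wk_congr {u u' : Term α} {z : ℕ} : Step u u' → Step (.wk z u) (.wk z u')
  | ctr_congr {u u' : Term α} {z x y : ℕ} : Step u u' → Step (.ctr z x y u) (.ctr z x y u')

/-- Proofs of the sequent `Γ ⊢ A`. -/
structure LLProof {α : Type*} (Γ : Ctx α) (A : Formula α) where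
  term : Term α
  derivation : Derivation Γ term A

/-- Equivalence under cut-elimination of two proofs of the same sequent: the equivalence relation
generated by the transformations between proofs of this sequent. -/
def LLProof.Equivalent {α : Type*} {Γ : Ctx α} {A : Formula α} (π ρ : LLProof Γ A) : Prop :=
  Relation.EqvGen (fun π ρ : LLProof Γ A => Step π.term ρ.term) π ρ

/-- The cut of a proof of `Γ ⊢ A` against a proof of `A ⊢ B`. -/
def LLProof.cut {α : Type*} {Γ : Ctx α} {A B : Formula α} {x : ℕ} (π : LLProof Γ A)
    (ρ : LLProof [(x, A)] B) : LLProof Γ B where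
  term := .cut A π.term x ρ.term
  derivation := .exch (by simp) (.cut π.derivation ρ.derivation (by simp [Ctx.names]))

/-- The promotion of a proof of `⊢ A`. -/
def LLProof.prom {α : Type*} {A : Formula α} (π : LLProof [] A) : LLProof [] (!ₗA) where
  term := .prom π.term
  derivation := .prom (by simp) π.derivation

/-- The tensor product of proofs of `⊢ A` and `⊢ B`. -/
def LLProof.tensor {α : Type*} {A B : Formula α} (π : LLProof [] A) (ρ : LLProof [] B) :
    LLProof [] (A ⊗ₗ B) where
  term := .tensorR π.term ρ.term
  derivation := .tensorR π.derivation ρ.derivation (by simp [Ctx.names])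

/-- `A.pow n` is `A & ⋯ & A` with `n` copies of `A`, for `n ≥ 1` (the value at `0` is not used). -/
def Formula.pow {α : Type*} (A : Formula α) : ℕ → Formula α
  | 0 => A
  | 1 => A
  | n + 2 => A &ₗ A.pow (n + 1)

/-- The type of `n`-booleans on `A`. -/
def nbool {α : Type*} (n : ℕ) (A : Formula α) : Formula α := A.pow n ⊸ₗ A

/-- The type of binary integers on `A`. -/
def bint {α : Type*} (A : Formula α) : Formula α :=
  !ₗ(A ⊸ₗ A) ⊸ₗ (!ₗ(A ⊸ₗ A) ⊸ₗ (A ⊸ₗ A))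

/-- The type of Turing configurations on `A` for a machine with `n` states. -/
def Tur {α : Type*} (n : ℕ) (A : Formula α) : Formula α :=
  (!ₗ(bint A) ⊗ₗ !ₗ(bint A)) ⊗ₗ !ₗ(nbool n A)

/-- The proof of `A^n ⊢ A` that ends with the left introduction of `&` for the position `i < n`;
the hypothesis is called `z`. -/
def projTerm {α : Type*} (z : ℕ) : ℕ → ℕ → Term α
  | _ + 2, 0 => .withL₀ z z (.ax z)
  | n + 2, i + 1 => .withL₁ z z (projTerm z (n + 1) i)
  | _, _ => .ax z

/-- The tree of `!(A ⊸ A), !(A ⊸ A), A ⊢ A` for a binary sequence, in which the two copies of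
`!(A ⊸ A)` are called `0` and `1` and stand for the digits zero and one, and `A` is called `2`.
For the empty sequence both copies are weakened. Otherwise the copy for the first digit is
contracted, one of the two results is derelicted and applied to the hypothesis `A`, and the
remaining digits are applied to the result. -/
def bintBody {α : Type*} : List Bool → Term α
  | [] => .wk 0 (.wk 1 (.ax 2))
  | s :: S => .ctr s.toNat s.toNat 3 (.der 3 3 (.lolliL 3 (.ax 2) 2 (bintBody S)))

theorem projTerm_derivation {α : Type*} (A : Formula α) (z : ℕ) :
    ∀ n i : ℕ, i < n → Derivation [(z, A.pow n)] (projTerm z n i) A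
  | 0, _, h => absurd h (Nat.not_lt_zero _)
  | 1, i, _ => by
      cases i <;> exact Derivation.ax z A
  | n + 2, 0, _ => Derivation.withL₀ (Derivation.ax z A) (by simp [Ctx.names])
  | n + 2, i + 1, h =>
      Derivation.withL₁ (projTerm_derivation A z (n + 1) i (by omega)) (by simp [Ctx.names])

theorem bintBody_derivation {α : Type*} (A : Formula α) : ∀ S : List Bool,
    Derivation [(0, !ₗ(A ⊸ₗ A)), (1, !ₗ(A ⊸ₗ A)), (2, A)] (bintBody S) A
  | [] => .wk (.wk (.ax 2 A) (by simp [Ctx.names])) (by simp [Ctx.names])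
  | false :: S => by
      have ih := bintBody_derivation A S
      refine .ctr (x := 0) (y := 3) ?_ (by simp [Ctx.names])
      refine .exch (List.Perm.swap _ _ _) ?_
      refine .der (x := 3) ?_ (by simp [Ctx.names])
      refine .exch (Γ := (3, A ⊸ₗ A) :: ([(2, A)] ++ [(0, !ₗ(A ⊸ₗ A)), (1, !ₗ(A ⊸ₗ A))]))
        (List.Perm.cons _ (List.perm_append_comm
          (l₁ := [(2, A)]) (l₂ := [(0, !ₗ(A ⊸ₗ A)), (1, !ₗ(A ⊸ₗ A))]))) ?_
      refine .lolliL (.ax 2 A) (.exch (List.perm_append_comm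
        (l₁ := [(0, !ₗ(A ⊸ₗ A)), (1, !ₗ(A ⊸ₗ A))]) (l₂ := [(2, A)])) ih) ?_ ?_ ?_ <;>
        simp [Ctx.names]
  | true :: S => by
      have ih := bintBody_derivation A S
      refine .exch (List.Perm.swap _ _ _) ?_
      refine .ctr (x := 1) (y := 3) ?_ (by simp [Ctx.names])
      refine .exch (List.Perm.swap _ _ _) ?_
      refine .der (x := 3) ?_ (by simp [Ctx.names])
      refine .exch (Γ := (3, A ⊸ₗ A) :: ([(2, A)] ++ [(1, !ₗ(A ⊸ₗ A)), (0, !ₗ(A ⊸ₗ A))]))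
        (List.Perm.cons _ (List.perm_append_comm
          (l₁ := [(2, A)]) (l₂ := [(1, !ₗ(A ⊸ₗ A)), (0, !ₗ(A ⊸ₗ A))]))) ?_
      refine .lolliL (.ax 2 A) (.exch (List.Perm.trans (List.perm_append_comm
        (l₁ := [(0, !ₗ(A ⊸ₗ A)), (1, !ₗ(A ⊸ₗ A))]) (l₂ := [(2, A)]))
        (List.Perm.cons _ (List.Perm.swap _ _ _))) ih) ?_ ?_ ?_ <;>
        simp [Ctx.names]

/-- The proof of `⊢ nbool n A` that represents `i`. -/
def nboolProof {α : Type*} (A : Formula α) {n : ℕ} (i : Fin n) : LLProof [] (nbool n A) where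
  term := .lolliR 0 (projTerm 0 n i)
  derivation := .lolliR (projTerm_derivation A 0 n i i.isLt)

/-- The proof of `⊢ bint A` that represents the binary sequence `S`; the first digit is applied
first. -/
def bintProof {α : Type*} (A : Formula α) (S : List Bool) : LLProof [] (bint A) where
  term := .lolliR 0 (.lolliR 1 (.lolliR 2 (bintBody S)))
  derivation := .lolliR (.lolliR (.lolliR (.exch
    ((List.reverse_perm [(2, A), (1, !ₗ(A ⊸ₗ A)), (0, !ₗ(A ⊸ₗ A))]))
    (bintBody_derivation A S))))

/-- The directions in which the head of a Turing machine can move. -/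
inductive Direction where
  | left : Direction
  | right : Direction

/-- The transition function of a Turing machine with tape alphabet `{0, 1}` (`false` is the symbol
`0`, which is the blank) and set of states `{0, …, n - 1}`. -/
abbrev Transition (n : ℕ) := Bool × Fin n → Bool × Fin n × Direction

/-- A configuration `⟨S, T, q⟩`: the word `S` is the tape to the left of the head, up to and
including the scanned square, `T` is the reversal of the tape to the right of the head, and `q` is
the state. All squares outside these words are blank. -/
structure Config (n : ℕ) where
  S : List Bool
  T : List Bool
  q : Fin n

/-- One step of the machine. The scanned symbol is the last letter of `S` and the symbol to its
right is the last letter of `T`; each is the blank if the word is empty. -/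
def stepConfig {n : ℕ} (δ : Transition n) (c : Config n) : Config n :=
  let σ := c.S.getLastD false
  let τ := c.T.getLastD false
  match δ (σ, c.q) with
  | (σ', q', .left) => ⟨c.S.dropLast, c.T.dropLast ++ [τ, σ'], q'⟩
  | (σ', q', .right) => ⟨c.S.dropLast ++ [σ', τ], c.T.dropLast, q'⟩

/-- The proof of `⊢ Tur n A` that represents a configuration. -/
def configProof {α : Type*} (A : Formula α) {n : ℕ} (c : Config n) : LLProof [] (Tur n A) :=
  ((bintProof A c.S).prom.tensor (bintProof A c.T).prom).tensor (nboolProof A c.q).prom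

/-- The proof `π` of `Tur n B ⊢ Tur n A` encodes `p` transition steps: the cut of `π` against any
configuration is equivalent under cut-elimination to the configuration `p` steps later. -/
def EncodesSteps {α : Type*} {n : ℕ} (δ : Transition n) (p : ℕ) {A B : Formula α}
    (π : LLProof [(0, Tur n B)] (Tur n A)) : Prop :=
  ∀ c : Config n, ((configProof B c).cut π).Equivalent (configProof A ((stepConfig δ)^[p] c))

/-- The `p`-fold iterated cube `(⋯(A^3)^3⋯)^3`, a bracketing of `3 ^ p` copies of `A`. -/
def Formula.cubed {α : Type*} (A : Formula α) : ℕ → Formula α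
  | 0 => A
  | p + 1 => (A.cubed p).pow 3

/-- The proof that results from cutting together the `p + 1` proofs `step (A.cubed p)`, …,
`step (A.cubed 1)`, `step A`. -/
def cutSteps {α : Type*} {n : ℕ}
    (step : ∀ B : Formula α, LLProof [(0, Tur n (B.pow 3))] (Tur n B)) (A : Formula α) :
    ∀ p : ℕ, LLProof [(0, Tur n (A.cubed (p + 1)))] (Tur n A)
  | 0 => step A
  | p + 1 => (step (A.cubed (p + 1))).cut (cutSteps step A p)

end ILL

open ILL

/-!
A transition only needs the last letters of the two words of a configuration, the two words without
their last letter, and the state. All of these can be computed by iterating a fixed function on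
triples, because a binary integer of type `bint B` iterates a pair of endomorphisms of `B`, and for
`B = A ^ 3` these can act on triples of proofs of type `A`.

* *Last letter.* Starting from `(a, b, a)`, the letter `s` sends `(a, b, _)` to `(a, b, b)` if `s`
  is one and to `(a, b, a)` if `s` is zero; the third component then selects `a` or `b` according
  to the last letter (`Retract.cut_caseLast`). The default `a` for the empty word is the blank.
* *All letters but the last.* Starting from `(x, x, x)`, the letter `s` sends `(u, v, _)` to
  `(f u, u, u)`, where `f` is the endomorphism of `A` that stands for `s`. The first component has
  applied all letters so far, and the second one all letters but the last
  (`Retract.cut_dropLastTerm`).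
* *State.* An `n`-boolean on `B` selects one of `n` triples whose components are all equal
  (`Retract.cut_caseState`).

To append fixed letters to a word, `!(A ⊸ A)` is contracted and the endomorphisms of the second word
are composed with those of the first; that this represents the concatenation uses that contraction
is associative with weakening as its unit (`word_append`). It also uses that contraction commutes
with the other left rules, which is not a transformation by itself but holds because both sides are
obtained from one common cut. The transition is assembled from four copies of the left word, four
copies of the right word and three copies of the state (`Retract.stepTerm`, `Retract.cut_stepTerm`).

The construction uses the type `A ^ 3` only through packing and unpacking of triples, so it makes
sense for every `B` of which `A ^ 3` is a retract (`Retract`). With `B = A ^ 3` it gives the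
transition proofs that are iterated along `A.cubed`. Since products are associative,
`(A ^ k) ^ 3` is a retract of `A ^ (3 * k)`, and the same construction gives a proof of
`Tur (A ^ (3 ^ (k + 1))) ⊢ Tur (A ^ (3 ^ k))` for the standard bracketing.

Equivalences are proved between proof trees rather than between derivations. `Term.WT` assigns
types to trees by recursion, with types for all names, and determines a derivation. The relation
`t ⇛ u` says that in every typing of `t` the trees `t` and `u` are connected by transformations
between trees of this typing; it is a transitive congruence, and for closed trees it gives
equivalence under cut-elimination (`TEq.equivalent`).

Names of hypotheses are fixed: `0`, `1`, `2` and `3` are used as in `bintBody` for the word that is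
produced, `4` is the hypothesis of a proof that acts as a map, `5`, `6` and `7` occur in
applications, `10`, `11`, `12` and `13` belong to the word that is consumed, `14`, `15` and `16` to
appended letters, and names from `20` on stand for the components of the configuration.
-/

namespace ILL

variable {α : Type*}

open Function (update)

/-! ### Typing of proof trees -/

/-- The tree `t` proves `A` from its hypotheses if every name `x` has the type `ρ x`. Types of names
that are not hypotheses are irrelevant. The side conditions say that active names occur in the
premise, that contexts which have to be disjoint or equal are so, and that the principal name is
distinct from the hypotheses of the premise that remain. -/
def Term.WT : Term α → (ℕ → Formula α) → Formula α → Prop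
  | .ax x, ρ, C => ρ x = C
  | .cut A t x u, ρ, C => t.WT ρ A ∧ u.WT (update ρ x A) C ∧ x ∈ u.fv ∧
      ∀ y ∈ t.fv, y ∈ u.fv → y = x
  | .tensorR t u, ρ, C => ∃ A B, C = A ⊗ₗ B ∧ t.WT ρ A ∧ u.WT ρ B ∧ ∀ y ∈ t.fv, y ∉ u.fv
  | .tensorL z x y u, ρ, C => ∃ A B, ρ z = A ⊗ₗ B ∧ u.WT (update (update ρ y B) x A) C ∧
      x ∈ u.fv ∧ y ∈ u.fv ∧ x ≠ y ∧ (z ∈ u.fv → z = x ∨ z = y)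
  | .lolliR x t, ρ, C => ∃ A B, C = A ⊸ₗ B ∧ t.WT (update ρ x A) B ∧ x ∈ t.fv
  | .lolliL f t x u, ρ, C => ∃ A B, ρ f = A ⊸ₗ B ∧ t.WT ρ A ∧ u.WT (update ρ x B) C ∧ x ∈ u.fv ∧
      (∀ y ∈ t.fv, y ∈ u.fv → y = x) ∧ f ∉ t.fv ∧ (f ∈ u.fv → f = x)
  | .withR t u, ρ, C => ∃ A B, C = A &ₗ B ∧ t.WT ρ A ∧ u.WT ρ B ∧ t.fv = u.fv
  | .withL₀ z x u, ρ, C => ∃ A B, ρ z = A &ₗ B ∧ u.WT (update ρ x A) C ∧ x ∈ u.fv ∧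
      (z ∈ u.fv → z = x)
  | .withL₁ z x u, ρ, C => ∃ A B, ρ z = A &ₗ B ∧ u.WT (update ρ x B) C ∧ x ∈ u.fv ∧
      (z ∈ u.fv → z = x)
  | .prom t, ρ, C => ∃ A, C = !ₗA ∧ t.WT ρ A ∧ ∀ y ∈ t.fv, ∃ B, ρ y = !ₗB
  | .der z x u, ρ, C => ∃ A, ρ z = !ₗA ∧ u.WT (update ρ x A) C ∧ x ∈ u.fv ∧ (z ∈ u.fv → z = x)
  | .wk z u, ρ, C => ∃ A, ρ z = !ₗA ∧ u.WT ρ C ∧ z ∉ u.fv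
  | .ctr z x y u, ρ, C => ∃ A, ρ z = !ₗA ∧ u.WT (update (update ρ y (!ₗA)) x (!ₗA)) C ∧
      x ∈ u.fv ∧ y ∈ u.fv ∧ x ≠ y ∧ (z ∈ u.fv → z = x ∨ z = y)

theorem Term.mem_fv_rename (e : Equiv.Perm ℕ) (t : Term α) (y : ℕ) :
    y ∈ (t.rename e).fv ↔ e.symm y ∈ t.fv := by
  induction t <;> simp_all [Term.rename, Term.fv, Equiv.symm_apply_eq]

theorem Term.WT.congr {t : Term α} {ρ ρ' : ℕ → Formula α} {A : Formula α}
    (h : t.WT ρ A) (hρ : ∀ y ∈ t.fv, ρ y = ρ' y) : t.WT ρ' A := by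
  induction t generalizing ρ ρ' A with
  | ax x => simp_all [Term.WT, Term.fv]
  | cut B t x u iht ihu =>
    obtain ⟨h1, h2, h3, h4⟩ := h
    refine ⟨iht h1 fun y hy => hρ y ?_, ihu h2 fun y hy => ?_, h3, h4⟩ <;>
      grind [Term.fv]
  | tensorR t u iht ihu =>
    obtain ⟨A, B, rfl, h1, h2, h3⟩ := h
    exact ⟨A, B, rfl, iht h1 (by grind [Term.fv]), ihu h2 (by grind [Term.fv]), h3⟩
  | tensorL z x y u ihu =>
    obtain ⟨A, B, h1, h2, h3⟩ := h
    exact ⟨A, B, by grind [Term.fv], ihu h2 (by grind [Term.fv]), h3⟩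
  | lolliR x t ih =>
    obtain ⟨A, B, rfl, h2, h3⟩ := h
    exact ⟨A, B, rfl, ih h2 (by grind [Term.fv]), h3⟩
  | lolliL f t x u iht ihu =>
    obtain ⟨A, B, h0, h1, h2, h3⟩ := h
    exact ⟨A, B, by grind [Term.fv], iht h1 (by grind [Term.fv]), ihu h2 (by grind [Term.fv]), h3⟩
  | withR t u iht ihu =>
    obtain ⟨A, B, rfl, h1, h2, h3⟩ := h
    exact ⟨A, B, rfl, iht h1 (by grind [Term.fv]), ihu h2 (by grind [Term.fv]), h3⟩
  | withL₀ z x u ihu =>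
    obtain ⟨A, B, h1, h2, h3⟩ := h
    exact ⟨A, B, by grind [Term.fv], ihu h2 (by grind [Term.fv]), h3⟩
  | withL₁ z x u ihu =>
    obtain ⟨A, B, h1, h2, h3⟩ := h
    exact ⟨A, B, by grind [Term.fv], ihu h2 (by grind [Term.fv]), h3⟩
  | prom t ih =>
    obtain ⟨A, rfl, h1, h2⟩ := h
    exact ⟨A, rfl, ih h1 (by grind [Term.fv]), by grind [Term.fv]⟩
  | der z x u ihu =>
    obtain ⟨A, h1, h2, h3⟩ := h
    exact ⟨A, by grind [Term.fv], ihu h2 (by grind [Term.fv]), h3⟩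
  | wk z u ihu =>
    obtain ⟨A, h1, h2, h3⟩ := h
    exact ⟨A, by grind [Term.fv], ihu h2 (by grind [Term.fv]), h3⟩
  | ctr z x y u ihu =>
    obtain ⟨A, h1, h2, h3⟩ := h
    exact ⟨A, by grind [Term.fv], ihu h2 (by grind [Term.fv]), h3⟩

theorem Term.WT_congr {t : Term α} {ρ ρ' : ℕ → Formula α} {A : Formula α}
    (hρ : ∀ y ∈ t.fv, ρ y = ρ' y) : t.WT ρ A ↔ t.WT ρ' A :=
  ⟨fun h => h.congr hρ, fun h => h.congr fun y hy => (hρ y hy).symm⟩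

theorem Term.WT_rename (e : Equiv.Perm ℕ) {t : Term α} {ρ : ℕ → Formula α} {A : Formula α} :
    (t.rename e).WT ρ A ↔ t.WT (ρ ∘ e) A := by
  have key : ∀ (ρ : ℕ → Formula α) x (B : Formula α),
      update ρ (e x) B ∘ e = update (ρ ∘ e) x B := fun ρ x B =>
    Function.update_comp_eq_of_injective ρ e.injective x B
  have h1 (t : Term α) x : e x ∈ (t.rename e).fv ↔ x ∈ t.fv := by
    simp [Term.mem_fv_rename]
  have h2 (t u : Term α) : (t.rename e).fv = (u.rename e).fv ↔ t.fv = u.fv := by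
    refine ⟨fun h => Finset.ext fun x => ?_, fun h => Finset.ext fun x => ?_⟩
    · rw [← h1, h, h1]
    · rw [Term.mem_fv_rename, Term.mem_fv_rename, h]
  induction t generalizing ρ A with
  | cut | tensorR | lolliL | prom =>
    simp only [Term.WT, Term.rename, Function.comp_apply, e.injective.eq_iff, *]
    rw [e.surjective.forall (p := fun y => y ∈ (Term.rename e _).fv → _)]
    simp only [h1, e.injective.eq_iff]
  | _ =>
    simp only [Term.WT, Term.rename, Function.comp_apply, e.injective.eq_iff, ne_eq, *]

theorem Term.rename_rename (e f : Equiv.Perm ℕ) (t : Term α) :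
    (t.rename e).rename f = t.rename (e.trans f) := by
  induction t <;> simp_all [Term.rename]

theorem Term.rename_refl (t : Term α) : t.rename (Equiv.refl ℕ) = t := by
  induction t <;> simp_all [Term.rename]

theorem Term.swap_swap (x y : ℕ) (t : Term α) : (t.swap x y).swap x y = t := by
  rw [Term.swap, Term.swap, Term.rename_rename, ← Equiv.Perm.mul_def, Equiv.swap_mul_self]
  exact Term.rename_refl t

theorem Term.mem_fv_swap {x y z : ℕ} {t : Term α} :
    z ∈ (t.swap x y).fv ↔ Equiv.swap x y z ∈ t.fv := by
  simp [Term.swap, Term.mem_fv_rename]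

theorem Term.WT_swap_update {t : Term α} {x x' : ℕ} {ρ : ℕ → Formula α} {A B : Formula α}
    (hx : x' ∉ t.fv ∨ x' = x) :
    (t.swap x x').WT (update ρ x' A) B ↔ t.WT (update ρ x A) B := by
  rw [Term.swap, Term.WT_rename]
  apply Term.WT_congr
  intro y hy
  by_cases h1 : y = x
  · subst h1; simp
  by_cases h2 : y = x'
  · grind
  · have := Equiv.swap_apply_of_ne_of_ne h1 h2
    simp_all

/-! ### Derivations of typed trees -/

/-- The context of the names in `s`, in some order, with their types in `ρ`. -/
noncomputable def ctxOf (ρ : ℕ → Formula α) (s : Finset ℕ) : Ctx α := s.toList.map fun x => (x, ρ x)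

theorem mem_names_ctxOf {ρ : ℕ → Formula α} {s : Finset ℕ} {x : ℕ} :
    x ∈ (ctxOf ρ s).names ↔ x ∈ s := by
  simp [ctxOf, Ctx.names]

theorem ctxOf_perm (ρ : ℕ → Formula α) {s : Finset ℕ} {l : List ℕ} (hl : l.Nodup)
    (h : ∀ x, x ∈ l ↔ x ∈ s) : (l.map fun x => (x, ρ x)).Perm (ctxOf ρ s) :=
  ((List.perm_ext_iff_of_nodup hl s.nodup_toList).2 (by simpa using h)).map _

theorem ctxOf_congr {ρ ρ' : ℕ → Formula α} {s : Finset ℕ} (h : ∀ y ∈ s, ρ y = ρ' y) :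
    ctxOf ρ s = ctxOf ρ' s :=
  List.map_congr_left fun y hy => by rw [h y (by simpa using hy)]

theorem ctxOf_cons {ρ : ℕ → Formula α} {s : Finset ℕ} {x : ℕ} (hx : x ∈ s) {A : Formula α}
    (hA : ρ x = A) : (ctxOf ρ s).Perm ((x, A) :: ctxOf ρ (s.erase x)) := by
  subst hA
  refine (ctxOf_perm ρ (l := x :: (s.erase x).toList) ?_ ?_).symm
  · simp [Finset.nodup_toList]
  · grind [Finset.mem_toList]

theorem ctxOf_update {ρ : ℕ → Formula α} {s : Finset ℕ} {x : ℕ} (hx : x ∈ s) (A : Formula α) :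
    (ctxOf (update ρ x A) s).Perm ((x, A) :: ctxOf ρ (s.erase x)) := by
  refine (ctxOf_cons (A := A) hx (by simp)).trans (.of_eq ?_)
  rw [ctxOf_congr (ρ' := ρ)]
  grind

theorem ctxOf_append {ρ : ℕ → Formula α} {s t r : Finset ℕ} (h : ∀ x ∈ s, x ∉ t)
    (hr : s ∪ t = r) : (ctxOf ρ s ++ ctxOf ρ t).Perm (ctxOf ρ r) := by
  subst hr
  rw [ctxOf, ctxOf, ← List.map_append]
  refine ctxOf_perm ρ ?_ (by simp)
  rw [List.nodup_append]
  refine ⟨s.nodup_toList, t.nodup_toList, ?_⟩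
  simp only [Finset.mem_toList]
  grind

theorem names_disjoint {ρ ρ' : ℕ → Formula α} {s t : Finset ℕ} (h : ∀ x ∈ s, x ∉ t) :
    (ctxOf ρ s).names.Disjoint (ctxOf ρ' t).names := by
  intro x h1 h2
  rw [mem_names_ctxOf] at h1 h2
  exact h x h1 h2

theorem Term.WT.derivation {t : Term α} {ρ : ℕ → Formula α} {A : Formula α} (h : t.WT ρ A) :
    Derivation (ctxOf ρ t.fv) t A := by
  have unary {s : Finset ℕ} {x : ℕ} (r : Finset ℕ) (hx : x ∈ s) (hr : r = s.erase x)
      {ρ : ℕ → Formula α} {u : Term α} {B C : Formula α}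
      (hd : Derivation (ctxOf (update ρ x B) s) u C) :
      Derivation ((x, B) :: ctxOf ρ r) u C := hr ▸ hd.exch (ctxOf_update hx B)
  have binary {s : Finset ℕ} {x y : ℕ} (r : Finset ℕ) (hx : x ∈ s) (hy : y ∈ s) (hxy : x ≠ y)
      (hr : r = s \ {x, y})
      {ρ : ℕ → Formula α} {u : Term α} {A B C : Formula α}
      (hd : Derivation (ctxOf (update (update ρ y B) x A) s) u C) :
      Derivation ((x, A) :: (y, B) :: ctxOf ρ r) u C := by
    have : r = (s.erase x).erase y := by grind
    rw [this]
    exact hd.exch ((ctxOf_update hx A).trans ((ctxOf_update (by grind) B).cons _))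
  have cons {s r : Finset ℕ} {x : ℕ} (hr : s = insert x r) (hx : x ∉ r)
      {ρ : ℕ → Formula α} {u : Term α} {B C : Formula α} (hB : ρ x = B)
      (hd : Derivation ((x, B) :: ctxOf ρ r) u C) :
      Derivation (ctxOf ρ s) u C := by
    refine hd.exch (.trans (.of_eq ?_) (ctxOf_cons (by grind) hB).symm)
    congr 2; grind
  induction t generalizing ρ A with
  | ax x =>
    obtain rfl := h
    simpa [ctxOf, Term.fv] using Derivation.ax x (ρ x)
  | cut B t x u iht ihu =>
    obtain ⟨h1, h2, h3, h4⟩ := h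
    refine (Derivation.cut (iht h1) (unary (u.fv \ {x}) h3 (by grind) (ihu h2))
      (names_disjoint (by grind))).exch (ctxOf_append (by grind) rfl)
  | tensorR t u iht ihu =>
    obtain ⟨A, B, rfl, h1, h2, h3⟩ := h
    exact (Derivation.tensorR (iht h1) (ihu h2) (names_disjoint h3)).exch
      (ctxOf_append (by grind) rfl)
  | tensorL z x y u ihu =>
    obtain ⟨A, B, h1, h2, h3, h4, h5, h6⟩ := h
    exact cons (by simp [Term.fv]) (by grind) h1 (.tensorL (binary (u.fv \ {x, y}) h3 h4 h5
      rfl (ihu h2)) (by rw [mem_names_ctxOf]; grind))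
  | lolliR x t ih =>
    obtain ⟨A, B, rfl, h2, h3⟩ := h
    exact .lolliR (unary _ h3 (by grind [Term.fv]) (ih h2))
  | lolliL f t x u iht ihu =>
    obtain ⟨A, B, h0, h1, h2, h3, h4, h5, h6⟩ := h
    refine cons (r := t.fv ∪ (u.fv \ {x})) (by simp [Term.fv]) (by grind) h0 ?_
    exact (Derivation.lolliL (iht h1) (unary (u.fv \ {x}) h3 (by grind) (ihu h2))
      (names_disjoint (by grind)) (by rw [mem_names_ctxOf]; grind)
      (by rw [mem_names_ctxOf]; grind)).exch (.cons _ (ctxOf_append (by grind) rfl))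
  | withR t u iht ihu =>
    obtain ⟨A, B, rfl, h1, h2, h3⟩ := h
    have : (t.withR u).fv = t.fv := by simp [Term.fv, h3]
    rw [this]
    exact .withR (iht h1) (h3 ▸ ihu h2)
  | withL₀ z x u ihu =>
    obtain ⟨A, B, h1, h2, h3, h4⟩ := h
    exact cons (by simp [Term.fv]) (by grind) h1 (.withL₀ (unary (u.fv \ {x}) h3
      (by grind) (ihu h2)) (by rw [mem_names_ctxOf]; grind))
  | withL₁ z x u ihu =>
    obtain ⟨A, B, h1, h2, h3, h4⟩ := h
    exact cons (by simp [Term.fv]) (by grind) h1 (.withL₁ (unary (u.fv \ {x}) h3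
      (by grind) (ihu h2)) (by rw [mem_names_ctxOf]; grind))
  | prom t ih =>
    obtain ⟨A, rfl, h1, h2⟩ := h
    refine .prom ?_ (ih h1)
    rintro ⟨y, B⟩ hy
    simp only [ctxOf, Term.fv, List.mem_map, Finset.mem_toList, Prod.mk.injEq] at hy
    grind
  | der z x u ihu =>
    obtain ⟨A, h1, h2, h3, h4⟩ := h
    exact cons (by simp [Term.fv]) (by grind) h1 (.der (unary (u.fv \ {x}) h3
      (by grind) (ihu h2)) (by rw [mem_names_ctxOf]; grind))
  | wk z u ihu =>
    obtain ⟨A, h1, h2, h3⟩ := h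
    exact cons (by simp [Term.fv]) (by grind) h1 (.wk (ihu h2)
      (by rw [mem_names_ctxOf]; grind))
  | ctr z x y u ihu =>
    obtain ⟨A, h1, h2, h3, h4, h5, h6⟩ := h
    exact cons (by simp [Term.fv]) (by grind) h1 (.ctr (binary (u.fv \ {x, y}) h3 h4 h5
      rfl (ihu h2)) (by rw [mem_names_ctxOf]; grind))

/-! ### Typed equivalence of proof trees -/

/-- A transformation between two trees that have the same hypotheses and prove `A` in the typing
`ρ`. -/
def TStep (ρ : ℕ → Formula α) (A : Formula α) (t u : Term α) : Prop :=
  Step t u ∧ t.WT ρ A ∧ u.WT ρ A ∧ t.fv = u.fv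

/-- The tree `t` proves `A` in the typing `ρ` and is connected to `u` by transformations between
such trees. -/
def TEq (ρ : ℕ → Formula α) (A : Formula α) (t u : Term α) : Prop :=
  t.WT ρ A ∧ Relation.EqvGen (TStep ρ A) t u

theorem TStep.eqvGen_spec {ρ : ℕ → Formula α} {A : Formula α} {t u : Term α}
    (h : Relation.EqvGen (TStep ρ A) t u) : (t.WT ρ A ↔ u.WT ρ A) ∧ t.fv = u.fv := by
  induction h with
  | rel _ _ h => exact ⟨iff_of_true h.2.1 h.2.2.1, h.2.2.2⟩
  | refl => simp
  | symm _ _ _ ih => exact ⟨ih.1.symm, ih.2.symm⟩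
  | trans _ _ _ _ _ ih ih' => exact ⟨ih.1.trans ih'.1, ih.2.trans ih'.2⟩

namespace TEq
variable {ρ ρ' : ℕ → Formula α} {A A' : Formula α} {t u v : Term α}

theorem left (h : TEq ρ A t u) : t.WT ρ A := h.1
theorem right (h : TEq ρ A t u) : u.WT ρ A := (TStep.eqvGen_spec h.2).1.1 h.1
theorem fv (h : TEq ρ A t u) : t.fv = u.fv := (TStep.eqvGen_spec h.2).2
theorem refl (h : t.WT ρ A) : TEq ρ A t t := ⟨h, .refl _⟩
theorem symm (h : TEq ρ A t u) : TEq ρ A u t := ⟨h.right, h.2.symm⟩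
theorem trans (h : TEq ρ A t u) (h' : TEq ρ A u v) : TEq ρ A t v := ⟨h.1, h.2.trans _ _ _ h'.2⟩

/-- Typed equivalence passes to a subtree position `F` in which transformations may be applied. -/
theorem map (F : Term α → Term α) (hstep : ∀ s s', Step s s' → Step (F s) (F s'))
    (hfv : ∀ s s', s.fv = s'.fv → (F s).fv = (F s').fv) (h : TEq ρ' A' t u)
    (hWT : ∀ s, s.fv = t.fv → s.WT ρ' A' → (F s).WT ρ A) : TEq ρ A (F t) (F u) := by
  refine ⟨hWT t rfl h.1, ?_⟩
  have key : ∀ a b, Relation.EqvGen (TStep ρ' A') a b → a.fv = t.fv →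
      Relation.EqvGen (TStep ρ A) (F a) (F b) := by
    intro a b hab
    induction hab with
    | rel a b h => exact fun ha => .rel _ _ ⟨hstep _ _ h.1, hWT _ ha h.2.1,
        hWT _ (h.2.2.2 ▸ ha) h.2.2.1, hfv _ _ h.2.2.2⟩
    | refl => exact fun _ => .refl _
    | symm a b h ih => exact fun ha => .symm _ _ (ih ((TStep.eqvGen_spec h).2.trans ha))
    | trans a b c h h' ih ih' =>
      exact fun ha => .trans _ _ _ (ih ha) (ih' ((TStep.eqvGen_spec h).2.symm.trans ha))
  exact key t u h.2 rfl

/-- A chain of typed transformations between closed trees lifts to proofs of the sequent `⊢ A`, as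
each tree in the chain determines a derivation. -/
theorem equivalent {π τ : LLProof [] A} (h : TEq ρ A π.term τ.term) (hπ : π.term.fv = ∅) :
    π.Equivalent τ := by
  have hd (s : Term α) (hs : s.fv = ∅) (hw : s.WT ρ A) : Derivation [] s A := by
    simpa [hs, ctxOf] using hw.derivation
  -- Trees along the chain are typed and closed as well, hence are proofs of the same sequent.
  have key : ∀ a b, Relation.EqvGen (TStep ρ A) a b → ∀ (ha : a.fv = ∅) (hb : b.fv = ∅)
      (wa : a.WT ρ A) (wb : b.WT ρ A), LLProof.Equivalent ⟨a, hd a ha wa⟩ ⟨b, hd b hb wb⟩ := by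
    intro a b hab
    induction hab with
    | rel a b h => exact fun _ _ _ _ => .rel _ _ h.1
    | refl => exact fun _ _ _ _ => .refl _
    | symm a b h ih => exact fun ha hb wa wb => .symm _ _ (ih hb ha wb wa)
    | trans a b c h h' ih ih' =>
      intro ha hc wa wc
      have := TStep.eqvGen_spec h
      exact .trans _ _ _ (ih ha (this.2 ▸ ha) wa (this.1.1 wa))
        (ih' (this.2 ▸ ha) hc (this.1.1 wa) wc)
  exact key _ _ h.2 hπ (h.fv ▸ hπ) h.left h.right

end TEq

/-- `t ⇛ u`: whenever `t` is well typed, so is `u`, and the two are equivalent in this typing. The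
relation is not symmetric, as `u` may have typings that `t` does not have. -/
def Fwd (t u : Term α) : Prop := ∀ (ρ : ℕ → Formula α) (A : Formula α), t.WT ρ A → TEq ρ A t u

infix:50 " ⇛ " => Fwd

namespace Fwd
variable {t t' u u' v : Term α}

theorem refl (t : Term α) : t ⇛ t := fun _ _ h => .refl h
theorem of_eq (h : t = u) : t ⇛ u := h ▸ refl t
theorem trans (h : t ⇛ u) (h' : u ⇛ v) : t ⇛ v :=
  fun ρ A ht => (h ρ A ht).trans (h' ρ A (h ρ A ht).right)

theorem of_step (h : Step t u) (hu : ∀ ρ A, t.WT ρ A → u.WT ρ A ∧ t.fv = u.fv) : t ⇛ u :=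
  fun ρ A ht => ⟨ht, .rel _ _ ⟨h, ht, hu ρ A ht⟩⟩

theorem of_step_symm (h : Step u t) (hu : ∀ ρ A, t.WT ρ A → u.WT ρ A ∧ t.fv = u.fv) : t ⇛ u :=
  fun ρ A ht => ⟨ht, .symm _ _ (.rel _ _ ⟨h, (hu ρ A ht).1, ht, (hu ρ A ht).2.symm⟩)⟩

theorem map (F : Term α → Term α) (hstep : ∀ s s', Step s s' → Step (F s) (F s'))
    (hfv : ∀ s s', s.fv = s'.fv → (F s).fv = (F s').fv)
    (hWT : ∀ ρ C s, (F s).WT ρ C → ∃ ρ' A, s.WT ρ' A ∧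
      ∀ s', s'.fv = s.fv → s'.WT ρ' A → (F s').WT ρ C) (h : t ⇛ u) : F t ⇛ F u := by
  intro ρ C ht
  obtain ⟨ρ', A, h1, h2⟩ := hWT ρ C t ht
  exact (h ρ' A h1).map F hstep hfv h2

/-! ### Congruence -/

theorem cutL {A : Formula α} {x : ℕ} (h : t ⇛ t') : .cut A t x u ⇛ .cut A t' x u :=
  h.map (fun s => .cut A s x u) (fun _ _ => .cut_congr_left) (by simp +contextual [Term.fv])
    fun ρ C s hs => ⟨ρ, A, hs.1, fun s' h1 h2 => ⟨h2, hs.2.1, hs.2.2.1, h1 ▸ hs.2.2.2⟩⟩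

theorem cutR {A : Formula α} {x : ℕ} (h : u ⇛ u') : .cut A t x u ⇛ .cut A t x u' :=
  h.map (fun s => .cut A t x s) (fun _ _ => .cut_congr_right) (by simp +contextual [Term.fv])
    fun ρ C s hs => ⟨_, _, hs.2.1, fun s' h1 h2 =>
      ⟨hs.1, h2, h1 ▸ hs.2.2.1, h1 ▸ hs.2.2.2⟩⟩

theorem tensorR_left (h : t ⇛ t') : .tensorR t u ⇛ .tensorR t' u :=
  h.map (fun s => .tensorR s u) (fun _ _ => .tensorR_congr_left) (by simp +contextual [Term.fv])
    fun ρ C s ⟨A, B, h1, h2, h3⟩ => ⟨_, _, h2, fun s' hf hs => ⟨A, B, h1, hs, hf ▸ h3⟩⟩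

theorem tensorR_right (h : u ⇛ u') : .tensorR t u ⇛ .tensorR t u' :=
  h.map (fun s => .tensorR t s) (fun _ _ => .tensorR_congr_right) (by simp +contextual [Term.fv])
    fun ρ C s ⟨A, B, h1, h2, h3, h4⟩ =>
      ⟨_, _, h3, fun s' hf hs => ⟨A, B, h1, h2, hs, hf ▸ h4⟩⟩

theorem lolliR {x : ℕ} (h : u ⇛ u') : .lolliR x u ⇛ .lolliR x u' :=
  h.map (fun s => .lolliR x s) (fun _ _ => .lolliR_congr) (by simp +contextual [Term.fv])
    fun ρ C s ⟨A, B, h1, h2, h3⟩ => ⟨_, _, h2, fun s' hf hs => ⟨A, B, h1, hs, hf ▸ h3⟩⟩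

theorem lolliL_left {f x : ℕ} (h : t ⇛ t') : .lolliL f t x u ⇛ .lolliL f t' x u :=
  h.map (fun s => .lolliL f s x u) (fun _ _ => .lolliL_congr_left)
    (by simp +contextual [Term.fv])
    fun ρ C s ⟨A, B, h1, h2, h3⟩ => ⟨_, _, h2, fun s' hf hs => ⟨A, B, h1, hs, hf ▸ h3⟩⟩

theorem lolliL_right {f x : ℕ} (h : u ⇛ u') : .lolliL f t x u ⇛ .lolliL f t x u' :=
  h.map (fun s => .lolliL f t x s) (fun _ _ => .lolliL_congr_right)
    (by simp +contextual [Term.fv])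
    fun ρ C s ⟨A, B, h1, h2, h3, h4⟩ =>
      ⟨_, _, h3, fun s' hf hs => ⟨A, B, h1, h2, hs, hf ▸ h4⟩⟩

theorem withR_left (h : t ⇛ t') : .withR t u ⇛ .withR t' u :=
  h.map (fun s => .withR s u) (fun _ _ => .withR_congr_left) (by simp +contextual [Term.fv])
    fun ρ C s ⟨A, B, h1, h2, h3, h4⟩ => ⟨_, _, h2, fun s' hf hs => ⟨A, B, h1, hs, h3, hf ▸ h4⟩⟩

theorem withR_right (h : u ⇛ u') : .withR t u ⇛ .withR t u' :=
  h.map (fun s => .withR t s) (fun _ _ => .withR_congr_right) (by simp +contextual [Term.fv])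
    fun ρ C s ⟨A, B, h1, h2, h3, h4⟩ =>
      ⟨_, _, h3, fun s' hf hs => ⟨A, B, h1, h2, hs, hf ▸ h4⟩⟩

theorem withR (h : t ⇛ t') (h' : u ⇛ u') : .withR t u ⇛ .withR t' u' :=
  h.withR_left.trans h'.withR_right

theorem prom (h : t ⇛ t') : .prom t ⇛ .prom t' :=
  h.map .prom (fun _ _ => .prom_congr) (by simp +contextual [Term.fv])
    fun ρ C s ⟨A, h1, h2, h3⟩ => ⟨_, _, h2, fun s' hf hs => ⟨A, h1, hs, hf ▸ h3⟩⟩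

theorem withL₀ {z x : ℕ} (h : u ⇛ u') : .withL₀ z x u ⇛ .withL₀ z x u' :=
  h.map (fun s => .withL₀ z x s) (fun _ _ => .withL₀_congr) (by simp +contextual [Term.fv])
    fun ρ C s ⟨A, B, h1, h2, h3⟩ => ⟨_, _, h2, fun s' hf hs => ⟨A, B, h1, hs, hf ▸ h3⟩⟩

theorem withL₁ {z x : ℕ} (h : u ⇛ u') : .withL₁ z x u ⇛ .withL₁ z x u' :=
  h.map (fun s => .withL₁ z x s) (fun _ _ => .withL₁_congr) (by simp +contextual [Term.fv])
    fun ρ C s ⟨A, B, h1, h2, h3⟩ => ⟨_, _, h2, fun s' hf hs => ⟨A, B, h1, hs, hf ▸ h3⟩⟩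

theorem der {z x : ℕ} (h : u ⇛ u') : .der z x u ⇛ .der z x u' :=
  h.map (fun s => .der z x s) (fun _ _ => .der_congr) (by simp +contextual [Term.fv])
    fun ρ C s ⟨A, h1, h2, h3⟩ => ⟨_, _, h2, fun s' hf hs => ⟨A, h1, hs, hf ▸ h3⟩⟩

theorem wk {z : ℕ} (h : u ⇛ u') : .wk z u ⇛ .wk z u' :=
  h.map (fun s => .wk z s) (fun _ _ => .wk_congr) (by simp +contextual [Term.fv])
    fun ρ C s ⟨A, h1, h2, h3⟩ => ⟨_, _, h2, fun s' hf hs => ⟨A, h1, hs, hf ▸ h3⟩⟩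

theorem ctr {z x y : ℕ} (h : u ⇛ u') : .ctr z x y u ⇛ .ctr z x y u' :=
  h.map (fun s => .ctr z x y s) (fun _ _ => .ctr_congr) (by simp +contextual [Term.fv])
    fun ρ C s ⟨A, h1, h2, h3⟩ => ⟨_, _, h2, fun s' hf hs => ⟨A, h1, hs, hf ▸ h3⟩⟩

end Fwd

namespace TEq
variable {ρ : ℕ → Formula α} {A B C : Formula α} {t t' u u' : Term α} {x y z : ℕ}

theorem cutL (h : TEq ρ A t t') (hw : (Term.cut A t x u).WT ρ C) :
    TEq ρ C (.cut A t x u) (.cut A t' x u) :=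
  h.map (fun s => .cut A s x u) (fun _ _ => .cut_congr_left) (by simp +contextual [Term.fv])
    fun _ h1 h2 => ⟨h2, hw.2.1, hw.2.2.1, h1 ▸ hw.2.2.2⟩

theorem cutR (h : TEq (update ρ x A) C u u') (hw : (Term.cut A t x u).WT ρ C) :
    TEq ρ C (.cut A t x u) (.cut A t x u') :=
  h.map (fun s => .cut A t x s) (fun _ _ => .cut_congr_right) (by simp +contextual [Term.fv])
    fun _ h1 h2 => ⟨hw.1, h2, h1 ▸ hw.2.2.1, h1 ▸ hw.2.2.2⟩

theorem ctr (h : TEq (update (update ρ y (!ₗA)) x (!ₗA)) C u u') (hA : ρ z = !ₗA)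
    (hw : (Term.ctr z x y u).WT ρ C) : TEq ρ C (.ctr z x y u) (.ctr z x y u') :=
  h.map (fun s => .ctr z x y s) (fun _ _ => .ctr_congr) (by simp +contextual [Term.fv])
    fun _ h1 h2 => by
      obtain ⟨_, _, _, h⟩ := hw
      exact ⟨A, hA, h2, h1 ▸ h⟩

theorem lolliR (h : TEq (update ρ x A) B u u') (hw : (Term.lolliR x u).WT ρ (A ⊸ₗ B)) :
    TEq ρ (A ⊸ₗ B) (.lolliR x u) (.lolliR x u') :=
  h.map (fun s => .lolliR x s) (fun _ _ => .lolliR_congr) (by simp +contextual [Term.fv])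
    fun _ h1 h2 => by
      obtain ⟨_, _, _, _, h⟩ := hw
      exact ⟨A, B, rfl, h2, h1 ▸ h⟩

theorem fwd (h : TEq ρ A t u) (h' : u ⇛ u') : TEq ρ A t u' := h.trans (h' ρ A h.right)

theorem tensorR (ht : TEq ρ A t t') (hu : TEq ρ B u u') (hd : ∀ y ∈ t.fv, y ∉ u.fv) :
    TEq ρ (A ⊗ₗ B) (.tensorR t u) (.tensorR t' u') :=
  (ht.map (fun s => .tensorR s u) (fun _ _ => .tensorR_congr_left) (by simp +contextual [Term.fv])
    fun _ h1 h2 => ⟨A, B, rfl, h2, hu.left, h1 ▸ hd⟩).trans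
  (hu.map (fun s => .tensorR t' s) (fun _ _ => .tensorR_congr_right)
    (by simp +contextual [Term.fv]) fun _ h1 h2 => ⟨A, B, rfl, ht.right, h2, ht.fv ▸ h1 ▸ hd⟩)

theorem prom (ht : TEq ρ A t t') (h : t.fv = ∅) : TEq ρ (!ₗA) (.prom t) (.prom t') :=
  ht.map .prom (fun _ _ => .prom_congr) (by simp +contextual [Term.fv])
    fun _ h1 h2 => ⟨A, rfl, h2, by simp [h1, h]⟩

end TEq

/-! ### The transformations in typed form -/

namespace Fwd
variable {A B C : Formula α} {s t t' u u' v : Term α} {x y z w a b f : ℕ}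

theorem alpha_cut {x' : ℕ} (h : x' ∉ u.fv) : .cut A t x u ⇛ .cut A t x' (u.swap x x') :=
  of_step (.alpha_cut h) fun ρ D ⟨h1, h2, h3, h4⟩ => by
    have hm (y) : y ∈ (u.swap x x').fv ↔ Equiv.swap x x' y ∈ u.fv := Term.mem_fv_swap
    refine ⟨⟨h1, (Term.WT_swap_update (.inl h)).2 h2, by simpa [hm] using h3, ?_⟩, ?_⟩
    · intro y hy; rw [hm]; grind
    · ext y; simp only [Term.fv, Finset.mem_union, Finset.mem_sdiff, hm, Finset.mem_singleton]
      grind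

theorem alpha_cut_symm {x' : ℕ} (h : x' ∉ u.fv) : .cut A t x' (u.swap x x') ⇛ .cut A t x u := by
  have h1 : x ∉ (u.swap x x').fv := by rw [Term.mem_fv_swap]; simpa
  have := alpha_cut (A := A) (t := t) (x := x') h1
  rwa [show (u.swap x x').swap x' x = u by
    rw [Term.swap, Equiv.swap_comm x' x]; exact Term.swap_swap x x' u] at this

theorem alpha_lolliR {x' : ℕ} (h : x' ∉ u.fv) : .lolliR x u ⇛ .lolliR x' (u.swap x x') :=
  of_step (.alpha_lolliR h) fun ρ D ⟨A, B, h1, h2, h3⟩ => by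
    have hm (y) : y ∈ (u.swap x x').fv ↔ Equiv.swap x x' y ∈ u.fv := Term.mem_fv_swap
    refine ⟨⟨A, B, h1, (Term.WT_swap_update (.inl h)).2 h2, by simpa [hm] using h3⟩, ?_⟩
    ext y; simp only [Term.fv, Finset.mem_sdiff, hm, Finset.mem_singleton]
    grind

theorem ctr_comm : .ctr z x y u ⇛ .ctr z y x u :=
  of_step .ctr_comm fun ρ D ⟨A, h1, h2, h3, h4, h5, h6⟩ => by
    refine ⟨⟨A, h1, ?_, h4, h3, h5.symm, fun h => (h6 h).symm⟩, by grind [Term.fv]⟩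
    rwa [Function.update_comm h5]

theorem alpha_ctr {x' : ℕ} (h : x' ∉ u.fv) : .ctr z x y u ⇛ .ctr z x' y (u.swap x x') :=
  of_step (.alpha_ctr h) fun ρ D ⟨A, h1, h2, h3, h4, h5, h6⟩ => by
    have hm (y) : y ∈ (u.swap x x').fv ↔ Equiv.swap x x' y ∈ u.fv := Term.mem_fv_swap
    have hy : Equiv.swap x x' y = y := Equiv.swap_apply_of_ne_of_ne (by grind) (by grind)
    refine ⟨⟨A, h1, (Term.WT_swap_update (.inl h)).2 h2, by simpa [hm] using h3,
      by rwa [hm, hy], by grind, ?_⟩, ?_⟩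
    · rw [hm]; grind
    · ext y; simp only [Term.fv, Finset.mem_sdiff, hm, Finset.mem_singleton, Finset.mem_union,
        Finset.mem_insert]
      grind

theorem cut_ax_left (h : y ∉ u.fv \ {x}) : .cut A (.ax y) x u ⇛ u.swap x y :=
  of_step (.cut_ax_left h) fun ρ D ⟨h1, h2, h3, h4⟩ => by
    obtain rfl := h1
    have hm (z) : z ∈ (u.swap x y).fv ↔ Equiv.swap x y z ∈ u.fv := Term.mem_fv_swap
    have := (Term.WT_swap_update (x := x) (x' := y) (by grind)).2 h2
    rw [Function.update_eq_self] at this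
    refine ⟨this, ?_⟩
    ext y; simp only [Term.fv, Finset.mem_sdiff, hm, Finset.mem_singleton, Finset.mem_union]
    grind

theorem cut_ax_self : .cut A (.ax x) x u ⇛ u := by
  have := cut_ax_left (A := A) (u := u) (x := x) (y := x) (by simp)
  rwa [Term.swap, Equiv.swap_self, Term.rename_refl] at this

theorem cut_ax_right : .cut A t x (.ax x) ⇛ t :=
  of_step .cut_ax_right fun ρ D ⟨h1, h2, h3, h4⟩ => by
    simp only [Term.WT, Function.update_self] at h2
    exact ⟨h2 ▸ h1, by simp [Term.fv]⟩

theorem cut_assoc₀ (h : x ∉ v.fv) :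
    .cut B (.cut A t x u) y v ⇛ .cut A t x (.cut B u y v) :=
  of_step (.cut_assoc h) fun ρ D ⟨⟨h1, h2, h3, h4⟩, h5, h6, h7⟩ =>
    ⟨⟨h1, ⟨h2, h5.congr (by grind), h6, by grind [Term.fv]⟩, by grind [Term.fv],
      by grind [Term.fv]⟩, by ext; grind [Term.fv]⟩

theorem cut_assoc_symm₀ (h : x ∉ v.fv) :
    .cut A t x (.cut B u y v) ⇛ .cut B (.cut A t x u) y v :=
  of_step_symm (.cut_assoc h) fun ρ D ⟨h1, ⟨h2, h3, h4, h5⟩, h6, h7⟩ =>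
    ⟨⟨⟨h1, h2, by grind [Term.fv], by grind [Term.fv]⟩, h3.congr (by grind), h4,
      by grind [Term.fv]⟩, by ext; grind [Term.fv]⟩

theorem exists_fresh (S : Finset ℕ) : ∃ w, w ∉ S := Infinite.exists_notMem_finset S

/-- The name `x` may coincide with `y`, since the latter can be renamed first. -/
theorem cut_assoc (h : x ∉ v.fv ∨ x = y) :
    .cut B (.cut A t x u) y v ⇛ .cut A t x (.cut B u y v) := by
  obtain ⟨y', hy'⟩ := exists_fresh (insert x v.fv)
  refine (alpha_cut (x' := y') (by grind)).trans ((cut_assoc₀ ?_).trans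
    (alpha_cut_symm (by grind)).cutR)
  rw [Term.mem_fv_swap]
  grind

/-- See `Fwd.cut_assoc` for the case `x = y`. -/
theorem cut_assoc_symm (h : x ∉ v.fv ∨ x = y) :
    .cut A t x (.cut B u y v) ⇛ .cut B (.cut A t x u) y v := by
  obtain ⟨y', hy'⟩ := exists_fresh (insert x v.fv)
  refine (alpha_cut (x' := y') (by grind)).cutR.trans ((cut_assoc_symm₀ ?_).trans
    (alpha_cut_symm (by grind)))
  rw [Term.mem_fv_swap]
  grind

theorem cut_comm (hxy : x ≠ y) (hx : x ∉ u.fv) (hy : y ∉ t.fv) :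
    .cut A t x (.cut B u y v) ⇛ .cut B u y (.cut A t x v) :=
  of_step (.cut_comm hxy hx hy) fun ρ D ⟨h1, ⟨h2, h3, h4, h5⟩, h6, h7⟩ =>
    ⟨⟨h2.congr (by grind), ⟨h1.congr (by grind), by rwa [Function.update_comm hxy.symm],
      by grind [Term.fv], by grind [Term.fv]⟩, by grind [Term.fv], by grind [Term.fv]⟩,
      by ext; grind [Term.fv]⟩

theorem cut_tensor (hxy : x ≠ y) (hx : x ∉ s.fv) :
    .cut (A ⊗ₗ B) (.tensorR t s) z (.tensorL z x y u) ⇛ .cut A t x (.cut B s y u) :=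
  of_step (.cut_tensor hxy hx) fun ρ D ⟨⟨A', B', h0, h1, h2, h3⟩,
      ⟨A'', B'', h4, h5, h6, h7, h8, h9⟩, h10, h11⟩ => by
    simp only [Formula.tensor.injEq, Function.update_self] at h0 h4
    obtain ⟨rfl, rfl⟩ := h0
    obtain ⟨rfl, rfl⟩ := h4
    simp only [Term.fv, Finset.mem_union, Finset.mem_sdiff, Finset.mem_singleton,
      Finset.mem_insert] at h11
    exact ⟨⟨h1, ⟨h2.congr (by grind), h5.congr (by grind), h7, by grind [Term.fv]⟩,
      by grind [Term.fv], by grind [Term.fv]⟩, by ext; grind [Term.fv]⟩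

theorem cut_lolli :
    .cut (A ⊸ₗ B) (.lolliR x t) f (.lolliL f s y u) ⇛ .cut B (.cut A s x t) y u :=
  of_step .cut_lolli fun ρ D ⟨⟨A', B', h0, h1, h2⟩, ⟨A'', B'', h4, h5, h6, h7, h8, h9⟩,
      h10, h11⟩ => by
    simp only [Formula.lolli.injEq, Function.update_self] at h0 h4
    obtain ⟨rfl, rfl⟩ := h0
    obtain ⟨rfl, rfl⟩ := h4
    simp only [Term.fv, Finset.mem_union, Finset.mem_sdiff, Finset.mem_singleton] at h11
    exact ⟨⟨⟨h5.congr (by grind), h1, h2, by grind [Term.fv]⟩, h6.congr (by grind), h7,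
      by grind [Term.fv]⟩, by ext; grind [Term.fv]⟩

theorem cut_with₀ : .cut (A &ₗ B) (.withR t s) z (.withL₀ z x u) ⇛ .cut A t x u :=
  of_step .cut_with₀ fun ρ D ⟨⟨A', B', h0, h1, h2, h3⟩, ⟨A'', B'', h4, h5, h6, h7⟩, h8, h9⟩ => by
    simp only [Formula.with.injEq, Function.update_self] at h0 h4
    obtain ⟨rfl, rfl⟩ := h0
    obtain ⟨rfl, rfl⟩ := h4
    exact ⟨⟨h1, h5.congr (by grind), h6, by grind [Term.fv]⟩, by ext; grind [Term.fv]⟩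

theorem cut_with₁ : .cut (A &ₗ B) (.withR t s) z (.withL₁ z x u) ⇛ .cut B s x u :=
  of_step .cut_with₁ fun ρ D ⟨⟨A', B', h0, h1, h2, h3⟩, ⟨A'', B'', h4, h5, h6, h7⟩, h8, h9⟩ => by
    simp only [Formula.with.injEq, Function.update_self] at h0 h4
    obtain ⟨rfl, rfl⟩ := h0
    obtain ⟨rfl, rfl⟩ := h4
    exact ⟨⟨h2, h5.congr (by grind), h6, by grind [Term.fv]⟩, by ext; grind [Term.fv]⟩

theorem cut_der : .cut (!ₗA) (.prom t) z (.der z x u) ⇛ .cut A t x u :=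
  of_step .cut_der fun ρ D ⟨⟨A', h0, h1, h2⟩, ⟨A'', h4, h5, h6, h7⟩, h8, h9⟩ => by
    simp only [Formula.bang.injEq, Function.update_self] at h0 h4
    subst h0 h4
    exact ⟨⟨h1, h5.congr (by grind), h6, by grind [Term.fv]⟩, by ext; grind [Term.fv]⟩

theorem cut_wk_closed (ht : t.fv = ∅) : .cut (!ₗA) (.prom t) z (.wk z u) ⇛ u :=
  of_step (.cut_wk [] (by simp) (by simp [ht])) fun ρ D ⟨h1, ⟨A', h4, h5, h6⟩, h8, h9⟩ =>
    ⟨h5.congr (by grind), by ext; grind [Term.fv]⟩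

theorem cut_wk_single (ht : t.fv = {w}) : .cut (!ₗA) (.prom t) z (.wk z u) ⇛ .wk w u :=
  of_step (.cut_wk [w] (by simp) (by simp [ht]))
    fun ρ D ⟨⟨A'', _, h1, h2⟩, ⟨A', h4, h5, h6⟩, h8, h9⟩ => by
    obtain ⟨B, hB⟩ := h2 w (by simp [ht])
    simp only [Term.fv, Finset.mem_singleton, ht] at h9
    exact ⟨⟨B, hB, h5.congr (by grind), by grind [Term.fv]⟩, by ext; grind [Term.fv]⟩

theorem cut_ctr_closed (ht : t.fv = ∅) (hxy : x ≠ y) :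
    .cut (!ₗA) (.prom t) z (.ctr z x y u) ⇛ .cut (!ₗA) (.prom t) x (.cut (!ₗA) (.prom t) y u) :=
  of_step (.cut_ctr [] (by simp) (by simp [ht]) (by simp) (by simp) hxy)
    fun ρ D ⟨⟨A', h0, h1, h2⟩, ⟨A'', h4, h5, h6, h7⟩, h8, h9⟩ => by
    simp only [Formula.bang.injEq, Function.update_self] at h0 h4
    subst h0 h4
    exact ⟨⟨⟨_, rfl, h1, h2⟩, ⟨⟨_, rfl, h1.congr (by grind), by grind⟩, h5.congr (by grind),
      by grind [Term.fv], by grind [Term.fv]⟩, by grind [Term.fv], by grind [Term.fv]⟩,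
      by ext; grind [Term.fv]⟩

theorem cut_ctr_single {w' : ℕ} (ht : t.fv = {w}) (hxy : x ≠ y) (h1 : w' ≠ w) (h2 : w' ∉ u.fv)
    (h3 : w' ≠ x) (h4 : w' ≠ y) :
    .cut (!ₗA) (.prom t) z (.ctr z x y u) ⇛
      .ctr w w w' (.cut (!ₗA) (.prom t) x (.cut (!ₗA) (.prom (t.swap w w')) y u)) :=
  of_step (.cut_ctr [(w, w')] (by simp) (by simp [ht]) (by simp) (by simp [*]) hxy)
    fun ρ D ⟨⟨A', k0, k1, k2⟩, ⟨A'', k4, k5, k6, k7⟩, k8, k9⟩ => by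
    simp only [Formula.bang.injEq, Function.update_self] at k0 k4
    subst k0 k4
    obtain ⟨B, hB⟩ := k2 w (by simp [ht])
    have hm (z) : z ∈ (t.swap w w').fv ↔ z = w' := by
      rw [Term.mem_fv_swap, ht]
      grind
    have hfv : (t.swap w w').fv = {w'} := by ext; simp [hm]
    have hw (ρ' : ℕ → Formula α) (h : ρ' w' = ρ w) : (t.swap w w').WT ρ' A := by
      rw [Term.swap, Term.WT_rename]
      exact k1.congr (by simp [ht, h])
    refine ⟨⟨B, hB, ⟨⟨A, rfl, k1.congr (by grind), by grind⟩, ⟨⟨A, rfl, hw _ (by grind),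
      by grind⟩, k5.congr (by grind [Term.fv]), ?_, ?_⟩, ?_, ?_⟩, ?_⟩, ?_⟩ <;>
    simp only [Term.fv, hfv, ht] at * <;> grind

theorem cut_prom :
    .cut (!ₗA) (.prom t) x (.prom u) ⇛ .prom (.cut (!ₗA) (.prom t) x u) :=
  of_step .cut_prom fun ρ D ⟨⟨A', h0, h1, h2⟩, ⟨A'', h4, h5, h6⟩, h8, h9⟩ =>
    ⟨⟨A'', h4, ⟨⟨A', h0, h1, h2⟩, h5, h8, h9⟩, by grind [Term.fv]⟩, by ext; grind [Term.fv]⟩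

/-- Moving a left rule out of the left premise of a cut is allowed also if one of its active names
is the name of the cut formula, since the latter can be renamed. -/
theorem left_relax {F : Term α → Term α} (hF : ∀ s s', s ⇛ s' → F s ⇛ F s')
    (h : ∀ u w, x ∉ u.fv → y ∉ u.fv → .cut C (F t) w u ⇛ F (.cut C t w u))
    (hx : x ∉ u.fv ∨ x = w) (hy : y ∉ u.fv ∨ y = w) :
    .cut C (F t) w u ⇛ F (.cut C t w u) := by
  obtain ⟨w', hw'⟩ := exists_fresh (insert x (insert y u.fv))
  refine (alpha_cut (x' := w') (by grind)).trans ((h _ _ ?_ ?_).trans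
    (hF _ _ (alpha_cut_symm (by grind)))) <;>
  · rw [Term.mem_fv_swap]
    grind

theorem left_lolliL (hx : x ∉ u.fv ∨ x = w) :
    .cut C (.lolliL f s x t) w u ⇛ .lolliL f s x (.cut C t w u) :=
  left_relax (F := fun t => .lolliL f s x t) (x := x) (y := x) (fun _ _ h => h.lolliL_right)
    (fun u w hx _ => of_step (.left_lolliL hx)
      fun ρ D ⟨⟨A, B, h0, h1, h2, h3, h4, h5, h6⟩, h7, h8, h9⟩ =>
      ⟨⟨A, B, h0, h1, ⟨h2, h7.congr (by grind), h8, by grind [Term.fv]⟩, by grind [Term.fv],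
        by grind [Term.fv], h5, by grind [Term.fv]⟩, by ext; grind [Term.fv]⟩) hx hx

theorem left_withL₀ (hx : x ∉ u.fv ∨ x = w) :
    .cut C (.withL₀ z x t) w u ⇛ .withL₀ z x (.cut C t w u) :=
  left_relax (F := fun t => .withL₀ z x t) (x := x) (y := x) (fun _ _ h => h.withL₀)
    (fun u w hx _ => of_step (.left_withL₀ hx)
      fun ρ D ⟨⟨A, B, h0, h1, h2, h3⟩, h7, h8, h9⟩ =>
      ⟨⟨A, B, h0, ⟨h1, h7.congr (by grind), h8, by grind [Term.fv]⟩, by grind [Term.fv],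
        by grind [Term.fv]⟩, by ext; grind [Term.fv]⟩) hx hx

theorem left_withL₁ (hx : x ∉ u.fv ∨ x = w) :
    .cut C (.withL₁ z x t) w u ⇛ .withL₁ z x (.cut C t w u) :=
  left_relax (F := fun t => .withL₁ z x t) (x := x) (y := x) (fun _ _ h => h.withL₁)
    (fun u w hx _ => of_step (.left_withL₁ hx)
      fun ρ D ⟨⟨A, B, h0, h1, h2, h3⟩, h7, h8, h9⟩ =>
      ⟨⟨A, B, h0, ⟨h1, h7.congr (by grind), h8, by grind [Term.fv]⟩, by grind [Term.fv],
        by grind [Term.fv]⟩, by ext; grind [Term.fv]⟩) hx hx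

theorem left_der (hx : x ∉ u.fv ∨ x = w) :
    .cut C (.der z x t) w u ⇛ .der z x (.cut C t w u) :=
  left_relax (F := fun t => .der z x t) (x := x) (y := x) (fun _ _ h => h.der)
    (fun u w hx _ => of_step (.left_der hx)
      fun ρ D ⟨⟨A, h0, h1, h2, h3⟩, h7, h8, h9⟩ =>
      ⟨⟨A, h0, ⟨h1, h7.congr (by grind), h8, by grind [Term.fv]⟩, by grind [Term.fv],
        by grind [Term.fv]⟩, by ext; grind [Term.fv]⟩) hx hx

theorem left_wk : .cut C (.wk z t) w u ⇛ .wk z (.cut C t w u) :=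
  of_step .left_wk fun ρ D ⟨⟨A, h0, h1, h2⟩, h7, h8, h9⟩ =>
      ⟨⟨A, h0, ⟨h1, h7, h8, by grind [Term.fv]⟩, by grind [Term.fv]⟩, by ext; grind [Term.fv]⟩

theorem left_ctr (hx : x ∉ u.fv ∨ x = w) (hy : y ∉ u.fv ∨ y = w) :
    .cut C (.ctr z x y t) w u ⇛ .ctr z x y (.cut C t w u) :=
  left_relax (F := fun t => .ctr z x y t) (fun _ _ h => h.ctr)
    (fun u w hx hy => of_step (.left_ctr hx hy)
      fun ρ D ⟨⟨A, h0, h1, h2, h3, h4, h5⟩, h7, h8, h9⟩ =>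
      ⟨⟨A, h0, ⟨h1, h7.congr (by grind), h8, by grind [Term.fv]⟩, by grind [Term.fv],
        by grind [Term.fv], h4, by grind [Term.fv]⟩, by ext; grind [Term.fv]⟩) hx hy

theorem right_tensorR₀ (hu : x ∈ u.fv) (hv : x ∉ v.fv) :
    .cut A t x (.tensorR u v) ⇛ .tensorR (.cut A t x u) v :=
  of_step (.right_tensorR₀ hu hv) fun ρ D ⟨h0, ⟨A, B, h1, h2, h3, h4⟩, h5, h6⟩ =>
    ⟨⟨A, B, h1, ⟨h0, h2, hu, by grind [Term.fv]⟩, h3.congr (by grind), by grind [Term.fv]⟩,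
      by ext; grind [Term.fv]⟩

theorem right_tensorR₁ (hu : x ∉ u.fv) (hv : x ∈ v.fv) :
    .cut A t x (.tensorR u v) ⇛ .tensorR u (.cut A t x v) :=
  of_step (.right_tensorR₁ hu hv) fun ρ D ⟨h0, ⟨A, B, h1, h2, h3, h4⟩, h5, h6⟩ =>
    ⟨⟨A, B, h1, h2.congr (by grind), ⟨h0, h3, hv, by grind [Term.fv]⟩, by grind [Term.fv]⟩,
      by ext; grind [Term.fv]⟩

theorem right_tensorL (hz : x ≠ z) (ha : a ≠ x) (hb : b ≠ x) (hat : a ∉ t.fv) (hbt : b ∉ t.fv) :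
    .cut A t x (.tensorL z a b u) ⇛ .tensorL z a b (.cut A t x u) :=
  of_step (.right_tensorL hz ha hb hat hbt)
    fun ρ D ⟨h0, ⟨A, B, h1, h2, h3, h4, h5, h6⟩, h7, h8⟩ =>
    ⟨⟨A, B, by grind, ⟨h0.congr (by grind), h2.congr (by grind), by grind [Term.fv],
      by grind [Term.fv]⟩, by grind [Term.fv], by grind [Term.fv], h5, by grind [Term.fv]⟩,
      by ext; grind [Term.fv]⟩

theorem right_lolliR (ha : a ≠ x) (hat : a ∉ t.fv) :
    .cut A t x (.lolliR a u) ⇛ .lolliR a (.cut A t x u) :=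
  of_step (.right_lolliR ha hat)
    fun ρ D ⟨h0, ⟨A, B, h1, h2, h3⟩, h7, h8⟩ =>
    ⟨⟨A, B, h1, ⟨h0.congr (by grind), h2.congr (by grind), by grind [Term.fv],
      by grind [Term.fv]⟩, by grind [Term.fv]⟩, by ext; grind [Term.fv]⟩

theorem right_lolliL₀ (hf : x ≠ f) (hs : x ∈ s.fv) (hu : x ∉ u.fv ∨ x = a) :
    .cut A t x (.lolliL f s a u) ⇛ .lolliL f (.cut A t x s) a u :=
  of_step (.right_lolliL₀ hf hs (by grind))
    fun ρ D ⟨h0, ⟨A, B, h1, h2, h3, h4, h5, h6, h7⟩, h8, h9⟩ =>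
    ⟨⟨A, B, by grind, ⟨h0, h2, hs, by grind [Term.fv]⟩, h3.congr (by grind), h4,
      by grind [Term.fv], by grind [Term.fv], h7⟩, by ext; grind [Term.fv]⟩

theorem right_withR : .cut A t x (.withR u v) ⇛ .withR (.cut A t x u) (.cut A t x v) :=
  of_step .right_withR fun ρ D ⟨h0, ⟨A, B, h1, h2, h3, h4⟩, h5, h6⟩ =>
    ⟨⟨A, B, h1, ⟨h0, h2, by grind [Term.fv], by grind [Term.fv]⟩,
      ⟨h0, h3, by grind [Term.fv], by grind [Term.fv]⟩, by grind [Term.fv]⟩,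
      by ext; grind [Term.fv]⟩

theorem right_der (hz : x ≠ z) (ha : a ≠ x) (hat : a ∉ t.fv) :
    .cut A t x (.der z a u) ⇛ .der z a (.cut A t x u) :=
  of_step (.right_der hz ha hat)
    fun ρ D ⟨h0, ⟨A, h1, h2, h3, h4⟩, h7, h8⟩ =>
    ⟨⟨A, by grind, ⟨h0.congr (by grind), h2.congr (by grind), by grind [Term.fv],
      by grind [Term.fv]⟩, by grind [Term.fv], by grind [Term.fv]⟩,
      by ext; grind [Term.fv]⟩

theorem right_wk (hz : x ≠ z) : .cut A t x (.wk z u) ⇛ .wk z (.cut A t x u) :=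
  of_step (.right_wk hz)
    fun ρ D ⟨h0, ⟨A, h1, h2, h3⟩, h7, h8⟩ =>
    ⟨⟨A, by grind, ⟨h0, h2, by grind [Term.fv], by grind [Term.fv]⟩, by grind [Term.fv]⟩,
      by ext; grind [Term.fv]⟩

theorem right_ctr (hz : x ≠ z) (ha : a ≠ x) (hb : b ≠ x) (hat : a ∉ t.fv) (hbt : b ∉ t.fv) :
    .cut A t x (.ctr z a b u) ⇛ .ctr z a b (.cut A t x u) :=
  of_step (.right_ctr hz ha hb hat hbt)
    fun ρ D ⟨h0, ⟨A, h1, h2, h3, h4, h5, h6⟩, h7, h8⟩ =>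
    ⟨⟨A, by grind, ⟨h0.congr (by grind), h2.congr (by grind), by grind [Term.fv],
      by grind [Term.fv]⟩, by grind [Term.fv], by grind [Term.fv], h5, by grind [Term.fv]⟩,
      by ext; grind [Term.fv]⟩

theorem ctr_assoc (hxy : x ≠ y) (haw : a ≠ w) (hw : w ∉ u.fv ∨ w = a ∨ w = b) :
    .ctr z x y (.ctr x a b u) ⇛ .ctr z a w (.ctr w b y u) :=
  of_step (.ctr_assoc hxy haw)
    fun ρ D ⟨A, h1, ⟨B, h2, h3, h4, h5, h6, h7⟩, h8, h9, h10, h11⟩ => by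
    simp only [Function.update_self] at h2
    obtain rfl := Formula.bang.inj h2
    simp only [Term.fv, Finset.mem_union, Finset.mem_sdiff, Finset.mem_singleton,
      Finset.mem_insert] at h9 h11
    refine ⟨⟨A, h1, ⟨A, by grind, h3.congr fun c hc => ?_, h5, by grind, by grind,
      by grind⟩, ?_⟩, ?_⟩
    · simp only [Function.update_apply]; grind (splits := 20)
    · simp only [Term.fv, Finset.mem_union, Finset.mem_sdiff, Finset.mem_singleton,
        Finset.mem_insert]
      grind
    · ext
      simp only [Term.fv, Finset.mem_union, Finset.mem_sdiff, Finset.mem_singleton,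
        Finset.mem_insert]
      grind

theorem ctr_wk (hxz : x ≠ z) : .ctr z x z (.wk x u) ⇛ u :=
  of_step (.ctr_wk hxz)
    fun ρ D ⟨A, h1, ⟨B, h2, h3, h4⟩, h8, h9, h10, h11⟩ =>
    ⟨h3.congr (by grind), by ext; grind [Term.fv]⟩

theorem eta_with : .withR (.withL₀ z x (.ax x)) (.withL₁ z y (.ax y)) ⇛ (.ax z : Term α) :=
  of_step_symm .eta_with fun ρ D ⟨A, B, h1, ⟨C, D, h2, h3, h4⟩, ⟨E, F, h5, h6, h7⟩, h8⟩ => by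
    simp_all [Term.WT, Term.fv]

/-! ### Commutation of left rules -/

/-- Two left rules commute because both orders arise from one cut: here the left premise ends with
the contraction and the right premise with the weakening, and either rule can be moved out of the
cut first. -/
theorem ctr_wk_comm (hz : w ≠ z) (hx : w ≠ x) (hy : w ≠ y) :
    .ctr z x y (.wk w u) ⇛ .wk w (.ctr z x y u) := fun ρ D h => by
  obtain ⟨A, h1, ⟨B, h2, h3, h4⟩, h5, h6, h7, h8⟩ := h
  obtain ⟨c, hc⟩ := exists_fresh ({w, x, y, z} ∪ u.fv)
  have hp : (Term.cut D (.ctr z x y u) c (.wk w (.ax c))).WT ρ D := by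
    simp only [Term.fv] at *
    refine ⟨⟨A, h1, h3, ?_⟩, ⟨B, ?_, ?_, ?_⟩, ?_⟩ <;>
    (try simp only [Term.WT, Term.fv]) <;> grind [Term.fv]
  refine TEq.trans (TEq.symm (Fwd.trans (left_ctr ?_ ?_)
    (.ctr (.trans (right_wk ?_) (.wk cut_ax_right))) ρ D hp))
    (Fwd.trans (right_wk ?_) (.wk cut_ax_right) ρ D hp) <;> grind [Term.fv]

/-- Both orders arise from a cut against a derelicted axiom. -/
theorem ctr_der_comm (hz : z ≠ a) (hx : x ≠ w) (hy : y ≠ w) (hx : x ≠ a) (hy : y ≠ a) :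
    .ctr z x y (.der w a u) ⇛ .der w a (.ctr z x y u) := fun ρ D h => by
  obtain ⟨A, h1, ⟨B, h2, h3, h4, h4'⟩, h5, h6, h7, h8⟩ := h
  simp only [Term.fv, Finset.mem_union, Finset.mem_sdiff, Finset.mem_singleton] at h5 h6 h8
  have hp : (Term.cut B (.der w a (.ax a)) a (.ctr z x y u)).WT ρ D := by
    refine ⟨⟨B, by grind, by simp [Term.WT], by simp [Term.fv]⟩,
      ⟨A, by grind, h3.congr ?_, ?_⟩, ?_⟩ <;> (try simp only [Term.fv]) <;> grind
  refine TEq.trans (TEq.symm (Fwd.trans (right_ctr ?_ ?_ ?_ ?_ ?_) ?_ ρ D hp))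
    (Fwd.trans (left_der ?_) (.der cut_ax_self) ρ D hp)
  any_goals grind [Term.fv]
  exact .ctr (.trans (left_der (by grind)) (.der cut_ax_self))

/-- Both orders arise from a cut against an axiom below a left rule for `⊸`. -/
theorem ctr_lolliL_comm (hz : z ≠ a) (hxf : x ≠ f) (hyf : y ≠ f) (hxa : x ≠ a) (hya : y ≠ a)
    (hxs : x ∉ s.fv) (hys : y ∉ s.fv) :
    .ctr z x y (.lolliL f s a u) ⇛ .lolliL f s a (.ctr z x y u) := fun ρ D h => by
  obtain ⟨A, h1, ⟨B, C, h2, h3, h4, h4', h9, h10, h11⟩, h5, h6, h7, h8⟩ := h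
  simp only [Term.fv, Finset.mem_union, Finset.mem_sdiff, Finset.mem_singleton] at h5 h6 h8
  have hp : (Term.cut C (.lolliL f s a (.ax a)) a (.ctr z x y u)).WT ρ D := by
    refine ⟨⟨B, C, by grind, h3.congr ?_, by simp [Term.WT], by simp [Term.fv], ?_⟩,
      ⟨A, by grind, h4.congr ?_, ?_⟩, ?_⟩ <;> (try simp only [Term.fv]) <;> grind
  refine TEq.trans (TEq.symm (Fwd.trans (right_ctr ?_ ?_ ?_ ?_ ?_) ?_ ρ D hp))
    (Fwd.trans (left_lolliL ?_) (.lolliL_right cut_ax_self) ρ D hp)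
  any_goals grind [Term.fv]
  exact .ctr (.trans (left_lolliL (by grind)) (.lolliL_right cut_ax_self))

/-- Both orders arise from a cut in which the two contracted copies are passed on as a tensor
product. -/
theorem ctr_ctr_comm (hzw : z ≠ w) (hza : z ≠ a) (hzb : z ≠ b) (hxw : x ≠ w) (hxa : x ≠ a)
    (hxb : x ≠ b) (hyw : y ≠ w) (hya : y ≠ a) (hyb : y ≠ b) :
    .ctr z x y (.ctr w a b u) ⇛ .ctr w a b (.ctr z x y u) := fun ρ D h => by
  obtain ⟨A, h1, ⟨B, h2, h3, h4, h5, h6, h7⟩, h8, h9, h10, h11⟩ := h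
  obtain ⟨v, hv⟩ := exists_fresh ({w, a, b, x, y, z} ∪ u.fv)
  simp only [Term.fv, Finset.mem_union, Finset.mem_sdiff, Finset.mem_singleton,
    Finset.mem_insert] at h8 h9 h11 hv
  have hp : (Term.cut (!ₗA ⊗ₗ !ₗA) (.ctr z x y (.tensorR (.ax x) (.ax y))) v
      (.ctr w a b (.tensorL v x y u))).WT ρ D := by
    refine ⟨⟨A, by grind, ⟨_, _, rfl, by simp [Term.WT], by simp [Term.WT, h10.symm],
      by simp [Term.fv, h10]⟩, ?_⟩,
      ⟨B, by grind, ⟨!ₗA, !ₗA, by grind, h3.congr ?_, ?_⟩, ?_⟩, ?_⟩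
    · simp [Term.fv, h10]
    · simp only [Function.update_apply]; grind (splits := 20)
    · grind
    all_goals simp only [Term.fv, Finset.mem_union, Finset.mem_sdiff, Finset.mem_singleton,
      Finset.mem_insert]; grind
  have key : (Term.cut (!ₗA ⊗ₗ !ₗA) (.tensorR (.ax x) (.ax y)) v (.tensorL v x y u)) ⇛ u :=
    (cut_tensor h10 (by simp [Term.fv, h10])).trans (.trans (.cutR cut_ax_self) cut_ax_self)
  refine TEq.trans (TEq.symm (Fwd.trans (left_ctr ?_ ?_) (.ctr (.trans (right_ctr ?_ ?_ ?_ ?_ ?_)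
    (.ctr key))) ρ D hp)) (Fwd.trans (right_ctr ?_ ?_ ?_ ?_ ?_) (.ctr (.trans (left_ctr ?_ ?_)
    (.ctr key))) ρ D hp)
  all_goals
    try simp only [Term.fv, Finset.mem_union, Finset.mem_sdiff, Finset.mem_singleton,
      Finset.mem_insert]
    grind

theorem wk_wk_comm (hxy : x ≠ y) :
    .wk x (.wk y u) ⇛ .wk y (.wk x u) := fun ρ D h => by
  obtain ⟨A, h1, ⟨B, h2, h3, h4⟩, h5⟩ := h
  obtain ⟨c, hc⟩ := exists_fresh ({x, y} ∪ u.fv)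
  have hp : (Term.cut D (.wk x u) c (.wk y (.ax c))).WT ρ D := by
    refine ⟨⟨A, h1, h3, by grind [Term.fv]⟩, ⟨B, by grind, by simp [Term.WT], by grind [Term.fv]⟩,
      by grind [Term.fv], by grind [Term.fv]⟩
  refine TEq.trans (TEq.symm (Fwd.trans left_wk (.wk (.trans (right_wk ?_) (.wk cut_ax_right)))
    ρ D hp)) (Fwd.trans (right_wk ?_) (.wk cut_ax_right) ρ D hp) <;> grind

/-- A right rule for `&` commutes with a left rule in both of its premises: both sides arise from a
cut against an axiom below the left rule. -/
theorem withR_withL₀ :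
    .withR (.withL₀ z x t) (.withL₀ z x u) ⇛ .withL₀ z x (.withR t u) := fun ρ C h => by
  obtain ⟨A, B, rfl, ⟨X, Y, h1, wt, hx, hz⟩, ⟨X', Y', h2, wu, hx', hz'⟩, hfv⟩ := h
  obtain ⟨rfl, rfl⟩ := Formula.with.inj (h1.symm.trans h2)
  have hfv' : t.fv = u.fv := by
    ext y
    have := congrArg (y ∈ ·) hfv
    simp only [Term.fv, Finset.mem_union, Finset.mem_sdiff, Finset.mem_singleton, eq_iff_iff]
      at this
    grind
  have hp : (Term.cut X (.withL₀ z x (.ax x)) x (.withR t u)).WT ρ (A &ₗ B) := by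
    refine ⟨⟨X, Y, h1, by simp [Term.WT], by simp [Term.fv], by simp [Term.fv]⟩,
      ⟨A, B, rfl, wt, wu, hfv'⟩, by simp [Term.fv, hx], ?_⟩
    simp only [Term.fv]
    grind
  have e {v : Term α} : .cut X (.withL₀ z x (.ax x)) x v ⇛ .withL₀ z x v :=
    (Fwd.left_withL₀ (.inr rfl)).trans (.withL₀ Fwd.cut_ax_self)
  exact (Fwd.right_withR.trans (.withR e e) ρ _ hp).symm.trans (e ρ _ hp)

theorem ctr_ctr_assoc (h1 : z ≠ y) (h2 : z ≠ b) :
    .ctr z z y (.ctr z z b u) ⇛ .ctr z z b (.ctr z z y u) :=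
  .trans (.ctr ctr_comm) (.trans (ctr_assoc h1 h2.symm (by simp)) ctr_comm)

/-- Weakening is a unit for contraction when the weakened copy keeps the name `z` of the contracted
hypothesis; the other copy `y` is then renamed to `z`. The name `x'` is any fresh name. -/
theorem ctr_wk' {x' : ℕ} (hx : x' ∉ insert y (insert z u.fv)) (hz : z ∉ u.fv)
    (hu : u.swap z x' = u) : .ctr z z y (.wk z u) ⇛ u.swap y z := by
  refine (alpha_ctr (x' := x') (by grind [Term.fv])).trans ?_
  have h1 : (Term.wk z u).swap z x' = .wk x' u := by simp [Term.swap, Term.rename, hu]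
  rw [h1]
  refine ctr_comm.trans ((alpha_ctr (x' := z) (by grind [Term.fv])).trans ?_)
  have h2 : (Term.wk x' u).swap y z = .wk x' (u.swap y z) := by
    simp [Term.swap, Term.rename, Equiv.swap_apply_of_ne_of_ne (a := y) (b := z) (x := x')
      (by grind) (by grind)]
  rw [h2]
  exact ctr_comm.trans (ctr_wk (by grind))

end Fwd

/-! ### Concatenation of words -/

/-- The tree `bintBody` with arbitrary names: `f₀` and `f₁` are the copies of `!(A ⊸ A)` for the
digits zero and one, `x` is the argument and `k` is the auxiliary name in contractions. -/
def wordTerm (f₀ f₁ x k : ℕ) : List Bool → Term α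
  | [] => .wk f₀ (.wk f₁ (.ax x))
  | s :: S => .ctr (bif s then f₁ else f₀) (bif s then f₁ else f₀) k
      (.der k k (.lolliL k (.ax x) x (wordTerm f₀ f₁ x k S)))

theorem bintBody_eq (S : List Bool) : (bintBody S : Term α) = wordTerm 0 1 2 3 S := by
  induction S with
  | nil => rfl
  | cons s S ih => cases s <;> simp [bintBody, wordTerm, ih]

theorem wordTerm_rename (e : Equiv.Perm ℕ) (f₀ f₁ x k : ℕ) (S : List Bool) :
    (wordTerm f₀ f₁ x k S : Term α).rename e = wordTerm (e f₀) (e f₁) (e x) (e k) S := by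
  induction S with
  | nil => rfl
  | cons s S ih => cases s <;> simp [wordTerm, Term.rename, ih]

theorem wordTerm_fv {f₀ f₁ x k : ℕ} (h₀ : k ≠ f₀) (h₁ : k ≠ f₁) (hx : x ≠ f₀) (hk : k ≠ x)
    (S : List Bool) : (wordTerm f₀ f₁ x k S : Term α).fv = {f₀, f₁, x} := by
  induction S with
  | nil => ext; simp [wordTerm, Term.fv]; grind
  | cons s S ih =>
    ext c
    cases s <;> simp [wordTerm, Term.fv, ih] <;> grind

theorem wordTerm_WT {A : Formula α} {f₀ f₁ x k : ℕ} (h : f₀ ≠ f₁) (h₀ : k ≠ f₀) (h₁ : k ≠ f₁)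
    (hx : x ≠ f₀) (hx' : x ≠ f₁) (hk : k ≠ x) {ρ : ℕ → Formula α} (hf₀ : ρ f₀ = !ₗ(A ⊸ₗ A))
    (hf₁ : ρ f₁ = !ₗ(A ⊸ₗ A)) (hA : ρ x = A) (S : List Bool) :
    (wordTerm f₀ f₁ x k S).WT ρ A := by
  induction S with
  | nil => exact ⟨_, hf₀, ⟨_, hf₁, hA, by simp [Term.fv, hx'.symm]⟩, by
      simp [Term.fv, hx.symm, h]⟩
  | cons s S ih =>
    refine ⟨A ⊸ₗ A, by cases s <;> assumption, ⟨A ⊸ₗ A, by grind, ⟨A, A, by grind,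
      by simp only [Term.WT]; grind, ih.congr ?_, ?_⟩, ?_⟩, ?_⟩ <;>
    simp only [Term.fv, wordTerm_fv h₀ h₁ hx hk] <;> cases s <;> grind

/-- Composing the body of a word with that of a second word, with contracted endomorphisms, gives
the body of the concatenation. By induction on the first word: the two contractions move past the
first letter, and for the empty word the weakenings cancel them. -/
theorem word_append (A : Formula α) (S S' : List Bool) :
    .ctr 0 0 14 (.ctr 1 1 15 (.cut A (bintBody S) 16 (wordTerm 14 15 16 3 S'))) ⇛
      bintBody (S ++ S') := by
  induction S with
  | nil =>
    have h1 : .cut A (bintBody []) 16 (wordTerm 14 15 16 3 S') ⇛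
        .wk 0 (.wk 1 (wordTerm 14 15 2 3 S')) := by
      refine Fwd.left_wk.trans (.wk (Fwd.left_wk.trans (.wk ((Fwd.cut_ax_left ?_).trans
        (.of_eq ?_)))))
      · simp [wordTerm_fv]
      · simp [Term.swap, wordTerm_rename, Equiv.swap_apply_def]
    refine (Fwd.ctr (Fwd.ctr h1)).trans ?_
    refine (Fwd.ctr (Fwd.ctr_wk_comm (by simp) (by simp) (by simp))).trans ?_
    refine (Fwd.ctr_wk' (x' := 100) ?_ ?_ ?_).trans ?_
    · simp [Term.fv, wordTerm_fv]
    · simp [Term.fv, wordTerm_fv]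
    · simp [Term.swap, Term.rename, wordTerm_rename, Equiv.swap_apply_def]
    · simp only [Term.swap, Term.rename, wordTerm_rename, Equiv.swap_apply_def]
      simp only [OfNat.one_ne_ofNat, ↓reduceIte, one_ne_zero, Nat.reduceEqDiff,
        OfNat.ofNat_ne_zero]
      refine (Fwd.ctr_wk' (x' := 100) ?_ ?_ ?_).trans (.of_eq ?_)
      · simp [wordTerm_fv]
      · simp [wordTerm_fv]
      · simp [Term.swap, wordTerm_rename, Equiv.swap_apply_def]
      · simp only [List.nil_append, bintBody_eq]
        simp [Term.swap, wordTerm_rename, Equiv.swap_apply_def]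
  | cons s S ih =>
    have h1 : .cut A (bintBody (s :: S)) 16 (wordTerm 14 15 16 3 S') ⇛
        .ctr s.toNat s.toNat 3 (.der 3 3 (.lolliL 3 (.ax 2) 2
          (.cut A (bintBody S) 16 (wordTerm 14 15 16 3 S')))) := by
      refine (Fwd.left_ctr ?_ ?_).trans (.ctr ((Fwd.left_der ?_).trans
        (.der (Fwd.left_lolliL ?_)))) <;> cases s <;> simp [wordTerm_fv]
    refine (Fwd.ctr (Fwd.ctr h1)).trans (.trans (u := .ctr s.toNat s.toNat 3 (.ctr 0 0 14
      (.ctr 1 1 15 (.der 3 3 (.lolliL 3 (.ax 2) 2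
          (.cut A (bintBody S) 16 (wordTerm 14 15 16 3 S'))))))) ?_ ?_)
    · cases s with
      | false =>
        refine (Fwd.ctr (Fwd.ctr_ctr_comm ?_ ?_ ?_ ?_ ?_ ?_ ?_ ?_ ?_)).trans
          (Fwd.ctr_ctr_assoc ?_ ?_) <;> simp
      | true =>
        refine (Fwd.ctr (Fwd.ctr_ctr_assoc ?_ ?_)).trans
          (Fwd.ctr_ctr_comm ?_ ?_ ?_ ?_ ?_ ?_ ?_ ?_ ?_) <;> simp
    · refine .ctr (.trans (.ctr ((Fwd.ctr_der_comm ?_ ?_ ?_ ?_ ?_).trans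
        (.der (Fwd.ctr_lolliL_comm ?_ ?_ ?_ ?_ ?_ ?_ ?_))))
        ((Fwd.ctr_der_comm ?_ ?_ ?_ ?_ ?_).trans
        (.der ((Fwd.ctr_lolliL_comm ?_ ?_ ?_ ?_ ?_ ?_ ?_).trans (.lolliL_right ih))))) <;>
      simp [Term.fv]

/-! ### Iteration along a word -/

/-- The auxiliary name `k` in a word is bound. -/
theorem wordTerm_bound {f₀ f₁ x k k' : ℕ} (h₀ : k ≠ f₀) (h₁ : k ≠ f₁) (hx : x ≠ f₀) (hk : k ≠ x)
    (h₀' : k' ≠ f₀) (h₁' : k' ≠ f₁) (hk' : k' ≠ x) (S : List Bool) :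
    (wordTerm f₀ f₁ x k S : Term α) ⇛ wordTerm f₀ f₁ x k' S := by
  have hs (y) (h : k ≠ y) (h' : k' ≠ y) : Equiv.swap k k' y = y :=
    Equiv.swap_apply_of_ne_of_ne h.symm h'.symm
  by_cases hkk : k = k'
  · subst hkk; exact .refl _
  cases S with
  | nil => exact .refl _
  | cons s S =>
    refine Fwd.ctr_comm.trans ((Fwd.alpha_ctr (x' := k') ?_).trans (.trans (.of_eq ?_)
      Fwd.ctr_comm))
    · simp [Term.fv, wordTerm_fv h₀ h₁ hx hk]
      grind
    · simp [Term.swap, Term.rename, wordTerm_rename, *]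

section Loops

variable {A B C : Formula α} {t a b c : Term α} {x z : ℕ}

/-- A word with fresh names, which do not interfere with those of the word that is to be produced.
-/
theorem bintProof_alpha (S : List Bool) : (bintProof B S).term ⇛
    .lolliR 10 (.lolliR 11 (.lolliR 12 (wordTerm 10 11 12 13 S))) := by
  have h : (bintProof B S).term = .lolliR 0 (.lolliR 1 (.lolliR 2 (wordTerm 0 1 2 3 S))) := by
    simp [bintProof, bintBody_eq]
  rw [h]
  refine (Fwd.alpha_lolliR (x' := 10) ?_).trans ?_
  · simp [Term.fv, wordTerm_fv]
  refine .lolliR (.trans (.of_eq (u := .lolliR 1 (.lolliR 2 (wordTerm 10 1 2 3 S))) ?_) ?_)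
  · simp [Term.rename, wordTerm_rename, Equiv.swap_apply_def]
  refine (Fwd.alpha_lolliR (x' := 11) ?_).trans (.lolliR ?_)
  · simp [Term.fv, wordTerm_fv]
  refine .trans (.of_eq (u := .lolliR 2 (wordTerm 10 11 2 3 S)) ?_) ?_
  · simp [Term.rename, wordTerm_rename, Equiv.swap_apply_def]
  refine (Fwd.alpha_lolliR (x' := 12) ?_).trans (.lolliR ?_)
  · simp [wordTerm_fv]
  refine .trans (.of_eq (u := wordTerm 10 11 12 3 S) ?_) (wordTerm_bound ?_ ?_ ?_ ?_ ?_ ?_ ?_ S)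
  · simp [wordTerm_rename, Equiv.swap_apply_def]
  all_goals simp

/-- The iteration along a word `z : !(bint B)`: its digits zero and one are interpreted by the
proofs `G₀` and `G₁` of `!(B ⊸ B)`, the result of applying them to `init` is called `4` and is used
in `K`. -/
def iterTerm (z : ℕ) (G₀ G₁ init K : Term α) : Term α :=
  .der z 5 (.lolliL 5 G₀ 6 (.lolliL 6 G₁ 7 (.lolliL 7 init 4 K)))

/-- The iteration along the word `S` as a tree with hypothesis `12 : B`, the value that the
iteration starts with. -/
def loopTerm (B : Formula α) (G₀ G₁ K : Term α) (S : List Bool) : Term α :=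
  .cut (!ₗ(B ⊸ₗ B)) G₁ 11 (.cut (!ₗ(B ⊸ₗ B)) G₀ 10 (.cut B (wordTerm 10 11 12 13 S) 4 K))

theorem cut_iterTerm {G₀ G₁ init K : Term α} (S : List Bool) (h1 : 11 ∉ G₀.fv) (h2 : 12 ∉ G₀.fv)
    (h3 : 12 ∉ G₁.fv) (h4 : 10 ∉ K.fv) (h5 : 11 ∉ K.fv) (h6 : 12 ∉ K.fv) :
    .cut (!ₗ(bint B)) (.prom (bintProof B S).term) z (iterTerm z G₀ G₁ init K) ⇛
      .cut B init 12 (loopTerm B G₀ G₁ K S) := by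
  refine Fwd.cut_der.trans ?_
  refine (Fwd.cutL (bintProof_alpha S)).trans ?_
  refine Fwd.cut_lolli.trans ?_
  refine (Fwd.cutL ((Fwd.right_lolliR (by simp) h1).trans
    (.lolliR (Fwd.right_lolliR (by simp) h2)))).trans ?_
  refine Fwd.cut_lolli.trans ?_
  refine (Fwd.cutL (Fwd.right_lolliR (by simp) h3)).trans ?_
  refine Fwd.cut_lolli.trans ?_
  refine (Fwd.cut_assoc (.inl h6)).trans (.cutR ?_)
  exact (Fwd.cut_assoc (.inl h5)).trans (.cutR (Fwd.cut_assoc (.inl h4)))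

/-- One letter of an iteration, for a letter that is interpreted by the promotion of `4 ⊢ h`, the
other letter being interpreted by `G'`. The promotion is duplicated: `D` stands for the contractions
of its hypotheses and `h'` for `h` with these hypotheses renamed. -/
theorem loop_step {G' h h' K w : Term α} {f f' : ℕ} {D : Term α → Term α}
    (hD : ∀ s s', s ⇛ s' → D s ⇛ D s')
    (hdup : .cut (!ₗ(B ⊸ₗ B)) (.prom (.lolliR 4 h)) f (.ctr f f 13
        (.cut (!ₗ(B ⊸ₗ B)) G' f' (.der 13 13 (.lolliL 13 (.ax 12) 12 (.cut B w 4 K))))) ⇛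
      D (.cut (!ₗ(B ⊸ₗ B)) (.prom (.lolliR 4 h)) f (.cut (!ₗ(B ⊸ₗ B)) (.prom (.lolliR 4 h')) 13
        (.cut (!ₗ(B ⊸ₗ B)) G' f' (.der 13 13 (.lolliL 13 (.ax 12) 12 (.cut B w 4 K)))))))
    (hff : f ≠ f') (h13 : f' ≠ 13) (h12 : f ≠ 12) (h12' : f' ≠ 12)
    (hK : ∀ y ∈ K.fv, y = 4) (hf : f ≠ 4)
    (hh : ∀ y ∈ h'.fv, y ≠ f ∧ y ≠ f') (h3 : f ∉ G'.fv) (h4 : 13 ∉ G'.fv) (h5 : 12 ∉ G'.fv)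
    (h6 : f' ∉ h'.fv) (h7 : 12 ∉ h.fv) :
    .cut (!ₗ(B ⊸ₗ B)) (.prom (.lolliR 4 h)) f (.cut (!ₗ(B ⊸ₗ B)) G' f'
      (.cut B (.ctr f f 13 (.der 13 13 (.lolliL 13 (.ax 12) 12 w))) 4 K)) ⇛
    D (.cut B (.cut B (.ax 12) 4 h') 12
      (.cut (!ₗ(B ⊸ₗ B)) (.prom (.lolliR 4 h)) f (.cut (!ₗ(B ⊸ₗ B)) G' f' (.cut B w 4 K)))) := by
  have e1 : .cut B (.ctr f f 13 (.der 13 13 (.lolliL 13 (.ax 12) 12 w))) 4 K ⇛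
      .ctr f f 13 (.der 13 13 (.lolliL 13 (.ax 12) 12 (.cut B w 4 K))) := by
    refine (Fwd.left_ctr ?_ ?_).trans (.ctr ((Fwd.left_der ?_).trans
      (.der (Fwd.left_lolliL ?_)))) <;> grind
  refine (Fwd.cutR ((Fwd.cutR e1).trans (Fwd.right_ctr hff.symm hff h13.symm h3 h4))).trans ?_
  refine hdup.trans (hD _ _ ?_)
  refine (Fwd.cutR ((Fwd.cut_comm h13.symm h4 ?_).trans (Fwd.cutR
    (Fwd.cut_der.trans Fwd.cut_lolli)))).trans ?_
  · simp [Term.fv]; grind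
  refine (Fwd.cutR (Fwd.cut_comm h12' ?_ h5)).trans (Fwd.cut_comm h12 ?_ ?_) <;>
  · simp [Term.fv]; grind

/-! ### Retracts and triples -/

/-- The formula `X` is a retract of `Y`: proofs `pk` of `X ⊢ Y` and `un` of `Y ⊢ X` whose composite
on `X` is equivalent to the axiom. Both trees use no name other than `4`. -/
structure Retract (X Y : Formula α) where
  pk : Term α
  un : Term α
  pk_fv : pk.fv = {4}
  un_fv : un.fv = {4}
  pk_rename : ∀ e : Equiv.Perm ℕ, e 4 = 4 → pk.rename e = pk
  un_rename : ∀ e : Equiv.Perm ℕ, e 4 = 4 → un.rename e = un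
  pk_WT : ∀ ρ : ℕ → Formula α, ρ 4 = X → pk.WT ρ Y
  un_WT : ∀ ρ : ℕ → Formula α, ρ 4 = Y → un.WT ρ X
  un_pk : .cut Y pk 4 un ⇛ .ax 4

namespace Retract

variable (r : Retract (A.pow 3) B)

/-- The triple with components `a`, `b` and `c`, packed as a proof of `B`. -/
def tuple (a b c : Term α) : Term α := .cut (A.pow 3) (.withR a (.withR b c)) 4 r.pk

/-- The component `i < 3` of a packed triple `4 : B`. -/
def comp (i : ℕ) : Term α := .cut (A.pow 3) r.un 4 (projTerm 4 3 i)

theorem cancel {X Y : Formula α} (r : Retract X Y) {t v : Term α} :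
    .cut Y (.cut X t 4 r.pk) 4 (.cut X r.un 4 v) ⇛ .cut X t 4 v :=
  (Fwd.cut_assoc (.inr rfl)).trans (.cutR ((Fwd.cut_assoc_symm (.inr rfl)).trans
    ((Fwd.cutL r.un_pk).trans Fwd.cut_ax_self)))

theorem tuple_comp₀ : .cut B (r.tuple a b c) 4 (r.comp 0) ⇛ a :=
  r.cancel.trans (Fwd.cut_with₀.trans Fwd.cut_ax_right)

theorem tuple_comp₁ : .cut B (r.tuple a b c) 4 (r.comp 1) ⇛ b :=
  r.cancel.trans (Fwd.cut_with₁.trans (Fwd.cut_with₀.trans Fwd.cut_ax_right))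

theorem tuple_comp₂ : .cut B (r.tuple a b c) 4 (r.comp 2) ⇛ c :=
  r.cancel.trans (Fwd.cut_with₁.trans (Fwd.cut_with₁.trans Fwd.cut_ax_right))

theorem tuple_congr {a' b' c' : Term α} (ha : a ⇛ a') (hb : b ⇛ b') (hc : c ⇛ c') :
    r.tuple a b c ⇛ r.tuple a' b' c' :=
  .cutL (.withR ha (.withR hb hc))

theorem cut_tuple : .cut C t x (r.tuple a b c) ⇛
    r.tuple (.cut C t x a) (.cut C t x b) (.cut C t x c) :=
  (Fwd.cut_assoc_symm (by rw [r.pk_fv]; grind)).trans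
    (.cutL (Fwd.right_withR.trans (.withR_right Fwd.right_withR)))

theorem comp_fv (i : ℕ) (hi : i < 3) : (r.comp i).fv = {4} := by
  ext; interval_cases i <;> simp [comp, Term.fv, projTerm, r.un_fv]

theorem tuple_fv : (r.tuple a b c).fv = a.fv ∪ (b.fv ∪ c.fv) := by
  simp [tuple, Term.fv, r.pk_fv]

theorem comp_rename (e : Equiv.Perm ℕ) (he : e 4 = 4) (i : ℕ) (hi : i < 3) :
    (r.comp i).rename e = r.comp i := by
  interval_cases i <;> simp [comp, Term.rename, projTerm, r.un_rename, he]

theorem tuple_rename (e : Equiv.Perm ℕ) (he : e 4 = 4) :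
    (r.tuple a b c).rename e = r.tuple (a.rename e) (b.rename e) (c.rename e) := by
  simp [tuple, Term.rename, r.pk_rename, he]

theorem comp_WT {ρ : ℕ → Formula α} (h : ρ 4 = B) (i : ℕ) (hi : i < 3) : (r.comp i).WT ρ A := by
  refine ⟨r.un_WT ρ h, ?_⟩
  interval_cases i
  · exact ⟨⟨A, A &ₗ A, by simp [Formula.pow], by simp [Term.WT], by simp [Term.fv]⟩,
      by simp [Term.fv, projTerm], by simp [r.un_fv, Term.fv, projTerm]⟩
  · exact ⟨⟨A, A &ₗ A, by simp [Formula.pow], ⟨A, A, by simp, by simp [Term.WT],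
      by simp [Term.fv]⟩, by simp [Term.fv, projTerm]⟩,
      by simp [Term.fv, projTerm], by simp [r.un_fv, Term.fv, projTerm]⟩
  · exact ⟨⟨A, A &ₗ A, by simp [Formula.pow], ⟨A, A, by simp, by simp [Term.WT, projTerm],
      by simp [Term.fv, projTerm]⟩, by simp [Term.fv, projTerm]⟩,
      by simp [Term.fv, projTerm], by simp [r.un_fv, Term.fv, projTerm]⟩

theorem tuple_WT {ρ : ℕ → Formula α} (ha : a.WT ρ A) (hb : b.WT ρ A) (hc : c.WT ρ A)
    (hab : a.fv = b.fv) (hbc : b.fv = c.fv) : (r.tuple a b c).WT ρ B :=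
  ⟨⟨A, A &ₗ A, rfl, ha, ⟨A, A, rfl, hb, hc, hbc⟩, by simp [Term.fv, hab, hbc]⟩,
    r.pk_WT _ (by simp), by simp [r.pk_fv], by simp [r.pk_fv]⟩

/-! ### The last letter of a word -/

/-- The action of the digit `s` on triples that records `s` in the third component: `(a, b, _)` is
sent to `(a, b, a)` or `(a, b, b)`. -/
def lastBody (s : Bool) : Term α :=
  r.tuple (r.comp 0) (r.comp 1) (bif s then r.comp 1 else r.comp 0)

/-- The action `lastBody` as a proof of `!(B ⊸ B)`. -/
def lastFun (s : Bool) : Term α := .prom (.lolliR 4 (r.lastBody s))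

theorem lastBody_fv (s : Bool) : (r.lastBody s).fv = {4} := by
  cases s <;> simp [lastBody, tuple_fv, comp_fv]

theorem lastFun_fv (s : Bool) : (r.lastFun s).fv = ∅ := by
  simp [lastFun, Term.fv, lastBody_fv]

/-- Renaming the hypothesis `4` to `12` is undone by a cut at `12`. -/
theorem cut_substComp {v : Term α} (hv : ∀ y ∈ v.fv, y = 4) :
    .cut B t 12 (.cut B (.ax 12) 4 v) ⇛ .cut B t 4 v :=
  (Fwd.cut_assoc_symm (.inl fun h => by simpa using hv _ h)).trans (.cutL Fwd.cut_ax_right)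

theorem loop_last_step (s : Bool) (S : List Bool) :
    loopTerm B (r.lastFun false) (r.lastFun true) (r.comp 2) (s :: S) ⇛
      .cut B (.cut B (.ax 12) 4 (r.lastBody s)) 12
        (loopTerm B (r.lastFun false) (r.lastFun true) (r.comp 2) S) := by
  cases s with
  | false =>
    refine (Fwd.cut_comm (by simp) (by simp [lastFun_fv]) (by simp [lastFun_fv])).trans ?_
    refine (loop_step (D := id) (h' := r.lastBody false) (fun _ _ h => h)
      (Fwd.cut_ctr_closed (r.lastFun_fv false) (by simp)) (by simp) (by simp) (by simp) (by simp)
      (by simp [comp_fv]) (by simp) ?_ ?_ ?_ ?_ ?_ ?_).trans (.cutR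
      (Fwd.cut_comm (by simp) (by simp [lastFun_fv]) (by simp [Term.fv, lastBody_fv])))
    all_goals simp [lastFun_fv, lastBody_fv]
  | true =>
    refine loop_step (D := id) (h' := r.lastBody true) (fun _ _ h => h)
      (Fwd.cut_ctr_closed (r.lastFun_fv true) (by simp)) (by simp) (by simp) (by simp) (by simp)
      (by simp [comp_fv]) (by simp) ?_ ?_ ?_ ?_ ?_ ?_
    all_goals simp [lastFun_fv, lastBody_fv]

/-- The invariant of the iteration: the third component of the initial triple acts as the letter `d`
before the word. -/
theorem loop_last (S : List Bool) (d : Bool) :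
    .cut B (r.tuple a b (bif d then b else a)) 12
      (loopTerm B (r.lastFun false) (r.lastFun true) (r.comp 2) S) ⇛
      bif S.getLastD d then b else a := by
  induction S generalizing d with
  | nil =>
    have h1 : loopTerm B (r.lastFun false) (r.lastFun true) (r.comp 2) [] ⇛
        .cut B (.ax 12) 4 (r.comp 2) := by
      refine (Fwd.cutR ((Fwd.cutR (Fwd.left_wk.trans (.wk Fwd.left_wk))).trans
        (Fwd.cut_wk_closed (t := .lolliR 4 _) (r.lastFun_fv false)))).trans
        (Fwd.cut_wk_closed (t := .lolliR 4 _) (r.lastFun_fv true))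
    refine (Fwd.cutR h1).trans ((cut_substComp (by simp [comp_fv])).trans ?_)
    exact r.tuple_comp₂
  | cons s S ih =>
    rw [List.getLastD_cons]
    refine .trans ?_ (ih s)
    refine (Fwd.cutR (r.loop_last_step s S)).trans
      ((Fwd.cut_assoc_symm (.inr rfl)).trans (.cutL ?_))
    refine (cut_substComp (by simp [lastBody_fv])).trans (r.cut_tuple.trans
      (r.tuple_congr r.tuple_comp₀ r.tuple_comp₁ ?_))
    cases s
    · exact r.tuple_comp₀
    · exact r.tuple_comp₁

/-- The choice between `a` and `b` by the last letter of the word `z`; it is `a` if the word is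
empty. -/
def caseLast (z : ℕ) (a b : Term α) : Term α :=
  iterTerm z (r.lastFun false) (r.lastFun true) (r.tuple a b a) (r.comp 2)

theorem cut_caseLast (S : List Bool) :
    .cut (!ₗ(bint B)) (.prom (bintProof B S).term) z (r.caseLast z a b) ⇛
      bif S.getLastD false then b else a := by
  refine (cut_iterTerm S ?_ ?_ ?_ ?_ ?_ ?_).trans (r.loop_last S false) <;>
  simp [lastFun_fv, comp_fv]

end Retract
end Loops

namespace Retract

variable {A B C : Formula α} {t a b c : Term α} {x z : ℕ} (r : Retract (A.pow 3) B)

/-! ### Deletion of the last letter -/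

/-- The action on triples of the endomorphism `f : A ⊸ A`, which sends `(u, v, _)` to `(f u, u, u)`.
-/
def tailBody (f : ℕ) : Term α :=
  r.tuple (.der f f (.lolliL f (r.comp 0) 2 (.ax 2))) (.wk f (r.comp 0)) (.wk f (r.comp 0))

/-- The action `tailBody` as a proof of `!(B ⊸ B)`, with `f : !(A ⊸ A)`. -/
def tailFun (f : ℕ) : Term α := .prom (.lolliR 4 (r.tailBody f))

theorem tailBody_fv {f : ℕ} : (r.tailBody f).fv = {f, 4} := by
  ext; simp [tailBody, tuple_fv, Term.fv, comp_fv]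

theorem tailFun_fv {f : ℕ} (h : f ≠ 4) : (r.tailFun f).fv = {f} := by
  ext; simp [tailFun, Term.fv, tailBody_fv]; try grind

theorem tailBody_swap {f g : ℕ} (hf : f ≠ 4) (hg : g ≠ 4) (hf' : f ≠ 2) (hg' : g ≠ 2) :
    (r.tailBody f).swap f g = r.tailBody g := by
  have h4 : Equiv.swap f g 4 = 4 := Equiv.swap_apply_of_ne_of_ne hf.symm hg.symm
  have h2 : Equiv.swap f g 2 = 2 := Equiv.swap_apply_of_ne_of_ne hf'.symm hg'.symm
  simp [tailBody, Term.swap, tuple_rename, comp_rename, Term.rename, h4, h2]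

/-- The second component after iterating `tailFun` along `S`, where `0` and `1` interpret the
digits. -/
def tailLoop (S : List Bool) : Term α :=
  loopTerm B (r.tailFun 0) (r.tailFun 1) (r.comp 1) S

theorem tailLoop_nil : r.tailLoop [] ⇛ .wk 0 (.wk 1 (.cut B (.ax 12) 4 (r.comp 1))) := by
  refine (Fwd.cutR ((Fwd.cutR (Fwd.left_wk.trans (.wk Fwd.left_wk))).trans
    (Fwd.cut_wk_single (t := .lolliR 4 _) (r.tailFun_fv (by simp))))).trans
    ((Fwd.right_wk (by simp)).trans (.wk
    (Fwd.cut_wk_single (t := .lolliR 4 _) (r.tailFun_fv (by simp)))))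

theorem tailLoop_cons (s : Bool) (S : List Bool) :
    r.tailLoop (s :: S) ⇛ .ctr s.toNat s.toNat 3
      (.cut B (.cut B (.ax 12) 4 (r.tailBody 3)) 12 (r.tailLoop S)) := by
  have hrn (f : ℕ) (hf : f = 0 ∨ f = 1) : (Term.lolliR 4 (r.tailBody f)).swap f 3 =
      .lolliR 4 (r.tailBody 3) := by
    have := r.tailBody_swap (f := f) (g := 3) (by grind) (by simp) (by grind) (by simp)
    rw [Term.swap] at *
    rw [Term.rename, this, Equiv.swap_apply_of_ne_of_ne (by grind) (by simp)]
  cases s with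
  | false =>
    refine (Fwd.cut_comm (by simp) (by simp [tailFun_fv]) (by simp [tailFun_fv])).trans ?_
    refine (loop_step (D := .ctr 0 0 3) (h' := r.tailBody 3) (fun _ _ h => h.ctr)
      ((Fwd.cut_ctr_single (t := .lolliR 4 (r.tailBody 0)) (w := 0) (w' := 3)
        (r.tailFun_fv (by simp)) ?_ ?_ ?_ ?_ ?_).trans
        (.of_eq (by rw [hrn 0 (by simp)]))) ?_ ?_ ?_ ?_ ?_ ?_ ?_ ?_ ?_ ?_ ?_ ?_).trans (.ctr (.cutR
      (Fwd.cut_comm ?_ ?_ ?_)))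
    all_goals simp [tailFun_fv, tailBody_fv, comp_fv, Term.fv, wordTerm_fv]
  | true =>
    refine (loop_step (D := .ctr 1 1 3) (h' := r.tailBody 3) (fun _ _ h => h.ctr)
      ((Fwd.cut_ctr_single (t := .lolliR 4 (r.tailBody 1)) (w := 1) (w' := 3)
        (r.tailFun_fv (by simp)) ?_ ?_ ?_ ?_ ?_).trans
        (.of_eq (by rw [hrn 1 (by simp)]))) ?_ ?_ ?_ ?_ ?_ ?_ ?_ ?_ ?_ ?_ ?_ ?_)
    all_goals simp [tailFun_fv, tailBody_fv, comp_fv, Term.fv, wordTerm_fv]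

/-- The value of `tailLoop` on the initial triple `12 : B`: its second component if the word is
empty, and otherwise all letters but the last applied to its first component. -/
def tailValue (r : Retract (A.pow 3) B) : List Bool → Term α
  | [] => .wk 0 (.wk 1 (.cut B (.ax 12) 4 (r.comp 1)))
  | s :: S => .cut A (.cut B (.ax 12) 4 (r.comp 0)) 2 (wordTerm 0 1 2 3 (s :: S).dropLast)

theorem step_comp₀ : .cut B (.cut B (.ax 12) 4 (r.tailBody 3)) 12 (.cut B (.ax 12) 4 (r.comp 0)) ⇛
    .der 3 3 (.lolliL 3 (.cut B (.ax 12) 4 (r.comp 0)) 2 (.ax 2)) := by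
  refine (cut_substComp (by simp [comp_fv])).trans ((Fwd.cut_assoc (.inr rfl)).trans
    ((Fwd.cutR r.tuple_comp₀).trans ((Fwd.right_der ?_ ?_ ?_).trans
    (.der (Fwd.right_lolliL₀ ?_ ?_ ?_))))) <;> simp [comp_fv, Term.fv]

theorem step_comp₁ : .cut B (.cut B (.ax 12) 4 (r.tailBody 3)) 12 (.cut B (.ax 12) 4 (r.comp 1)) ⇛
    .wk 3 (.cut B (.ax 12) 4 (r.comp 0)) :=
  (cut_substComp (by simp [comp_fv])).trans ((Fwd.cut_assoc (.inr rfl)).trans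
    ((Fwd.cutR r.tuple_comp₁).trans (Fwd.right_wk (by simp))))

theorem tailValue_WT {ρ : ℕ → Formula α} (h0 : ρ 0 = !ₗ(A ⊸ₗ A)) (h1 : ρ 1 = !ₗ(A ⊸ₗ A))
    (h12 : ρ 12 = B) (S : List Bool) : (r.tailValue S).WT ρ A := by
  have hQ (i : ℕ) (hi : i < 3) : (Term.cut B (.ax 12) 4 (r.comp i)).WT ρ A :=
    ⟨h12, r.comp_WT (by simp) i hi, by simp [comp_fv, hi], by simp [comp_fv, hi]⟩
  cases S with
  | nil => exact ⟨_, h0, ⟨_, h1, hQ 1 (by simp), by simp [Term.fv, comp_fv]⟩,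
      by simp [Term.fv, comp_fv]⟩
  | cons s S =>
    refine ⟨hQ 0 (by simp), wordTerm_WT ?_ ?_ ?_ ?_ ?_ ?_ ?_ ?_ ?_ _, ?_, ?_⟩ <;>
    simp [h0, h1, Term.fv, comp_fv, wordTerm_fv]

theorem tailStep_nil (s : Bool) : .ctr s.toNat s.toNat 3
    (.cut B (.cut B (.ax 12) 4 (r.tailBody 3)) 12 (r.tailValue [])) ⇛
      .wk 0 (.wk 1 (.cut B (.ax 12) 4 (r.comp 0))) := by
  have e1 : .cut B (.cut B (.ax 12) 4 (r.tailBody 3)) 12 (r.tailValue []) ⇛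
      .wk 0 (.wk 1 (.wk 3 (.cut B (.ax 12) 4 (r.comp 0)))) :=
    (Fwd.right_wk (by simp)).trans (.wk ((Fwd.right_wk (by simp)).trans (.wk r.step_comp₁)))
  refine (Fwd.ctr e1).trans ?_
  have hQ (e : Equiv.Perm ℕ) (h4 : e 4 = 4) (h12 : e 12 = 12) :
      (Term.cut B (.ax 12) 4 (r.comp 0)).rename e = Term.cut B (.ax 12) 4 (r.comp 0) := by
    simp [Term.rename, h4, h12, comp_rename]
  cases s with
  | false =>
    refine (Fwd.ctr_wk' (x' := 100) ?_ ?_ ?_).trans ?_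
    · simp [Term.fv, comp_fv]
    · simp [Term.fv, comp_fv]
    · simp [Term.swap, Term.rename, comp_rename, Equiv.swap_apply_def]
    · refine .trans (.of_eq ?_) (Fwd.wk_wk_comm (x := 1) (y := 0) (by simp))
      simp [Term.swap, Term.rename, comp_rename, Equiv.swap_apply_def]
  | true =>
    refine (Fwd.ctr_wk_comm ?_ ?_ ?_).trans (.wk ((Fwd.ctr_wk' (x' := 100) ?_ ?_ ?_).trans
      (.of_eq ?_))) <;>
    simp [Term.fv, comp_fv, Term.swap, Term.rename, comp_rename, Equiv.swap_apply_def]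

/-- The first letter acts on the initial triple; the value of the remaining iteration is known by
induction. In `tailValue` the word is cut against its argument; moving this cut to the argument of
the first letter gives the tree that results from the iteration. That expansion is used backwards,
so the lemma is stated for a given typing. -/
theorem tailLoop_eq {ρ : ℕ → Formula α} (h0 : ρ 0 = !ₗ(A ⊸ₗ A)) (h1 : ρ 1 = !ₗ(A ⊸ₗ A))
    (h12 : ρ 12 = B) (S : List Bool) (hw : (r.tailLoop S).WT ρ A) :
    TEq ρ A (r.tailLoop S) (r.tailValue S) := by
  induction S generalizing ρ with
  | nil => exact r.tailLoop_nil ρ A hw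
  | cons s S ih =>
    have e1 := r.tailLoop_cons s S ρ A hw
    have hs : ρ s.toNat = !ₗ(A ⊸ₗ A) := by cases s <;> assumption
    have e1w := e1.right
    obtain ⟨X, hX, hcut, hrest⟩ := e1.right
    obtain rfl : A ⊸ₗ A = X := by simpa [hs] using hX
    have hρ : ∀ ρ' : ℕ → Formula α, ρ' = update (update ρ 3 (!ₗ(A ⊸ₗ A))) s.toNat (!ₗ(A ⊸ₗ A)) →
        ρ' 0 = !ₗ(A ⊸ₗ A) ∧ ρ' 1 = !ₗ(A ⊸ₗ A) := by
      rintro _ rfl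
      cases s <;> simp [h0, h1]
    have ih' := ih (ρ := update _ 12 B) (by simp [hρ _ rfl]) (by simp [hρ _ rfl]) (by simp) hcut.2.1
    have e2 := e1.trans (TEq.ctr (ih'.cutR hcut) hs e1w)
    have hv := r.tailValue_WT h0 h1 h12 (s :: S)
    cases S with
    | nil =>
      exact (e2.fwd (r.tailStep_nil s)).trans (TEq.symm ((Fwd.trans (Fwd.right_wk (by simp))
        (.wk ((Fwd.right_wk (by simp)).trans (.wk Fwd.cut_ax_right)))) _ _ hv))
    | cons s' S =>
      have e3 : .cut B (.cut B (.ax 12) 4 (r.tailBody 3)) 12 (r.tailValue (s' :: S)) ⇛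
          .der 3 3 (.lolliL 3 (.cut B (.ax 12) 4 (r.comp 0)) 2
            (wordTerm 0 1 2 3 (s' :: S).dropLast)) := by
        refine (Fwd.cut_assoc_symm (.inl ?_)).trans ((Fwd.cutL r.step_comp₀).trans
          ((Fwd.left_der (.inl ?_)).trans (.der ((Fwd.left_lolliL (.inr rfl)).trans
          (.lolliL_right Fwd.cut_ax_self))))) <;> simp [wordTerm_fv]
      refine (e2.fwd (.ctr e3)).trans (TEq.symm (Fwd.trans (Fwd.right_ctr ?_ ?_ ?_ ?_ ?_)
        (.trans (.ctr ((Fwd.right_der ?_ ?_ ?_).trans (.der ((Fwd.right_lolliL₀ ?_ ?_ ?_).trans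
          (.lolliL_left Fwd.cut_ax_right))))) (.of_eq ?_)) _ _ hv)) <;>
      cases s <;> simp [Term.fv, comp_fv]

/-- The body of the word `z` without its last letter. -/
def dropLastTerm (z : ℕ) : Term α :=
  iterTerm z (r.tailFun 0) (r.tailFun 1) (r.tuple (.ax 2) (.ax 2) (.ax 2)) (r.comp 1)

theorem dropLast_value (S : List Bool) :
    .cut B (r.tuple (.ax 2) (.ax 2) (.ax 2)) 12 (r.tailValue S) ⇛ bintBody S.dropLast := by
  have e0 : .cut B (r.tuple (.ax 2) (.ax 2) (.ax 2)) 12 (.cut B (.ax 12) 4 (r.comp 0)) ⇛ .ax 2 :=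
    (cut_substComp (by simp [comp_fv])).trans r.tuple_comp₀
  have e1 : .cut B (r.tuple (.ax 2) (.ax 2) (.ax 2)) 12 (.cut B (.ax 12) 4 (r.comp 1)) ⇛ .ax 2 :=
    (cut_substComp (by simp [comp_fv])).trans r.tuple_comp₁
  cases S with
  | nil => exact (Fwd.right_wk (by simp)).trans (.wk ((Fwd.right_wk (by simp)).trans (.wk e1)))
  | cons s S =>
    rw [bintBody_eq]
    exact (Fwd.cut_assoc_symm (.inl (by simp [wordTerm_fv]))).trans
      ((Fwd.cutL e0).trans Fwd.cut_ax_self)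

theorem cut_dropLastTerm {ρ : ℕ → Formula α} (h0 : ρ 0 = !ₗ(A ⊸ₗ A)) (h1 : ρ 1 = !ₗ(A ⊸ₗ A))
    (S : List Bool)
    (hw : (Term.cut (!ₗ(bint B)) (.prom (bintProof B S).term) z (r.dropLastTerm z)).WT ρ A) :
    TEq ρ A (.cut (!ₗ(bint B)) (.prom (bintProof B S).term) z (r.dropLastTerm z))
      (bintBody S.dropLast) := by
  have e1 := cut_iterTerm S (by simp [tailFun_fv]) (by simp [tailFun_fv])
    (by simp [tailFun_fv]) (by simp [comp_fv]) (by simp [comp_fv]) (by simp [comp_fv]) ρ A hw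
  refine e1.trans (TEq.fwd ?_ (r.dropLast_value S))
  exact TEq.cutR (r.tailLoop_eq (by simp [h0]) (by simp [h1]) (by simp) S e1.right.2.1) e1.right

/-- The body of the word `z` with its last letter replaced by the word `w`. -/
def writeTerm (z : ℕ) (w : List Bool) : Term α :=
  .ctr 0 0 14 (.ctr 1 1 15 (.cut A (r.dropLastTerm z) 16 (wordTerm 14 15 16 3 w)))

theorem cut_writeTerm {ρ : ℕ → Formula α} (h0 : ρ 0 = !ₗ(A ⊸ₗ A)) (h1 : ρ 1 = !ₗ(A ⊸ₗ A))
    (S w : List Bool) (hz : 20 ≤ z)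
    (hw : (Term.cut (!ₗ(bint B)) (.prom (bintProof B S).term) z (r.writeTerm z w)).WT ρ A) :
    TEq ρ A (.cut (!ₗ(bint B)) (.prom (bintProof B S).term) z (r.writeTerm z w))
      (bintBody (S.dropLast ++ w)) := by
  have hfv : (bintProof B S).term.fv = ∅ := by
    ext; simp [bintProof, bintBody_eq, Term.fv, wordTerm_fv]; grind
  have e1 : .cut (!ₗ(bint B)) (.prom (bintProof B S).term) z (r.writeTerm z w) ⇛
      .ctr 0 0 14 (.ctr 1 1 15 (.cut A (.cut (!ₗ(bint B)) (.prom (bintProof B S).term) z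
        (r.dropLastTerm z)) 16 (wordTerm 14 15 16 3 w))) := by
    refine (Fwd.right_ctr ?_ ?_ ?_ ?_ ?_).trans (.ctr ((Fwd.right_ctr ?_ ?_ ?_ ?_ ?_).trans
      (.ctr (Fwd.cut_assoc_symm (.inl ?_))))) <;> simp [hfv, Term.fv, wordTerm_fv] <;> grind
  have e2 := e1 ρ A hw
  have w1 := e2.right
  obtain ⟨X, hX, w2, -⟩ := w1
  obtain rfl : A ⊸ₗ A = X := by simpa [h0] using hX
  obtain ⟨Y, hY, w3, -⟩ := id w2
  obtain rfl : A ⊸ₗ A = Y := by simpa [h1] using hY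
  refine (e2.trans (TEq.ctr (TEq.ctr (TEq.cutL (r.cut_dropLastTerm ?_ ?_ S w3.1) w3) ?_ w2) h0
    e2.right)).fwd (word_append A _ w) <;> simp [h1]

end Retract

/-! ### Selection by the scanned letters and the state -/

/-- The cut of the promotion of `t` against the hypothesis `z` of `u`. -/
abbrev Term.bcut (A : Formula α) (t : Term α) (z : ℕ) (u : Term α) : Term α :=
  .cut (!ₗA) (.prom t) z u

theorem bcut_comm {A B : Formula α} {s t u : Term α} {z w : ℕ} (hs : s.fv = ∅) (ht : t.fv = ∅)
    (h : z ≠ w) : .bcut A s z (.bcut B t w u) ⇛ .bcut B t w (.bcut A s z u) :=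
  Fwd.cut_comm h (by simp [Term.fv, ht]) (by simp [Term.fv, hs])

/-- The proof of `B ^ (m + 1)` with the given components. -/
def tupleFin : ∀ m : ℕ, (Fin (m + 1) → Term α) → Term α
  | 0, g => g 0
  | m + 1, g => .withR (g 0) (tupleFin m fun i => g i.succ)

theorem tupleFin_fv {s : Finset ℕ} : ∀ (m : ℕ) (g : Fin (m + 1) → Term α), (∀ i, (g i).fv = s) →
    (tupleFin m g).fv = s
  | 0, _, h => h 0
  | m + 1, _, h => by simp [tupleFin, Term.fv, h, tupleFin_fv m _ fun i => h i.succ]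

theorem tupleFin_WT {ρ : ℕ → Formula α} {B : Formula α} {s : Finset ℕ} :
    ∀ (m : ℕ) (g : Fin (m + 1) → Term α), (∀ i, (g i).fv = s) → (∀ i, (g i).WT ρ B) →
      (tupleFin m g).WT ρ (B.pow (m + 1))
  | 0, _, _, h => h 0
  | m + 1, _, hs, h => ⟨B, B.pow (m + 1), rfl, h 0,
      tupleFin_WT m _ (fun i => hs i.succ) fun i => h i.succ,
      (hs 0).trans (tupleFin_fv m _ fun i => hs i.succ).symm⟩

theorem cut_tupleFin {B : Formula α} : ∀ (m : ℕ) (g : Fin (m + 1) → Term α) (i : Fin (m + 1)),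
    .cut (B.pow (m + 1)) (tupleFin m g) 0 (projTerm 0 (m + 1) i) ⇛ g i
  | 0, g, i => by
    obtain rfl : i = 0 := Subsingleton.elim (α := Fin 1) i 0
    exact Fwd.cut_ax_right
  | m + 1, g, i => by
    refine Fin.cases ?_ (fun i => ?_) i
    · exact Fwd.cut_with₀.trans Fwd.cut_ax_right
    · exact Fwd.cut_with₁.trans (cut_tupleFin m (fun i => g i.succ) i)

theorem projTerm_fv (z : ℕ) : ∀ n i : ℕ, (projTerm z n i : Term α).fv = {z}
  | 0, _ | 1, _ => by simp [projTerm, Term.fv]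
  | _ + 2, 0 => by simp [projTerm, Term.fv]
  | n + 2, i + 1 => by simp [projTerm, Term.fv, projTerm_fv z (n + 1) i]

theorem projTerm_WT {A : Formula α} {z : ℕ} : ∀ (n i : ℕ) {ρ : ℕ → Formula α}, i < n →
    ρ z = A.pow n → (projTerm z n i).WT ρ A
  | 0, _, _, h, _ => absurd h (Nat.not_lt_zero _)
  | 1, _, _, _, hz => hz
  | n + 2, 0, _, _, hz => ⟨A, A.pow (n + 1), hz, by simp [Term.WT], by simp [Term.fv]⟩
  | n + 2, i + 1, _, h, hz => ⟨A, A.pow (n + 1), hz, projTerm_WT (n + 1) i (by omega) (by simp),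
      by simp [projTerm_fv], by simp⟩

theorem bintProof_fv (A : Formula α) (S : List Bool) : (bintProof A S).term.fv = ∅ := by
  ext; simp [bintProof, bintBody_eq, Term.fv, wordTerm_fv]; grind

theorem nboolProof_fv (A : Formula α) {n : ℕ} (i : Fin n) : (nboolProof A i).term.fv = ∅ := by
  simp [nboolProof, Term.fv, projTerm_fv]

theorem bintProof_WT (A : Formula α) (S : List Bool) (ρ : ℕ → Formula α) :
    (bintProof A S).term.WT ρ (bint A) := by
  refine ⟨_, _, rfl, ⟨_, _, rfl, ⟨_, _, rfl, ?_, ?_⟩, ?_⟩, ?_⟩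
  · rw [bintBody_eq]
    exact wordTerm_WT (by simp) (by simp) (by simp) (by simp) (by simp) (by simp) (by simp)
      (by simp) (by simp) S
  all_goals simp [bintBody_eq, Term.fv, wordTerm_fv]

theorem nboolProof_WT (A : Formula α) {n : ℕ} (i : Fin n) (ρ : ℕ → Formula α) :
    (nboolProof A i).term.WT ρ (nbool n A) :=
  ⟨_, _, rfl, projTerm_WT n i i.isLt (by simp), by simp [projTerm_fv]⟩

section Iter

variable {A B C : Formula α} {ρ : ℕ → Formula α} {G₀ G₁ init K : Term α} {z : ℕ}

theorem iterTerm_fv (hK : K.fv = {4}) (h₀ : ∀ y ∈ G₀.fv, y < 4 ∨ 7 < y)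
    (h₁ : ∀ y ∈ G₁.fv, y < 4 ∨ 7 < y) (hi : ∀ y ∈ init.fv, y < 4 ∨ 7 < y) :
    (iterTerm z G₀ G₁ init K).fv = {z} ∪ (G₀.fv ∪ (G₁.fv ∪ init.fv)) := by
  ext y
  simp only [iterTerm, Term.fv, hK, Finset.mem_union, Finset.mem_sdiff, Finset.mem_singleton]
  grind

theorem iterTerm_WT (hK : K.fv = {4}) (h₀ : ∀ y ∈ G₀.fv, y < 4 ∨ 7 < y)
    (h₁ : ∀ y ∈ G₁.fv, y < 4 ∨ 7 < y) (hi : ∀ y ∈ init.fv, y < 4 ∨ 7 < y)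
    (hz : ρ z = !ₗ(bint B)) (hz₀ : z ∉ G₀.fv) (hz₁ : z ∉ G₁.fv) (hzi : z ∉ init.fv)
    (w₀ : G₀.WT ρ (!ₗ(B ⊸ₗ B))) (w₁ : G₁.WT ρ (!ₗ(B ⊸ₗ B))) (wi : init.WT ρ B)
    (wK : K.WT (fun _ => B) C) (h01 : ∀ y ∈ G₀.fv, y ∉ G₁.fv)
    (h0i : ∀ y ∈ G₀.fv, y ∉ init.fv) (h1i : ∀ y ∈ G₁.fv, y ∉ init.fv) :
    (iterTerm z G₀ G₁ init K).WT ρ C := by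
  refine ⟨bint B, hz, ⟨_, !ₗ(B ⊸ₗ B) ⊸ₗ (B ⊸ₗ B), by simp [bint], w₀.congr ?_,
    ⟨_, B ⊸ₗ B, by simp, w₁.congr ?_,
    ⟨_, B, by simp, wi.congr ?_, wK.congr ?_, ?_⟩, ?_⟩, ?_⟩, ?_⟩
  all_goals
    try simp only [Term.fv, hK, Finset.mem_union, Finset.mem_sdiff, Finset.mem_singleton]
    grind

end Iter

namespace Retract

variable {A B : Formula α} (r : Retract (A.pow 3) B) {ρ : ℕ → Formula α} {z zS zT zq : ℕ} {m : ℕ}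
  {s : Finset ℕ}

theorem lastFun_WT (b : Bool) : (r.lastFun b).WT ρ (!ₗ(B ⊸ₗ B)) := by
  refine ⟨_, rfl, ⟨_, _, rfl, r.tuple_WT (r.comp_WT (by simp) 0 (by simp))
    (r.comp_WT (by simp) 1 (by simp)) ?_ ?_ ?_, ?_⟩, ?_⟩
  · cases b
    exacts [r.comp_WT (by simp) 0 (by simp), r.comp_WT (by simp) 1 (by simp)]
  all_goals cases b <;> simp [comp_fv, lastBody_fv, Term.fv]

theorem tailFun_WT {f : ℕ} (hf : ρ f = !ₗ(A ⊸ₗ A)) (h4 : f ≠ 4) (h2 : f ≠ 2) :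
    (r.tailFun f).WT ρ (!ₗ(B ⊸ₗ B)) := by
  have hw : (Term.wk f (r.comp 0)).WT (update ρ 4 B) A :=
    ⟨A ⊸ₗ A, by simp [hf, h4], r.comp_WT (by simp) 0 (by simp), by simp [comp_fv, h4]⟩
  refine ⟨_, rfl, ⟨_, _, rfl, r.tuple_WT ?_ hw hw ?_ rfl, ?_⟩, ?_⟩
  · refine ⟨A ⊸ₗ A, by simp [hf, h4], ⟨A, A, by simp, r.comp_WT ?_ 0 (by simp), by simp [Term.WT],
      ?_⟩, ?_⟩ <;> simp [Term.fv, comp_fv, h2, h4, h4.symm]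
  · ext; simp [Term.fv, comp_fv]
  · simp [tailBody_fv]
  · have := r.tailFun_fv h4
    simp only [tailFun, Term.fv] at this
    simp [Term.fv, this, hf]

theorem caseLast_fv {a b : Term α} (ha : a.fv = s) (hb : b.fv = s)
    (hs : ∀ y ∈ s, y < 4 ∨ 7 < y) : (r.caseLast z a b).fv = insert z s := by
  rw [caseLast, iterTerm_fv] <;> simp [comp_fv, lastFun_fv, tuple_fv, ha, hb]
  exact hs

theorem caseLast_WT {a b : Term α} (ha : a.fv = s) (hb : b.fv = s)
    (hs : ∀ y ∈ s, y < 4 ∨ 7 < y) (hzs : z ∉ s) (hzρ : ρ z = !ₗ(bint B))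
    (wa : a.WT ρ A) (wb : b.WT ρ A) : (r.caseLast z a b).WT ρ A := by
  refine iterTerm_WT ?_ ?_ ?_ ?_ hzρ ?_ ?_ ?_ (r.lastFun_WT _) (r.lastFun_WT _)
    (r.tuple_WT wa wb wa ?_ ?_) (r.comp_WT rfl 2 (by simp)) ?_ ?_ ?_ <;>
  simp [comp_fv, lastFun_fv, tuple_fv, ha, hb, hzs]
  exact hs

/-- The choice among the trees `g i` by the `n`-boolean `z : !(nbool (m + 1) B)`. -/
def caseState (z : ℕ) (g : Fin (m + 1) → Term α) : Term α :=
  .der z 5 (.lolliL 5 (tupleFin m fun i => r.tuple (g i) (g i) (g i)) 4 (r.comp 0))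

theorem cut_caseState (g : Fin (m + 1) → Term α) (i : Fin (m + 1)) :
    .bcut (nbool (m + 1) B) (nboolProof B i).term z (r.caseState z g) ⇛ g i :=
  Fwd.cut_der.trans (Fwd.cut_lolli.trans ((Fwd.cutL (cut_tupleFin m _ i)).trans r.tuple_comp₀))

theorem caseState_fv {g : Fin (m + 1) → Term α} (hg : ∀ i, (g i).fv = s)
    (hs : ∀ y ∈ s, y < 4 ∨ 7 < y) : (r.caseState z g).fv = insert z s := by
  have h := tupleFin_fv m (fun i => r.tuple (g i) (g i) (g i)) (s := s) (by simp [tuple_fv, hg])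
  ext y
  simp only [caseState, Term.fv, h, comp_fv, Nat.ofNat_pos, Finset.mem_union, Finset.mem_sdiff,
    Finset.mem_singleton, Finset.mem_insert]
  grind

theorem caseState_WT {g : Fin (m + 1) → Term α} (hg : ∀ i, (g i).fv = s)
    (hs : ∀ y ∈ s, y < 4 ∨ 7 < y) (hzs : z ∉ s) (hzρ : ρ z = !ₗ(nbool (m + 1) B))
    (w : ∀ i, (g i).WT ρ A) : (r.caseState z g).WT ρ A := by
  have hfv (i) : (r.tuple (g i) (g i) (g i)).fv = s := by simp [tuple_fv, hg]
  have h := tupleFin_fv m _ hfv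
  have hw : (tupleFin m fun i => r.tuple (g i) (g i) (g i)).WT ρ (B.pow (m + 1)) :=
    tupleFin_WT m _ hfv fun i => r.tuple_WT (w i) (w i) (w i) rfl rfl
  refine ⟨_, hzρ, ⟨B.pow (m + 1), B, by simp [nbool], hw.congr ?_,
    r.comp_WT (by simp) 0 (by simp), ?_⟩, ?_⟩
  all_goals
    simp only [Term.fv, h, comp_fv, Nat.ofNat_pos, Finset.mem_union, Finset.mem_sdiff,
      Finset.mem_singleton]
    grind

/-- The choice among trees by the last letters of the words `zS` and `zT` and by the state `zq`. -/
def caseAll (zS zT zq : ℕ) (L : Bool → Bool → Fin (m + 1) → Term α) : Term α :=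
  r.caseLast zS
    (r.caseLast zT (r.caseState zq (L false false)) (r.caseState zq (L false true)))
    (r.caseLast zT (r.caseState zq (L true false)) (r.caseState zq (L true true)))

theorem cut_caseAll {L : Bool → Bool → Fin (m + 1) → Term α} (S T : List Bool) (q : Fin (m + 1))
    (hST : zS ≠ zT) (hSq : zS ≠ zq) (hTq : zT ≠ zq) :
    .bcut (bint B) (bintProof B S).term zS (.bcut (bint B) (bintProof B T).term zT
      (.bcut (nbool (m + 1) B) (nboolProof B q).term zq (r.caseAll zS zT zq L))) ⇛
    L (S.getLastD false) (T.getLastD false) q := by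
  refine (Fwd.cutR (bcut_comm (bintProof_fv _ _) (nboolProof_fv _ _) hTq)).trans ?_
  refine (bcut_comm (bintProof_fv _ _) (nboolProof_fv _ _) hSq).trans ?_
  refine (Fwd.cutR ((bcut_comm (bintProof_fv _ _) (bintProof_fv _ _) hST).trans
    (Fwd.cutR (r.cut_caseLast S)))).trans ?_
  generalize S.getLastD false = σ
  -- Both branches of the choice by the left word read the right word and the state.
  refine .trans (.cutR (u' := r.caseState zq (L σ (T.getLastD false))) ?_)
    (r.cut_caseState _ q)
  cases σ <;> refine (r.cut_caseLast T).trans (.of_eq ?_) <;>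
  generalize T.getLastD false = τ <;> cases τ <;> rfl

theorem caseAll_fv {L : Bool → Bool → Fin (m + 1) → Term α} (hL : ∀ σ τ q, (L σ τ q).fv = s)
    (hs : ∀ y ∈ s, y < 4 ∨ 7 < y) (hT : 7 < zT) (hq : 7 < zq) :
    (r.caseAll zS zT zq L).fv = insert zS (insert zT (insert zq s)) := by
  have h1 (σ τ) : (r.caseState zq (L σ τ)).fv = insert zq s := r.caseState_fv (hL σ τ) hs
  have h2 (σ) : (r.caseLast zT (r.caseState zq (L σ false)) (r.caseState zq (L σ true))).fv =
      insert zT (insert zq s) := r.caseLast_fv (h1 _ _) (h1 _ _) (by simp; grind)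
  exact r.caseLast_fv (h2 _) (h2 _) (by simp; grind)

theorem caseAll_WT {L : Bool → Bool → Fin (m + 1) → Term α} (hL : ∀ σ τ q, (L σ τ q).fv = s)
    (hs : ∀ y ∈ s, y < 4 ∨ 7 < y) (hT : 7 < zT) (hq : 7 < zq)
    (hST : zS ≠ zT) (hSq : zS ≠ zq) (hTq : zT ≠ zq) (hSs : zS ∉ s) (hTs : zT ∉ s) (hqs : zq ∉ s)
    (ρS : ρ zS = !ₗ(bint B)) (ρT : ρ zT = !ₗ(bint B)) (ρq : ρ zq = !ₗ(nbool (m + 1) B))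
    (w : ∀ σ τ q, (L σ τ q).WT ρ A) : (r.caseAll zS zT zq L).WT ρ A := by
  have h1 (σ τ) : (r.caseState zq (L σ τ)).fv = insert zq s := r.caseState_fv (hL σ τ) hs
  have w1 (σ τ) : (r.caseState zq (L σ τ)).WT ρ A := r.caseState_WT (hL σ τ) hs hqs ρq (w σ τ)
  have h2 (σ) : (r.caseLast zT (r.caseState zq (L σ false)) (r.caseState zq (L σ true))).fv =
      insert zT (insert zq s) := r.caseLast_fv (h1 _ _) (h1 _ _) (by simp; grind)
  have w2 (σ) : (r.caseLast zT (r.caseState zq (L σ false)) (r.caseState zq (L σ true))).WT ρ A :=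
    r.caseLast_WT (h1 _ _) (h1 _ _) (by simp; grind) (by simp; grind) ρT (w1 _ _) (w1 _ _)
  exact r.caseLast_WT (h2 _) (h2 _) (by simp; grind) (by simp; grind) ρS (w2 _) (w2 _)

theorem dropLastTerm_fv : (r.dropLastTerm z).fv = {z, 0, 1, 2} := by
  rw [dropLastTerm, iterTerm_fv] <;> simp [comp_fv, tailFun_fv, tuple_fv, Term.fv]
  ext; simp; grind

theorem dropLastTerm_WT (h0 : ρ 0 = !ₗ(A ⊸ₗ A)) (h1 : ρ 1 = !ₗ(A ⊸ₗ A)) (h2 : ρ 2 = A)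
    (hz : 7 < z) (hzρ : ρ z = !ₗ(bint B)) : (r.dropLastTerm z).WT ρ A := by
  refine iterTerm_WT ?_ ?_ ?_ ?_ hzρ ?_ ?_ ?_ (r.tailFun_WT h0 (by simp) (by simp))
    (r.tailFun_WT h1 (by simp) (by simp))
    (r.tuple_WT h2 h2 h2 ?_ ?_) (r.comp_WT rfl 1 (by simp)) ?_ ?_ ?_ <;>
  simp [comp_fv, tailFun_fv, tuple_fv, Term.fv] <;> omega

theorem writeTerm_fv (hz : 20 ≤ z) (w : List Bool) : (r.writeTerm z w).fv = {z, 0, 1, 2} := by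
  ext; simp [writeTerm, Term.fv, wordTerm_fv, dropLastTerm_fv]; grind

theorem writeTerm_WT (h0 : ρ 0 = !ₗ(A ⊸ₗ A)) (h1 : ρ 1 = !ₗ(A ⊸ₗ A)) (h2 : ρ 2 = A)
    (hz : 20 ≤ z) (hzρ : ρ z = !ₗ(bint B)) (w : List Bool) : (r.writeTerm z w).WT ρ A := by
  refine ⟨A ⊸ₗ A, h0, ⟨A ⊸ₗ A, by simp [h1], ⟨r.dropLastTerm_WT ?_ ?_ ?_ ?_ ?_, wordTerm_WT ?_ ?_ ?_
    ?_ ?_ ?_ ?_ ?_ ?_ w, ?_⟩, ?_⟩, ?_⟩ <;>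
  (try simp [Term.fv, wordTerm_fv, dropLastTerm_fv, *]) <;> grind

/-- The word `zc` with its last letter replaced by the word `w σ τ q`, where `σ` and `τ` are the
last letters of the words `zS` and `zT` and `q` is the state `zq`. -/
def newWord (zS zT zq zc : ℕ) (w : Bool → Bool → Fin (m + 1) → List Bool) : Term α :=
  .lolliR 0 (.lolliR 1 (.lolliR 2 (r.caseAll zS zT zq fun σ τ q => r.writeTerm zc (w σ τ q))))

/-- The state `k σ τ q`, where `σ`, `τ` and `q` are as in `newWord`. -/
def newState (zS zT zq : ℕ) (k : Bool → Bool → Fin (m + 1) → Fin (m + 1)) : Term α :=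
  .lolliR 0 (r.caseAll zS zT zq fun σ τ q => projTerm 0 (m + 1) (k σ τ q))

variable {zc : ℕ} {w : Bool → Bool → Fin (m + 1) → List Bool}
  {k : Bool → Bool → Fin (m + 1) → Fin (m + 1)}

theorem newWord_fv (hS : 20 ≤ zS) (hT : 20 ≤ zT) (hq : 20 ≤ zq) (hc : 20 ≤ zc) :
    (r.newWord zS zT zq zc w).fv = {zS, zT, zq, zc} := by
  have h := r.caseAll_fv (zS := zS) (zT := zT) (zq := zq)
    (L := fun σ τ q => r.writeTerm zc (w σ τ q))
    (fun σ τ q => r.writeTerm_fv hc _) (by simp; omega) (by omega) (by omega)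
  ext; simp [newWord, Term.fv, h]; grind

theorem newState_fv (hS : 20 ≤ zS) (hT : 20 ≤ zT) (hq : 20 ≤ zq) :
    (r.newState zS zT zq k).fv = {zS, zT, zq} := by
  have h := r.caseAll_fv (zS := zS) (zT := zT) (zq := zq)
    (L := fun σ τ q => projTerm 0 (m + 1) (k σ τ q))
    (fun σ τ q => projTerm_fv _ _ _) (by simp) (by omega) (by omega)
  ext; simp [newState, Term.fv, h]; grind

theorem newWord_WT (hS : 20 ≤ zS) (hT : 20 ≤ zT) (hq : 20 ≤ zq) (hc : 20 ≤ zc)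
    (hST : zS ≠ zT) (hSq : zS ≠ zq) (hTq : zT ≠ zq) (hSc : zS ≠ zc) (hTc : zT ≠ zc) (hqc : zq ≠ zc)
    (ρS : ρ zS = !ₗ(bint B)) (ρT : ρ zT = !ₗ(bint B)) (ρq : ρ zq = !ₗ(nbool (m + 1) B))
    (ρc : ρ zc = !ₗ(bint B)) : (r.newWord zS zT zq zc w).WT ρ (bint A) := by
  have h := r.caseAll_fv (zS := zS) (zT := zT) (zq := zq)
    (L := fun σ τ q => r.writeTerm zc (w σ τ q))
    (fun σ τ q => r.writeTerm_fv hc _) (by simp; omega) (by omega) (by omega)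
  refine ⟨_, _, rfl, ⟨_, _, rfl, ⟨_, _, rfl, r.caseAll_WT
    (fun σ τ q => r.writeTerm_fv hc _) (by simp; omega) (by omega) (by omega)
    hST hSq hTq ?_ ?_ ?_ ?_ ?_ ?_ (fun σ τ q => r.writeTerm_WT ?_ ?_ ?_ ?_ ?_ _), ?_⟩, ?_⟩, ?_⟩ <;>
  (try simp only [h, Term.fv, Finset.mem_insert, Finset.mem_sdiff, Finset.mem_singleton]) <;> grind

theorem newState_WT (hS : 20 ≤ zS) (hT : 20 ≤ zT) (hq : 20 ≤ zq)
    (hST : zS ≠ zT) (hSq : zS ≠ zq) (hTq : zT ≠ zq)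
    (ρS : ρ zS = !ₗ(bint B)) (ρT : ρ zT = !ₗ(bint B)) (ρq : ρ zq = !ₗ(nbool (m + 1) B)) :
    (r.newState zS zT zq k).WT ρ (nbool (m + 1) A) := by
  have h := r.caseAll_fv (zS := zS) (zT := zT) (zq := zq)
    (L := fun σ τ q => projTerm 0 (m + 1) (k σ τ q))
    (fun σ τ q => projTerm_fv _ _ _) (by simp) (by omega) (by omega)
  refine ⟨_, _, rfl, r.caseAll_WT
    (fun σ τ q => projTerm_fv _ _ _) (by simp) (by omega) (by omega)
    hST hSq hTq ?_ ?_ ?_ ?_ ?_ ?_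
    (fun σ τ q => projTerm_WT _ _ (k σ τ q).isLt (by simp)), ?_⟩ <;>
  (try simp only [h, Finset.mem_insert, Finset.mem_singleton]) <;> grind

end Retract

/-! ### Distribution of a configuration -/

/-- The hypothesis `z` of type `!A` is contracted to copies, called `z` and the names in `l`. -/
def copies (z : ℕ) (l : List ℕ) (u : Term α) : Term α := l.foldr (fun y v => .ctr z z y v) u

theorem copies_fv {z : ℕ} {l : List ℕ} {u : Term α} (hz : z ∈ u.fv) :
    (copies z l u).fv = u.fv \ l.toFinset ∪ {z} := by
  induction l with
  | nil => ext; simp [copies]; grind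
  | cons y l ih =>
    ext
    simp only [copies, List.foldr_cons, Term.fv] at ih ⊢
    simp only [ih]; simp; grind

theorem copies_WT {ρ : ℕ → Formula α} {A C : Formula α} {z : ℕ} {l : List ℕ} {u : Term α}
    (hl : (z :: l).Nodup) (hu : ∀ y ∈ z :: l, y ∈ u.fv) (hz : ρ z = !ₗA)
    (w : u.WT (fun y => if y ∈ l then !ₗA else ρ y) C) : (copies z l u).WT ρ C := by
  induction l generalizing ρ with
  | nil => simpa [copies] using w
  | cons y l ih =>
    have hfv := copies_fv (l := l) (hu z (by simp))
    refine ⟨A, hz, ih (by grind) (by grind) (by simp) (w.congr ?_), ?_⟩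
    · grind
    · change _ ∈ (copies z l u).fv ∧ _ ∈ (copies z l u).fv ∧ _ ∧ (_ ∈ (copies z l u).fv → _)
      simp only [hfv]; simp; grind

theorem bcut_copies {A : Formula α} {t u : Term α} {z : ℕ} {l : List ℕ} (ht : t.fv = ∅)
    (hl : z ∉ l) : .bcut A t z (copies z l u) ⇛ l.foldr (fun y v => .bcut A t y v)
      (.bcut A t z u) := by
  induction l with
  | nil => exact .refl _
  | cons y l ih =>
    have hy : z ≠ y := by grind
    exact (Fwd.cut_ctr_closed ht hy).trans ((bcut_comm ht ht hy).trans (.cutR (ih (by grind))))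

theorem bcut_copies_of_ne {A : Formula α} {t u : Term α} {x z : ℕ} {l : List ℕ} (ht : t.fv = ∅)
    (hz : x ≠ z) (hl : x ∉ l) : .bcut A t x (copies z l u) ⇛ copies z l (.bcut A t x u) := by
  induction l with
  | nil => exact .refl _
  | cons y l ih =>
    refine (Fwd.right_ctr hz hz.symm ?_ ?_ ?_).trans (.ctr (ih ?_)) <;> grind [Term.fv]

theorem copies_congr {z : ℕ} {l : List ℕ} {u u' : Term α} (h : u ⇛ u') :
    copies z l u ⇛ copies z l u' := by
  induction l with
  | nil => exact h
  | cons y l ih => exact ih.ctr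

/-- The tensor product of three promotions. -/
def triple (a b c : Term α) : Term α := .tensorR (.tensorR (.prom a) (.prom b)) (.prom c)

theorem bcut_triple₀ {A : Formula α} {t a b c : Term α} {x : ℕ} (ha : x ∈ a.fv) (hb : x ∉ b.fv)
    (hc : x ∉ c.fv) : .bcut A t x (triple a b c) ⇛ triple (.bcut A t x a) b c :=
  (Fwd.right_tensorR₀ (u := .tensorR (.prom a) (.prom b)) (v := .prom c)
    (by simp [Term.fv, ha]) hc).trans
    (.tensorR_left ((Fwd.right_tensorR₀ (u := .prom a) (v := .prom b) ha hb).trans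
      (.tensorR_left Fwd.cut_prom)))

theorem bcut_triple₁ {A : Formula α} {t a b c : Term α} {x : ℕ} (ha : x ∉ a.fv) (hb : x ∈ b.fv)
    (hc : x ∉ c.fv) : .bcut A t x (triple a b c) ⇛ triple a (.bcut A t x b) c :=
  (Fwd.right_tensorR₀ (u := .tensorR (.prom a) (.prom b)) (v := .prom c)
    (by simp [Term.fv, hb]) hc).trans
    (.tensorR_left ((Fwd.right_tensorR₁ (u := .prom a) (v := .prom b) ha hb).trans
      (.tensorR_right Fwd.cut_prom)))

theorem bcut_triple₂ {A : Formula α} {t a b c : Term α} {x : ℕ} (ha : x ∉ a.fv) (hb : x ∉ b.fv)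
    (hc : x ∈ c.fv) : .bcut A t x (triple a b c) ⇛ triple a b (.bcut A t x c) :=
  (Fwd.right_tensorR₁ (u := .tensorR (.prom a) (.prom b)) (v := .prom c)
    (by simp [Term.fv, ha, hb]) hc).trans (.tensorR_right Fwd.cut_prom)

/-- The promotions of the two words and of the state are distributed over their copies. The first
component reads copies `20`, `30`, `40` and rewrites the copy `23` of the left word, the second one
reads `21`, `31`, `41` and rewrites the copy `33` of the right word, and the third one reads `22`,
`32`, `42`. -/
theorem bcut_contract {A B : Formula α} {tS tT tq a b c : Term α} (hS : tS.fv = ∅) (hT : tT.fv = ∅)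
    (hq : tq.fv = ∅) (ha : a.fv = {20, 30, 40, 23}) (hb : b.fv = {21, 31, 41, 33})
    (hc : c.fv = {22, 32, 42}) :
    .bcut A tS 20 (.bcut A tT 30 (.bcut B tq 40 (copies 20 [23, 21, 22] (copies 30 [33, 31, 32]
      (copies 40 [41, 42] (triple a b c)))))) ⇛
    triple (.bcut A tS 23 (.bcut A tS 20 (.bcut A tT 30 (.bcut B tq 40 a))))
      (.bcut A tT 33 (.bcut A tS 21 (.bcut A tT 31 (.bcut B tq 41 b))))
      (.bcut A tS 22 (.bcut A tT 32 (.bcut B tq 42 c))) := by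
  have e1 : .bcut B tq 40 (copies 20 [23, 21, 22] (copies 30 [33, 31, 32]
      (copies 40 [41, 42] (triple a b c)))) ⇛ copies 20 [23, 21, 22] (copies 30 [33, 31, 32]
      (triple (.bcut B tq 40 a) (.bcut B tq 41 b) (.bcut B tq 42 c))) := by
    refine (bcut_copies_of_ne hq (by simp) (by simp)).trans (copies_congr
      ((bcut_copies_of_ne hq (by simp) (by simp)).trans (copies_congr ?_)))
    refine (bcut_copies hq (by simp)).trans ((Fwd.cutR (Fwd.cutR (bcut_triple₀ ?_ ?_ ?_))).trans
      ((Fwd.cutR (bcut_triple₂ ?_ ?_ ?_)).trans (bcut_triple₁ ?_ ?_ ?_))) <;>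
    simp [Term.fv, *]
  refine (Fwd.cutR (Fwd.cutR e1)).trans ?_
  have e2 {a b c : Term α} (ha : a.fv = {20, 30, 23}) (hb : b.fv = {21, 31, 33})
      (hc : c.fv = {22, 32}) : .bcut A tT 30 (copies 20 [23, 21, 22] (copies 30 [33, 31, 32]
      (triple a b c))) ⇛ copies 20 [23, 21, 22] (triple (.bcut A tT 30 a)
      (.bcut A tT 33 (.bcut A tT 31 b)) (.bcut A tT 32 c)) := by
    refine (bcut_copies_of_ne hT (by simp) (by simp)).trans (copies_congr ?_)
    refine (bcut_copies hT (by simp)).trans ((Fwd.cutR (Fwd.cutR (Fwd.cutR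
      (bcut_triple₀ ?_ ?_ ?_)))).trans ((Fwd.cutR (Fwd.cutR (bcut_triple₂ ?_ ?_ ?_))).trans
      ((Fwd.cutR (bcut_triple₁ ?_ ?_ ?_)).trans (bcut_triple₁ ?_ ?_ ?_)))) <;>
    simp [Term.fv, *]
  refine (Fwd.cutR (e2 ?_ ?_ ?_)).trans ?_
  · simp [Term.fv, *]; decide
  · simp [Term.fv, *]; decide
  · simp [Term.fv, *]; decide
  have e3 {a b c : Term α} (ha : a.fv = {20, 23}) (hb : b.fv = {21}) (hc : c.fv = {22}) :
      .bcut A tS 20 (copies 20 [23, 21, 22] (triple a b c)) ⇛ triple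
      (.bcut A tS 23 (.bcut A tS 20 a)) (.bcut A tS 21 b) (.bcut A tS 22 c) := by
    refine (bcut_copies hS (by simp)).trans ((Fwd.cutR (Fwd.cutR (Fwd.cutR
      (bcut_triple₀ ?_ ?_ ?_)))).trans ((Fwd.cutR (Fwd.cutR (bcut_triple₂ ?_ ?_ ?_))).trans
      ((Fwd.cutR (bcut_triple₁ ?_ ?_ ?_)).trans (bcut_triple₀ ?_ ?_ ?_)))) <;>
    simp [Term.fv, *]
  refine (e3 ?_ ?_ ?_).trans ?_
  · simp [Term.fv, *]; decide
  · simp [Term.fv, *]; decide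
  · simp [Term.fv, *]; decide
  exact .tensorR_left (.tensorR_right (.prom (bcut_comm hS hT (by simp))))

/-! ### One transition -/

/-- The letters that replace the last letter of the left word in a transition. -/
def leftLetters {n : ℕ} (δ : Transition n) (σ τ : Bool) (q : Fin n) : List Bool :=
  match δ (σ, q) with
  | (_, _, .left) => []
  | (σ', _, .right) => [σ', τ]

/-- The letters that replace the last letter of the right word in a transition. -/
def rightLetters {n : ℕ} (δ : Transition n) (σ τ : Bool) (q : Fin n) : List Bool :=
  match δ (σ, q) with
  | (σ', _, .left) => [τ, σ']
  | (_, _, .right) => []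

theorem stepConfig_eq {n : ℕ} (δ : Transition n) (c : Config n) : stepConfig δ c =
    ⟨c.S.dropLast ++ leftLetters δ (c.S.getLastD false) (c.T.getLastD false) c.q,
      c.T.dropLast ++ rightLetters δ (c.S.getLastD false) (c.T.getLastD false) c.q,
      (δ (c.S.getLastD false, c.q)).2.1⟩ := by
  simp only [stepConfig, leftLetters, rightLetters]
  rcases δ (c.S.getLastD false, c.q) with ⟨σ', q', _ | _⟩ <;> simp

namespace Retract

variable {A B : Formula α} (r : Retract (A.pow 3) B) {ρ : ℕ → Formula α} {z zS zT zq zc : ℕ} {m : ℕ}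
  {w : Bool → Bool → Fin (m + 1) → List Bool} {k : Bool → Bool → Fin (m + 1) → Fin (m + 1)}

theorem bcut_lolliR {t u : Term α} {x : ℕ} (ht : t.fv = ∅) (hx : x ≠ z) :
    .bcut A t z (.lolliR x u) ⇛ .lolliR x (.bcut A t z u) :=
  Fwd.right_lolliR hx (by simp [Term.fv, ht])

theorem cut_newState (S T : List Bool) (q : Fin (m + 1)) (hS : 20 ≤ zS) (hT : 20 ≤ zT)
    (hq : 20 ≤ zq) (hST : zS ≠ zT) (hSq : zS ≠ zq) (hTq : zT ≠ zq) :
    .bcut (bint B) (bintProof B S).term zS (.bcut (bint B) (bintProof B T).term zT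
      (.bcut (nbool (m + 1) B) (nboolProof B q).term zq (r.newState zS zT zq k))) ⇛
    (nboolProof A (k (S.getLastD false) (T.getLastD false) q)).term := by
  refine (Fwd.cutR ((Fwd.cutR (bcut_lolliR (nboolProof_fv _ _) (by omega))).trans
    (bcut_lolliR (bintProof_fv _ _) (by omega)))).trans
    ((bcut_lolliR (bintProof_fv _ _) (by omega)).trans (.lolliR ?_))
  exact r.cut_caseAll S T q hST hSq hTq

theorem cut_newWord (S T U : List Bool) (q : Fin (m + 1)) (hS : 20 ≤ zS) (hT : 20 ≤ zT)
    (hq : 20 ≤ zq) (hc : 20 ≤ zc) (hST : zS ≠ zT) (hSq : zS ≠ zq) (hTq : zT ≠ zq)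
    (hw : (Term.bcut (bint B) (bintProof B U).term zc (.bcut (bint B) (bintProof B S).term zS
      (.bcut (bint B) (bintProof B T).term zT
      (.bcut (nbool (m + 1) B) (nboolProof B q).term zq (r.newWord zS zT zq zc w))))).WT ρ
        (bint A)) :
    TEq ρ (bint A) (.bcut (bint B) (bintProof B U).term zc
      (.bcut (bint B) (bintProof B S).term zS (.bcut (bint B) (bintProof B T).term zT
      (.bcut (nbool (m + 1) B) (nboolProof B q).term zq (r.newWord zS zT zq zc w)))))
    (bintProof A (U.dropLast ++ w (S.getLastD false) (T.getLastD false) q)).term := by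
  have push (C : Formula α) (t u : Term α) (z : ℕ) (hz : 20 ≤ z) (ht : t.fv = ∅) :
      .bcut C t z (.lolliR 0 (.lolliR 1 (.lolliR 2 u))) ⇛
        .lolliR 0 (.lolliR 1 (.lolliR 2 (.bcut C t z u))) :=
    (bcut_lolliR ht (by omega)).trans (.lolliR ((bcut_lolliR ht (by omega)).trans
      (.lolliR (bcut_lolliR ht (by omega)))))
  have e1 : .bcut (bint B) (bintProof B S).term zS (.bcut (bint B) (bintProof B T).term zT
      (.bcut (nbool (m + 1) B) (nboolProof B q).term zq (r.newWord zS zT zq zc w))) ⇛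
      .lolliR 0 (.lolliR 1 (.lolliR 2
        (r.writeTerm zc (w (S.getLastD false) (T.getLastD false) q)))) := by
    refine (Fwd.cutR ((Fwd.cutR (push _ _ _ _ hq (nboolProof_fv _ _))).trans
      (push _ _ _ _ hT (bintProof_fv _ _)))).trans ((push _ _ _ _ hS (bintProof_fv _ _)).trans ?_)
    exact .lolliR (.lolliR (.lolliR (r.cut_caseAll S T q hST hSq hTq)))
  have e2 := ((Fwd.cutR e1).trans (push _ _ _ _ hc (bintProof_fv _ _))) ρ _ hw
  have w0 := e2.right
  obtain ⟨X, Y, hX, w1, -⟩ := id w0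
  obtain ⟨rfl, rfl⟩ := Formula.lolli.inj hX
  obtain ⟨X, Y, hX, w2, -⟩ := id w1
  obtain ⟨rfl, rfl⟩ := Formula.lolli.inj hX
  obtain ⟨X, Y, hX, w3, -⟩ := id w2
  obtain ⟨rfl, rfl⟩ := Formula.lolli.inj hX
  exact e2.trans (TEq.lolliR (TEq.lolliR (TEq.lolliR (r.cut_writeTerm (by simp) (by simp) U _ hc w3)
    w2) w1) w0)

/-- The proof of `Tur (m + 1) B ⊢ Tur (m + 1) A` for one transition: the configuration `0` is split
into the words `20` and `30` and the state `40`, and these are contracted to as many copies as are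
used by the new words and the new state. -/
def stepTerm (r : Retract (A.pow 3) B) (δ : Transition (m + 1)) : Term α :=
  .tensorL 0 50 40 (.tensorL 50 20 30 (copies 20 [23, 21, 22] (copies 30 [33, 31, 32]
    (copies 40 [41, 42] (triple (r.newWord 20 30 40 23 (leftLetters δ))
      (r.newWord 21 31 41 33 (rightLetters δ))
      (r.newState 22 32 42 fun σ _ q => (δ (σ, q)).2.1))))))

variable (δ : Transition (m + 1))

theorem copies_step_fv {a b c : Term α} (ha : a.fv = {20, 30, 40, 23})
    (hb : b.fv = {21, 31, 41, 33}) (hc : c.fv = {22, 32, 42}) :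
    (copies 40 [41, 42] (triple a b c)).fv = {20, 21, 22, 23, 30, 31, 32, 33, 40} ∧
    (copies 30 [33, 31, 32] (copies 40 [41, 42] (triple a b c))).fv = {20, 21, 22, 23, 30, 40} ∧
    (copies 20 [23, 21, 22] (copies 30 [33, 31, 32] (copies 40 [41, 42] (triple a b c)))).fv =
      {20, 30, 40} := by
  have h3 : (copies 40 [41, 42] (triple a b c)).fv = {20, 21, 22, 23, 30, 31, 32, 33, 40} := by
    rw [copies_fv (by simp [triple, Term.fv, ha, hb, hc])]
    simp only [triple, Term.fv, ha, hb, hc]; decide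
  have h2 : (copies 30 [33, 31, 32] (copies 40 [41, 42] (triple a b c))).fv =
      {20, 21, 22, 23, 30, 40} := by
    rw [copies_fv (by simp [h3]), h3]; decide
  exact ⟨h3, h2, by rw [copies_fv (by simp [h2]), h2]; decide⟩

theorem stepTerm_WT (h0 : ρ 0 = Tur (m + 1) B) : (r.stepTerm δ).WT ρ (Tur (m + 1) A) := by
  have f1 := r.newWord_fv (zS := 20) (zT := 30) (zq := 40) (zc := 23) (w := leftLetters δ)
    (by simp) (by simp) (by simp) (by simp)
  have f2 := r.newWord_fv (zS := 21) (zT := 31) (zq := 41) (zc := 33) (w := rightLetters δ)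
    (by simp) (by simp) (by simp) (by simp)
  have f3 := r.newState_fv (zS := 22) (zT := 32) (zq := 42)
    (k := fun σ _ q => (δ (σ, q)).2.1) (by simp) (by simp) (by simp)
  obtain ⟨h3, h2, h1⟩ := copies_step_fv f1 f2 f3
  have h4 : (triple (r.newWord 20 30 40 23 (leftLetters δ)) (r.newWord 21 31 41 33 (rightLetters δ))
      (r.newState 22 32 42 fun σ _ q => (δ (σ, q)).2.1)).fv =
      {20, 30, 40, 23, 21, 31, 41, 33, 22, 32, 42} := by
    simp only [triple, Term.fv, f1, f2, f3]; decide
  refine ⟨!ₗ(bint B) ⊗ₗ !ₗ(bint B), !ₗ(nbool (m + 1) B), h0, ⟨!ₗ(bint B), !ₗ(bint B), by simp,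
    copies_WT (A := bint B) ?_ ?_ ?_ (copies_WT (A := bint B) ?_ ?_ ?_
    (copies_WT (A := nbool (m + 1) B) ?_ ?_ ?_
    ⟨!ₗ(bint A) ⊗ₗ !ₗ(bint A), !ₗ(nbool (m + 1) A), rfl, ⟨!ₗ(bint A), !ₗ(bint A), rfl,
      ⟨bint A, rfl, r.newWord_WT ?_ ?_ ?_ ?_ ?_ ?_ ?_ ?_ ?_ ?_ ?_ ?_ ?_ ?_, ?_⟩,
      ⟨bint A, rfl, r.newWord_WT ?_ ?_ ?_ ?_ ?_ ?_ ?_ ?_ ?_ ?_ ?_ ?_ ?_ ?_, ?_⟩, ?_⟩,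
      ⟨nbool (m + 1) A, rfl, r.newState_WT ?_ ?_ ?_ ?_ ?_ ?_ ?_ ?_ ?_, ?_⟩, ?_⟩)), ?_⟩, ?_⟩
  all_goals simp [Term.fv, f1, f2, f3, h1, h2, h3, h4]

theorem stepTerm_fv : (r.stepTerm δ).fv = {0} := by
  have h := (copies_step_fv
    (r.newWord_fv (zS := 20) (zT := 30) (zq := 40) (zc := 23) (w := leftLetters δ)
      (by simp) (by simp) (by simp) (by simp))
    (r.newWord_fv (zS := 21) (zT := 31) (zq := 41) (zc := 33) (w := rightLetters δ)
      (by simp) (by simp) (by simp) (by simp))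
    (r.newState_fv (zS := 22) (zT := 32) (zq := 42)
      (k := fun σ _ q => (δ (σ, q)).2.1) (by simp) (by simp) (by simp))).2.2
  simp only [stepTerm, Term.fv, h]; decide

theorem configProof_fv (c : Config (m + 1)) : (configProof B c).term.fv = ∅ := by
  simp [configProof, LLProof.tensor, LLProof.prom, Term.fv, bintProof_fv, nboolProof_fv]

theorem configProof_WT (c : Config (m + 1)) : (configProof B c).term.WT ρ (Tur (m + 1) B) := by
  refine ⟨_, _, rfl, ⟨_, _, rfl, ⟨_, rfl, bintProof_WT _ _ _, ?_⟩, ⟨_, rfl, bintProof_WT _ _ _, ?_⟩,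
    ?_⟩, ⟨_, rfl, nboolProof_WT _ _ _, ?_⟩, ?_⟩ <;>
  simp [LLProof.prom, LLProof.tensor, Term.fv, bintProof_fv, nboolProof_fv]

theorem cut_stepTerm (c : Config (m + 1)) : TEq ρ (Tur (m + 1) A)
    (.cut (Tur (m + 1) B) (configProof B c).term 0 (r.stepTerm δ))
    (configProof A (stepConfig δ c)).term := by
  have f1 := r.newWord_fv (zS := 20) (zT := 30) (zq := 40) (zc := 23) (w := leftLetters δ)
    (by simp) (by simp) (by simp) (by simp)
  have f2 := r.newWord_fv (zS := 21) (zT := 31) (zq := 41) (zc := 33) (w := rightLetters δ)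
    (by simp) (by simp) (by simp) (by simp)
  have f3 := r.newState_fv (zS := 22) (zT := 32) (zq := 42)
    (k := fun σ _ q => (δ (σ, q)).2.1) (by simp) (by simp) (by simp)
  have hS := bintProof_fv B c.S
  have hT := bintProof_fv B c.T
  have hq := nboolProof_fv B c.q
  have hw : (Term.cut (Tur (m + 1) B) (configProof B c).term 0 (r.stepTerm δ)).WT ρ
      (Tur (m + 1) A) := by
    refine ⟨configProof_WT c, r.stepTerm_WT δ (by simp), ?_, by simp [configProof_fv]⟩
    simp [stepTerm, Term.fv]
  have e1 := (Fwd.cut_tensor (by simp) (by simp [Term.fv, hq])).trans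
    ((Fwd.cutR (Fwd.right_tensorL (by simp) (by simp) (by simp) (by simp [Term.fv, hq])
    (by simp [Term.fv, hq]))).trans ((Fwd.cut_tensor (by simp)
    (by simp [Term.fv, hT])).trans
    (bcut_contract hS hT hq f1 f2 f3))) ρ _ hw
  refine e1.trans ?_
  obtain ⟨X, Y, hXY, ⟨X', Y', hXY', ⟨_, h3, w1, -⟩, ⟨_, h4, w2, -⟩, -⟩, ⟨_, h5, w3, -⟩, -⟩ :=
    e1.right
  obtain ⟨rfl, rfl⟩ := Formula.tensor.inj hXY
  obtain ⟨rfl, rfl⟩ := Formula.tensor.inj hXY'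
  obtain rfl := Formula.bang.inj h3
  obtain rfl := Formula.bang.inj h4
  obtain rfl := Formula.bang.inj h5
  have t1 := r.cut_newWord c.S c.T c.S c.q (by simp) (by simp) (by simp) (by simp) (by simp)
    (by simp) (by simp) w1
  have t2 := r.cut_newWord c.S c.T c.T c.q (by simp) (by simp) (by simp) (by simp) (by simp)
    (by simp) (by simp) w2
  have t3 := r.cut_newState c.S c.T c.q (by simp) (by simp) (by simp) (by simp) (by simp)
    (by simp) ρ _ w3
  have z1 := t1.fv.trans (bintProof_fv _ _)
  have z2 := t2.fv.trans (bintProof_fv _ _)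
  have z3 := t3.fv.trans (nboolProof_fv _ _)
  rw [stepConfig_eq]
  refine TEq.tensorR (TEq.tensorR (t1.prom z1) (t2.prom z2) fun y hy => ?_) (t3.prom z3)
    fun y hy => ?_
  · exact absurd (z1.subset hy) (Finset.notMem_empty y)
  · exact ((Finset.mem_union.mp hy).elim (fun h => Finset.notMem_empty y (z1.subset h))
      fun h => Finset.notMem_empty y (z2.subset h)).elim

end Retract

/-! ### Retracts between powers -/

namespace Retract

variable {X Y Z A : Formula α}

/-- Every formula is a retract of itself. -/
protected def refl (X : Formula α) : Retract X X where
  pk := .ax 4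
  un := .ax 4
  pk_fv := rfl
  un_fv := rfl
  pk_rename e he := by simp [Term.rename, he]
  un_rename e he := by simp [Term.rename, he]
  pk_WT ρ h := h
  un_WT ρ h := h
  un_pk := Fwd.cut_ax_self

/-- The composite of two retracts. -/
protected def trans (r : Retract X Y) (s : Retract Y Z) : Retract X Z where
  pk := .cut Y r.pk 4 s.pk
  un := .cut Y s.un 4 r.un
  pk_fv := by simp [Term.fv, r.pk_fv, s.pk_fv]
  un_fv := by simp [Term.fv, r.un_fv, s.un_fv]
  pk_rename e he := by simp [Term.rename, r.pk_rename, s.pk_rename, he]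
  un_rename e he := by simp [Term.rename, r.un_rename, s.un_rename, he]
  pk_WT ρ h := ⟨r.pk_WT ρ h, s.pk_WT _ (by simp), by simp [s.pk_fv], by simp [r.pk_fv]⟩
  un_WT ρ h := ⟨s.un_WT ρ h, r.un_WT _ (by simp), by simp [r.un_fv], by simp [s.un_fv]⟩
  un_pk := s.cancel.trans r.un_pk

/-- A retract between right factors gives a retract between products. -/
def prodRight (A : Formula α) (r : Retract X Y) : Retract (A &ₗ X) (A &ₗ Y) where
  pk := .withR (.withL₀ 4 4 (.ax 4)) (.withL₁ 4 4 r.pk)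
  un := .withR (.withL₀ 4 4 (.ax 4)) (.withL₁ 4 4 r.un)
  pk_fv := by simp [Term.fv, r.pk_fv]
  un_fv := by simp [Term.fv, r.un_fv]
  pk_rename e he := by simp [Term.rename, r.pk_rename, he]
  un_rename e he := by simp [Term.rename, r.un_rename, he]
  pk_WT ρ h := ⟨A, Y, rfl, ⟨A, X, h, by simp [Term.WT], by simp [Term.fv]⟩,
    ⟨A, X, h, r.pk_WT _ (by simp), by simp [r.pk_fv]⟩, by simp [Term.fv, r.pk_fv]⟩
  un_WT ρ h := ⟨A, X, rfl, ⟨A, Y, h, by simp [Term.WT], by simp [Term.fv]⟩,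
    ⟨A, Y, h, r.un_WT _ (by simp), by simp [r.un_fv]⟩, by simp [Term.fv, r.un_fv]⟩
  un_pk := Fwd.right_withR.trans ((Fwd.withR (Fwd.cut_with₀.trans Fwd.cut_ax_right)
    (Fwd.cut_with₁.trans ((Fwd.left_withL₁ (.inr rfl)).trans (.withL₁ r.un_pk)))).trans
    Fwd.eta_with)

/-- The product `(X & Y) & Z` is a retract of `X & (Y & Z)`. -/
def assoc (X Y Z : Formula α) : Retract ((X &ₗ Y) &ₗ Z) (X &ₗ (Y &ₗ Z)) where
  pk := .withR (.withL₀ 4 4 (.withL₀ 4 4 (.ax 4)))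
    (.withR (.withL₀ 4 4 (.withL₁ 4 4 (.ax 4))) (.withL₁ 4 4 (.ax 4)))
  un := .withR (.withR (.withL₀ 4 4 (.ax 4)) (.withL₁ 4 4 (.withL₀ 4 4 (.ax 4))))
    (.withL₁ 4 4 (.withL₁ 4 4 (.ax 4)))
  pk_fv := by simp [Term.fv]
  un_fv := by simp [Term.fv]
  pk_rename e he := by simp [Term.rename, he]
  un_rename e he := by simp [Term.rename, he]
  pk_WT ρ h := by simp [Term.WT, Term.fv, h]
  un_WT ρ h := by simp [Term.WT, Term.fv, h]
  un_pk := by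
    refine Fwd.right_withR.trans ((Fwd.withR (Fwd.right_withR.trans (Fwd.withR
      (Fwd.cut_with₀.trans Fwd.cut_ax_right)
      (Fwd.cut_with₁.trans (Fwd.cut_with₀.trans Fwd.cut_ax_right))))
      (Fwd.cut_with₁.trans (Fwd.cut_with₁.trans Fwd.cut_ax_right))).trans ?_)
    exact (Fwd.withR_left (Fwd.withR_withL₀.trans (.withL₀ Fwd.eta_with))).trans Fwd.eta_with

/-- The right-nested product of `a + b + 2` copies of `A` has as a retract the product of its first
`a + 1` and its last `b + 1` factors. -/
theorem nonempty_pow_with_pow (A : Formula α) (a b : ℕ) :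
    Nonempty (Retract (A.pow (a + 1) &ₗ A.pow (b + 1)) (A.pow (a + b + 2))) := by
  induction a with
  | zero => rw [show 0 + b + 2 = b + 2 by omega]; exact ⟨.refl (A.pow (b + 2))⟩
  | succ a ih =>
    obtain ⟨r⟩ := ih
    rw [show a + 1 + b + 2 = a + b + 1 + 2 by omega]
    exact ⟨(assoc A (A.pow (a + 1)) (A.pow (b + 1))).trans (r.prodRight A)⟩

theorem nonempty_pow_pow_three (A : Formula α) {k : ℕ} (hk : 1 ≤ k) :
    Nonempty (Retract ((A.pow k).pow 3) (A.pow (k * 3))) := by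
  obtain ⟨k, rfl⟩ := Nat.exists_eq_add_of_le' hk
  obtain ⟨r⟩ := nonempty_pow_with_pow A k k
  obtain ⟨s⟩ := nonempty_pow_with_pow A k (k + k + 1)
  rw [show (k + 1) * 3 = k + (k + k + 1) + 2 by ring]
  exact ⟨(r.prodRight (A.pow (k + 1))).trans s⟩

/-- The tree `stepTerm` as a proof. -/
def stepProof {A B : Formula α} (r : Retract (A.pow 3) B) {m : ℕ} (δ : Transition (m + 1)) :
    LLProof [(0, Tur (m + 1) B)] (Tur (m + 1) A) where
  term := r.stepTerm δ
  derivation := by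
    simpa [r.stepTerm_fv, ctxOf] using
      (r.stepTerm_WT δ (ρ := fun _ => Tur (m + 1) B) rfl).derivation

end Retract

/-! ### Iterated transitions -/

/-- The tree `t` of `Tur (m + 1) B ⊢ Tur (m + 1) A` encodes `p` transitions, up to typed
equivalence. -/
def Simulates {m : ℕ} (δ : Transition (m + 1)) (p : ℕ) (B A : Formula α) (t : Term α) : Prop :=
  ∀ (ρ : ℕ → Formula α) (c : Config (m + 1)), TEq ρ (Tur (m + 1) A)
    (.cut (Tur (m + 1) B) (configProof B c).term 0 t)
    (configProof A ((stepConfig δ)^[p] c)).term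

namespace Simulates

variable {m : ℕ} {δ : Transition (m + 1)} {p q : ℕ} {A B C : Formula α}

theorem encodesSteps {π : LLProof [(0, Tur (m + 1) B)] (Tur (m + 1) A)}
    (h : Simulates δ p B A π.term) : EncodesSteps δ p π := fun c =>
  (h (fun _ => Tur (m + 1) A) c).equivalent ((h (fun _ => Tur (m + 1) A) c).fv.trans
    (Retract.configProof_fv _))

theorem cut {t u : Term α} (ht : Simulates δ p C B t) (hu : Simulates δ q B A u)
    (htv : t.fv ⊆ {0}) : Simulates δ (q + p) C A (.cut (Tur (m + 1) B) t 0 u) := fun ρ c => by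
  have h1 := (ht ρ c).left
  have h2 := (hu ρ c).left
  have hw : (Term.cut (Tur (m + 1) C) (configProof C c).term 0
      (.cut (Tur (m + 1) B) t 0 u)).WT ρ (Tur (m + 1) A) := by
    refine ⟨h1.1, ⟨h1.2.1, by simpa using h2.2.1, h2.2.2.1, ?_⟩, ?_,
      by simp [Retract.configProof_fv]⟩
    · exact fun y hy _ => by simpa using htv hy
    · simp [Term.fv, h1.2.2.1]
  rw [Function.iterate_add_apply]
  have h := Fwd.cut_assoc_symm (.inr rfl) ρ _ hw
  exact h.trans (((ht ρ c).cutL h.right).trans (hu ρ _))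

end Simulates

theorem Retract.simulates_stepProof {A B : Formula α} (r : Retract (A.pow 3) B) {m : ℕ}
    (δ : Transition (m + 1)) : Simulates δ 1 B A (r.stepProof δ).term :=
  fun _ c => r.cut_stepTerm δ c

section Turing

variable {m : ℕ} (δ : Transition (m + 1)) (A : Formula α)

theorem simulates_cutSteps (p : ℕ) : Simulates δ (p + 1) (A.cubed (p + 1)) A
    (cutSteps (fun B => (Retract.refl (B.pow 3)).stepProof δ) A p).term := by
  induction p with
  | zero => exact Retract.simulates_stepProof _ δ
  | succ p ih =>
    -- The transition on the outermost formula acts first on the configuration.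
    exact (Retract.simulates_stepProof _ δ).cut ih (Retract.stepTerm_fv _ δ).le

theorem exists_simulates_pow (p : ℕ) :
    ∃ π : LLProof [(0, Tur (m + 1) (A.pow (3 ^ (p + 1))))] (Tur (m + 1) A),
      Simulates δ (p + 1) (A.pow (3 ^ (p + 1))) A π.term := by
  induction p with
  | zero => exact ⟨(Retract.refl (A.pow 3)).stepProof δ, Retract.simulates_stepProof _ δ⟩
  | succ p ih =>
    obtain ⟨π, hπ⟩ := ih
    obtain ⟨r⟩ := Retract.nonempty_pow_pow_three A (Nat.one_le_pow (p + 1) 3 (by simp))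
    exact ⟨(r.stepProof δ).cut π,
      (Retract.simulates_stepProof r δ).cut hπ (Retract.stepTerm_fv r δ).le⟩

end Turing

end ILL

theorem mainTheorem2 {α : Type*} (n : ℕ) (hn : 1 ≤ n) (δ : Transition n) :
    ∃ step : ∀ A : Formula α, LLProof [(0, Tur n (A.pow 3))] (Tur n A),
      ∀ A : Formula α,
        (∀ p : ℕ, EncodesSteps δ (p + 1) (cutSteps step A p)) ∧
        (∀ p : ℕ, 1 ≤ p →
          ∃ pStep : LLProof [(0, Tur n (A.pow (3 ^ p)))] (Tur n A), EncodesSteps δ p pStep) := by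
  obtain ⟨m, rfl⟩ := Nat.exists_eq_add_of_le' hn
  refine ⟨fun A => (Retract.refl (A.pow 3)).stepProof δ, fun A =>
    ⟨fun p => (simulates_cutSteps δ A p).encodesSteps, fun p hp => ?_⟩⟩
  obtain ⟨p, rfl⟩ := Nat.exists_eq_add_of_le' hp
  obtain ⟨π, hπ⟩ := exists_simulates_pow δ A p
  exact ⟨π, hπ.encodesSteps⟩
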